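/- **Setting.** Let $U$ be an open set of points $u=(x,y)\in\mathbb R^n\times\mathbb R^n$ (an adapted chart of a manifold $\mathbf V^{n+n}$), and let $N_i^a(u)$ be smooth coefficients of an N-connection, with N-adapted frame $\mathbf e_i=\partial_{x^i}-N_i^a\partial_{y^a}$, $e_a=\partial_{y^a}$ and N-elongated derivatives $\mathbf e_\nu f$. Let $g_{ij}=g_{ji}$ (nondegenerate) and $a_{ij}=-a_{ji}$ (of rank $n-k$) be smooth on $U$. Suppose that there are smooth $\xi_1,\dots,\xi_k$ with $a\xi=0$, ${}^t\xi g\xi=1$. Put $\eta={}^t(g\xi)$, $l=\xi\eta$, $m=1-l$, and let $\check a$ be the matrix with $a\check a={}^tm$, $l\check a=0$ (the upper left block of $\begin{pmatrix}a&-{}^t\eta\\ \eta&0\end{pmatrix}^{-1}$). The d-metric $\check{\mathbf g}=\mathbf g+\mathbf a$ has horizontal and vertical blocks both equal to $g_{ij}+a_{ij}$ and no mixed components in the N-adapted coframe. Assume that it is natural (a symmetric Obata operator $O^{ir}_{sj}=\frac12(\delta^i_s\delta^r_j\pm g_{sj}g^{ir})$ commutes with a skew-symmetric one $\Phi=\frac12(\delta^i_s\delta^r_j\pm(l^i_sl^r_j+a_{sj}\check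 a^{ir}))$ or $\Psi=\Phi\pm\frac12(l^i_sm^r_j+m^i_sl^r_j)$) and of elliptic or hyperbolic type: $g_{ir}g_{js}\check a^{rs}=\nu a_{ij}$ with $\nu=\mp c^2$, $c\neq0$ constant. A d-connection ${}_\circ\Gamma=({}_\circ L^i_{jk},{}_\circ C^a_{bc})$ (with the coefficients $L^a_{bk}$, $C^i_{jc}$ equal to these under the identification of $h$- and $v$-indices) determines $${}_*L^i_{jk}={}_\circ L^i_{jk}+\tfrac12\big[g^{ir}{}_\circ D_kg_{rj}+{}^-O^{ir}_{sj}(\check a^{st}{}_\circ D_ka_{tr}+3l^s_t{}_\circ D_kl^t_r-{}_\circ D_kl^s_r)\big],$$ and ${}_*C^a_{bc}$ by the same formula with ${}_\circ C$ and ${}_\circ D_c$, where ${}^-O^{ir}_{sj}=\frac12(\delta^i_s\delta^r_j-g_{sj}g^{ir})$. **Theorem.** (1) For every smooth ${}_\circ\Gamma$, ${}_*\Gamma=({}_*L,{}_*C)$ is a smooth linear connection which preserves the horizontal and the vertical distribution, makes the almost complex structure $\mathbf e_i\mapsto-\partial_{y^i}$, $\partial_{y^i}\mapsto\mathbf e_i$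 parallel, satisfies ${}_*\mathbf D\check{\mathbf g}=0$, and does not depend on the choice of $\xi$. (2) Let $n=2$ and let $g+a$ be nondegenerate on $U$. Write $\check{\mathbf g}^{\mu\nu}\check{\mathbf g}_{\sigma\nu}=\delta^\mu_\sigma$, $|\check{\mathbf g}|=|\det\check{\mathbf g}_{\mu\nu}|$, and let $W$ be a smooth connection with $$W^\lambda_{\mu\nu}={}_*\Gamma^\lambda_{\mu\nu}-\tfrac23\delta^\lambda_\mu W_\nu,\qquad W_\nu=W^\lambda_{[\nu\lambda]}.$$ Then ${}_*\Gamma^\lambda_{[\nu\lambda]}=0$. For all constants $\lambda,\mu$ and every source $\Upsilon_{\mu\nu}$, the fields $(\check{\mathbf g},W)$ satisfy the N-adapted Euler–Lagrange equations $\frac{\partial\mathcal L}{\partial\varphi}-\mathbf e_\rho\frac{\partial\mathcal L}{\partial(\mathbf e_\rho\varphi)}=0$ (all components of the metric and of the connection $W$ varied independently, then evaluated at $(\check{\mathbf g},W)$) of $$\mathcal L=\sqrt{|\check{\mathbf g}|}\Big(\check{\mathbf g}^{\mu\nu}{}_WR_{\mu\nu}-2\lambda-\tfrac{\mu^2}4\check{\mathbf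 g}^{\mu\nu}\check{\mathbf g}_{[\nu\mu]}-\tfrac16\check{\mathbf g}^{\mu\nu}W_\mu W_\nu\Big)-8\pi\check{\mathbf g}^{\mu\nu}\sigma_{\mu\nu},$$ where the source density $\sigma=\sqrt{|\check{\mathbf g}|}\Upsilon$ is held fixed, if and only if $${}_WG_{\mu\nu}+\lambda\check{\mathbf g}_{\mu\nu}+\tfrac{\mu^2}4S_{\mu\nu}-\tfrac16\,{}_PG_{\mu\nu}=8\pi\Upsilon_{\mu\nu},\qquad 2\mathbf e_\nu\big(\sqrt{|\check{\mathbf g}|}\check{\mathbf g}^{[\nu\mu]}\big)=\sqrt{|\check{\mathbf g}|}\check{\mathbf g}^{(\nu\mu)}W_\nu,$$ $$\tfrac1{\sqrt{|\check{\mathbf g}|}}\mathbf e_\sigma\big(\sqrt{|\check{\mathbf g}|}\check{\mathbf g}^{\mu\nu}\big)+\check{\mathbf g}^{\rho\nu}W^\mu_{\rho\sigma}+\check{\mathbf g}^{\mu\rho}W^\nu_{\sigma\rho}-\check{\mathbf g}^{\mu\nu}W^\rho_{\sigma\rho}+\tfrac16W_\beta\big(\delta^\nu_\sigma\check{\mathbf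 g}^{(\mu\beta)}-\delta^\mu_\sigma\check{\mathbf g}^{(\nu\beta)}\big)+\tfrac23\delta^\nu_\sigma\check{\mathbf g}^{\mu\rho}W^\beta_{[\rho\beta]}=0.$$ Here ${}_WR_{\mu\nu}={}_\Gamma R_{\mu\nu}+\frac23\mathbf e_{[\nu}W_{\mu]}$ with $\Gamma^\lambda_{\mu\nu}=W^\lambda_{\mu\nu}+\frac23\delta^\lambda_\mu W_\nu$ (which is ${}_*\Gamma$ at the given fields) and ${}_\Gamma R_{\mu\nu}=\mathbf e_\beta\Gamma^\beta_{\mu\nu}-\frac12(\mathbf e_\nu\Gamma^\lambda_{(\mu\lambda)}+\mathbf e_\mu\Gamma^\lambda_{(\nu\lambda)})-\Gamma^\beta_{\alpha\nu}\Gamma^\alpha_{\mu\beta}+\Gamma^\lambda_{(\alpha\lambda)}\Gamma^\alpha_{\mu\nu}$; ${}_WG_{\mu\nu}$ and ${}_PG_{\mu\nu}$ are $T_{\mu\nu}-\frac12\check{\mathbf g}_{\mu\nu}\check{\mathbf g}^{\alpha\beta}T_{\alpha\beta}$ for $T={}_WR$ and $T_{\mu\nu}=W_\mu W_\nu$; $S_{\mu\nu}=\mathbf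 a_{\mu\nu}+\check{\mathbf g}^{[\sigma\rho]}(\check{\mathbf g}_{\mu\sigma}\check{\mathbf g}_{\rho\nu}+\frac12\mathbf a_{\rho\sigma}\check{\mathbf g}_{\mu\nu})$, $\mathbf a_{\mu\nu}=\check{\mathbf g}_{[\mu\nu]}$; round and square brackets denote symmetrization and antisymmetrization with the factor $\frac12$. (3) In the situation of (2), the connections of the theory are completely determined by $N$ and $\check{\mathbf g}$: there are a smooth ${}_\circ\Gamma$ and a smooth $W$ which satisfy $W^\lambda_{\mu\nu}={}_*\Gamma^\lambda_{\mu\nu}-\frac23\delta^\lambda_\mu W_\nu$, $W_\nu=W^\lambda_{[\nu\lambda]}$, and the second field equation, and any two such choices of smooth ${}_\circ\Gamma$ and of $W$ give the same ${}_*\Gamma$ and the same $W$ on $U$. -/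

import Mathlib

open scoped ContDiff Matrix

noncomputable section

namespace NGT

/-- A coordinate domain of `V^{n+n}` is an open set of points `u = (x, y)`. -/
abbrev Chart (n : ℕ) : Type := (Fin n → ℝ) × (Fin n → ℝ)

/-- Frame indices: `Sum.inl i` is the horizontal index `i`, `Sum.inr a` the vertical index `a`. -/
abbrev Idx (n : ℕ) : Type := Fin n ⊕ Fin n

variable {n k : ℕ}

/-! ### N-connection, N-adapted frames, almost complex structure -/

/-- Coefficients of an N-connection: `N u a i` is `N_i^a(u)`. -/
abbrev NConnection (n : ℕ) : Type := Chart n → Fin n → Fin n → ℝ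

/-- The N-adapted frame `e_i = ∂/∂x^i - N_i^a ∂/∂y^a`, `e_a = ∂/∂y^a`. -/
def frame (N : NConnection n) (u : Chart n) : Idx n → Chart n
  | Sum.inl i => (Pi.single i 1, fun a => -N u a i)
  | Sum.inr a => (0, Pi.single a 1)

/-- The dual coframe `e^i = dx^i`, `e^a = dy^a + N_i^a dx^i`, evaluated on a tangent vector. -/
def coframe (N : NConnection n) (u : Chart n) (v : Chart n) : Idx n → ℝ
  | Sum.inl i => v.1 i
  | Sum.inr a => v.2 a + ∑ i, N u a i * v.1 i

/-- The N-elongated partial derivative `e_ν f`. -/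
def eD (N : NConnection n) (ν : Idx n) (f : Chart n → ℝ) (u : Chart n) : ℝ :=
  fderiv ℝ f u (frame N u ν)

/-- The horizontal subspace at `u`. -/
def horizontal (N : NConnection n) (u : Chart n) : Submodule ℝ (Chart n) :=
  Submodule.span ℝ (Set.range fun i : Fin n => frame N u (Sum.inl i))

/-- The vertical subspace at `u`. -/
def vertical (N : NConnection n) (u : Chart n) : Submodule ℝ (Chart n) :=
  Submodule.span ℝ (Set.range fun a : Fin n => frame N u (Sum.inr a))

/-- The almost complex structure with `F(e_i) = -∂/∂y^i` and `F(∂/∂y^i) = e_i`. -/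
def almostComplex (N : NConnection n) (u : Chart n) (v : Chart n) : Chart n :=
  ∑ i, (coframe N u v (Sum.inr i) • frame N u (Sum.inl i)
    - coframe N u v (Sum.inl i) • frame N u (Sum.inr i))

/-! ### Distinguished connections -/

/-- Coefficients `(L^i_{jk}, C^a_{bc})` of a d-connection: `L u i j k` is `L^i_{jk}(u)` and
`C u a b c` is `C^a_{bc}(u)`. -/
structure DConn (n : ℕ) where
  L : Chart n → Fin n → Fin n → Fin n → ℝ
  C : Chart n → Fin n → Fin n → Fin n → ℝ

/-- All coefficients in the N-adapted frame, `D_{e_ν} e_μ = Γ^γ_{μν} e_γ`; `coeff u γ μ ν` is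
`Γ^γ_{μν}(u)`. As usual on `V^{n+n}`, `L^a_{bk}` equals `L^i_{jk}` and `C^i_{jc}` equals
`C^a_{bc}` for `a = i`, `b = j`. -/
def DConn.coeff (D : DConn n) (u : Chart n) : Idx n → Idx n → Idx n → ℝ
  | Sum.inl i, Sum.inl j, Sum.inl l => D.L u i j l
  | Sum.inr i, Sum.inr j, Sum.inl l => D.L u i j l
  | Sum.inl i, Sum.inl j, Sum.inr l => D.C u i j l
  | Sum.inr i, Sum.inr j, Sum.inr l => D.C u i j l
  | Sum.inl _, Sum.inr _, _ => 0
  | Sum.inr _, Sum.inl _, _ => 0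

/-- Smoothness of the coefficients on `U`. -/
def DConn.IsSmoothOn (D : DConn n) (U : Set (Chart n)) : Prop :=
  (∀ i j l, ContDiffOn ℝ ∞ (fun u => D.L u i j l) U) ∧
    ∀ i j l, ContDiffOn ℝ ∞ (fun u => D.C u i j l) U

/-- The covariant derivative `D_X Y` of vector fields. -/
def covDeriv (N : NConnection n) (D : DConn n) (X Y : Chart n → Chart n) (u : Chart n) : Chart n :=
  ∑ γ, (fderiv ℝ (fun v => coframe N v (Y v) γ) u (X u)
    + ∑ μ, ∑ ν, D.coeff u γ μ ν * coframe N u (Y u) μ * coframe N u (X u) ν) • frame N u γ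

/-- `D` is a linear connection on `U` which preserves the horizontal and the vertical
distribution and for which the almost complex structure is parallel. -/
structure IsNormalDConnection (N : NConnection n) (U : Set (Chart n)) (D : DConn n) : Prop where
  smooth : ∀ X Y : Chart n → Chart n, ContDiffOn ℝ ∞ X U → ContDiffOn ℝ ∞ Y U →
    ContDiffOn ℝ ∞ (covDeriv N D X Y) U
  add_left : ∀ X Z Y : Chart n → Chart n, ∀ u ∈ U,
    covDeriv N D (X + Z) Y u = covDeriv N D X Y u + covDeriv N D Z Y u
  smul_left : ∀ (f : Chart n → ℝ) (X Y : Chart n → Chart n), ∀ u ∈ U,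
    covDeriv N D (fun v => f v • X v) Y u = f u • covDeriv N D X Y u
  add_right : ∀ X Y Z : Chart n → Chart n, ContDiffOn ℝ ∞ Y U → ContDiffOn ℝ ∞ Z U →
    ∀ u ∈ U, covDeriv N D X (Y + Z) u = covDeriv N D X Y u + covDeriv N D X Z u
  leibniz : ∀ (f : Chart n → ℝ) (X Y : Chart n → Chart n), ContDiffOn ℝ ∞ f U →
    ContDiffOn ℝ ∞ Y U → ∀ u ∈ U,
    covDeriv N D X (fun v => f v • Y v) u = fderiv ℝ f u (X u) • Y u + f u • covDeriv N D X Y u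
  preserves_horizontal : ∀ X Y : Chart n → Chart n, ContDiffOn ℝ ∞ Y U →
    (∀ u ∈ U, Y u ∈ horizontal N u) → ∀ u ∈ U, covDeriv N D X Y u ∈ horizontal N u
  preserves_vertical : ∀ X Y : Chart n → Chart n, ContDiffOn ℝ ∞ Y U →
    (∀ u ∈ U, Y u ∈ vertical N u) → ∀ u ∈ U, covDeriv N D X Y u ∈ vertical N u
  parallel_almostComplex : ∀ X Y : Chart n → Chart n, ContDiffOn ℝ ∞ Y U → ∀ u ∈ U,
    covDeriv N D X (fun v => almostComplex N v (Y v)) u = almostComplex N u (covDeriv N D X Y u)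

/-- The matrix `(Γ^i_{jγ})_{ij}` of the connection in the direction `e_γ`; it acts in the same way
on horizontal and on vertical tensors. -/
def DConn.dir (D : DConn n) (u : Chart n) : Idx n → Matrix (Fin n) (Fin n) ℝ
  | Sum.inl l => Matrix.of fun i j => D.L u i j l
  | Sum.inr l => Matrix.of fun i j => D.C u i j l

/-- `D_γ t_{ij}` for a d-tensor of type (0,2). -/
def DConn.covLow (D : DConn n) (N : NConnection n) (t : Chart n → Matrix (Fin n) (Fin n) ℝ)
    (γ : Idx n) (u : Chart n) (i j : Fin n) : ℝ :=
  eD N γ (fun v => t v i j) u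
    - ∑ s, D.dir u γ s i * t u s j - ∑ s, D.dir u γ s j * t u i s

/-- `D_γ t^i_j` for a d-tensor of type (1,1). -/
def DConn.covMixed (D : DConn n) (N : NConnection n) (t : Chart n → Matrix (Fin n) (Fin n) ℝ)
    (γ : Idx n) (u : Chart n) (i j : Fin n) : ℝ :=
  eD N γ (fun v => t v i j) u
    + ∑ s, D.dir u γ i s * t u s j - ∑ s, D.dir u γ s j * t u i s

/-! ### Nonsymmetric d-metrics -/

/-- `g + a` is a nonsymmetric d-metric of index `k` on `U`: `g` is symmetric and nondegenerate,
`a` is skew-symmetric of rank `n - k`. -/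
structure IsNonsymDMetric (U : Set (Chart n)) (k : ℕ)
    (g a : Chart n → Matrix (Fin n) (Fin n) ℝ) : Prop where
  smooth_sym : ∀ i j, ContDiffOn ℝ ∞ (fun u => g u i j) U
  smooth_skew : ∀ i j, ContDiffOn ℝ ∞ (fun u => a u i j) U
  symm : ∀ u ∈ U, (g u)ᵀ = g u
  skew : ∀ u ∈ U, (a u)ᵀ = -a u
  det_ne : ∀ u ∈ U, (g u).det ≠ 0
  rank_eq : ∀ u ∈ U, (a u).rank + k = n

/-- The components of the d-metric in the N-adapted coframe: the horizontal and the vertical block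
are both `g_{ij} + a_{ij}`, the mixed blocks vanish. -/
def fullMetric (g a : Chart n → Matrix (Fin n) (Fin n) ℝ) (u : Chart n) : Idx n → Idx n → ℝ
  | Sum.inl i, Sum.inl j => g u i j + a u i j
  | Sum.inr i, Sum.inr j => g u i j + a u i j
  | Sum.inl _, Sum.inr _ => 0
  | Sum.inr _, Sum.inl _ => 0

/-- The connection is compatible with a (nonsymmetric) metric with N-adapted components `G`:
`e_ν G_{αβ} - Γ^γ_{αν} G_{γβ} - Γ^γ_{βν} G_{αγ} = 0`. -/
def IsMetricCompatible (N : NConnection n) (U : Set (Chart n)) (D : DConn n)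
    (G : Chart n → Idx n → Idx n → ℝ) : Prop :=
  ∀ u ∈ U, ∀ ν α β, eD N ν (fun v => G v α β) u
    - ∑ γ, D.coeff u γ α ν * G u γ β - ∑ γ, D.coeff u γ β ν * G u α γ = 0

/-- Smooth d-vector fields `ξ_1, …, ξ_k` (the columns of `ξ`) with `a ξ = 0`, `ᵗξ g ξ = 1`. -/
structure IsKernelFrame (U : Set (Chart n)) (g a : Chart n → Matrix (Fin n) (Fin n) ℝ)
    (ξ : Chart n → Matrix (Fin n) (Fin k) ℝ) : Prop where
  smooth : ∀ i p, ContDiffOn ℝ ∞ (fun u => ξ u i p) U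
  kernel : ∀ u ∈ U, a u * ξ u = 0
  orthonormal : ∀ u ∈ U, (ξ u)ᵀ * g u * ξ u = 1

/-- `η`, with `ᵗη = g ξ`. -/
def etaMat (g : Matrix (Fin n) (Fin n) ℝ) (ξ : Matrix (Fin n) (Fin k) ℝ) :
    Matrix (Fin k) (Fin n) ℝ := (g * ξ)ᵀ

/-- The projector `l = ξ η` onto the kernel of `a`. -/
def lMat (g : Matrix (Fin n) (Fin n) ℝ) (ξ : Matrix (Fin n) (Fin k) ℝ) :
    Matrix (Fin n) (Fin n) ℝ := ξ * etaMat g ξ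

/-- The complementary projector `m = 1 - l`. -/
def mMat (g : Matrix (Fin n) (Fin n) ℝ) (ξ : Matrix (Fin n) (Fin k) ℝ) :
    Matrix (Fin n) (Fin n) ℝ := 1 - lMat g ξ

/-- The d-tensor `ǎ^{ij}`: the upper left block of the inverse of the nonsingular skew-symmetric
extension of `a` by `η`. It is the only matrix with `a ǎ = ᵗm` and `l ǎ = 0`. -/
def aCheck (g a : Matrix (Fin n) (Fin n) ℝ) (ξ : Matrix (Fin n) (Fin k) ℝ) :
    Matrix (Fin n) (Fin n) ℝ :=
  (Matrix.fromBlocks a (-(etaMat g ξ)ᵀ) (etaMat g ξ) 0)⁻¹.toBlocks₁₁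

/-! ### Obata operators -/

/-- Operators on d-tensors `X^s_r`; `T i r s j` is the component `T^{ir}_{sj}`, and
`(T X)^i_j = T^{ir}_{sj} X^s_r`. -/
abbrev Tensor22 (n : ℕ) : Type := Fin n → Fin n → Fin n → Fin n → ℝ

def delta {ι : Type*} [DecidableEq ι] (i j : ι) : ℝ := if i = j then 1 else 0

/-- The product of operators, `(A B)^{im}_{sj} = A^{ir}_{tj} B^{tm}_{sr}`. -/
def Tensor22.comp (A B : Tensor22 n) : Tensor22 n :=
  fun i m s j => ∑ t, ∑ r, A i r t j * B t m s r

/-- The symmetric Obata operators, `ε = 1` or `ε = -1`. -/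
def obataO (ε : ℝ) (g : Matrix (Fin n) (Fin n) ℝ) : Tensor22 n :=
  fun i r s j => (1 / 2) * (delta s i * delta j r + ε * (g s j * g⁻¹ i r))

/-- The skew-symmetric Obata operators `Φ`. -/
def obataPhi (ε : ℝ) (g a : Matrix (Fin n) (Fin n) ℝ) (ξ : Matrix (Fin n) (Fin k) ℝ) :
    Tensor22 n :=
  fun i r s j => (1 / 2) * (delta s i * delta j r
    + ε * (lMat g ξ i s * lMat g ξ r j + a s j * aCheck g a ξ i r))

/-- The operator `θ`. -/
def obataTheta (g : Matrix (Fin n) (Fin n) ℝ) (ξ : Matrix (Fin n) (Fin k) ℝ) : Tensor22 n :=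
  fun i r s j => (1 / 2) * (lMat g ξ i s * mMat g ξ r j + mMat g ξ i s * lMat g ξ r j)

/-- The skew-symmetric Obata projectors `Ψ = Φ ± θ`. -/
def obataPsi (ε : ℝ) (g a : Matrix (Fin n) (Fin n) ℝ) (ξ : Matrix (Fin n) (Fin k) ℝ) :
    Tensor22 n :=
  fun i r s j => obataPhi ε g a ξ i r s j + ε * obataTheta g ξ i r s j

/-- The d-metric is natural: a symmetric Obata operator commutes with a skew-symmetric one. -/
def IsNatural (U : Set (Chart n)) (g a : Chart n → Matrix (Fin n) (Fin n) ℝ)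
    (ξ : Chart n → Matrix (Fin n) (Fin k) ℝ) : Prop :=
  ∃ ε ∈ ({1, -1} : Set ℝ), ∃ ε₁ ∈ ({1, -1} : Set ℝ),
    (∀ u ∈ U, (obataO ε (g u)).comp (obataPhi ε₁ (g u) (a u) (ξ u))
      = (obataPhi ε₁ (g u) (a u) (ξ u)).comp (obataO ε (g u))) ∨
    (∀ u ∈ U, (obataO ε (g u)).comp (obataPsi ε₁ (g u) (a u) (ξ u))
      = (obataPsi ε₁ (g u) (a u) (ξ u)).comp (obataO ε (g u)))

/-- The d-metric is natural and of elliptic (`ν = -c²`) or hyperbolic (`ν = c²`) type, where `ν` is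
the factor in `g_{ir} g_{js} ǎ^{rs} = ν a_{ij}` and `c` is a nonzero constant. -/
def IsEllipticOrHyperbolic (U : Set (Chart n)) (g a : Chart n → Matrix (Fin n) (Fin n) ℝ)
    (ξ : Chart n → Matrix (Fin n) (Fin k) ℝ) : Prop :=
  IsNatural U g a ξ ∧ ∃ c : ℝ, c ≠ 0 ∧ ∃ ν ∈ ({-c ^ 2, c ^ 2} : Set ℝ), ∀ u ∈ U, ∀ i j,
    ∑ r, ∑ s, g u i r * g u j s * aCheck (g u) (a u) (ξ u) r s = ν * a u i j

/-! ### The metric compatible d-connection -/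

/-- The deformation of the matrix of a d-connection `D` in the direction `e_γ`:
`½ [g^{ir} D_γ g_{rj} + O^{ir}_{sj} (ǎ^{st} D_γ a_{tr} + 3 l^s_t D_γ l^t_r - D_γ l^s_r)]`, where
`O` is the Obata projector with the minus sign. -/
def deformation (N : NConnection n) (g a : Chart n → Matrix (Fin n) (Fin n) ℝ)
    (ξ : Chart n → Matrix (Fin n) (Fin k) ℝ) (D : DConn n) (γ : Idx n) (u : Chart n)
    (i j : Fin n) : ℝ :=
  (1 / 2) * (∑ r, (g u)⁻¹ i r * D.covLow N g γ u r j
    + ∑ s, ∑ r, obataO (-1) (g u) i r s j *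
      (∑ t, aCheck (g u) (a u) (ξ u) s t * D.covLow N a γ u t r
        + 3 * ∑ t, lMat (g u) (ξ u) s t * D.covMixed N (fun v => lMat (g v) (ξ v)) γ u t r
        - D.covMixed N (fun v => lMat (g v) (ξ v)) γ u s r))

/-- The d-connection `*Γ = (*L, *C)` obtained from an arbitrary d-connection `D`. -/
def starConn (N : NConnection n) (g a : Chart n → Matrix (Fin n) (Fin n) ℝ)
    (ξ : Chart n → Matrix (Fin n) (Fin k) ℝ) (D : DConn n) : DConn n where
  L := fun u i j l => D.L u i j l + deformation N g a ξ D (Sum.inl l) u i j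
  C := fun u i j l => D.C u i j l + deformation N g a ξ D (Sum.inr l) u i j

/-! ### Nonsymmetric gravity in N-adapted frames -/

/-- The inverse metric, normalised by `G^{μν} G_{σν} = δ^μ_σ`. -/
def invMetric (G : Idx n → Idx n → ℝ) (μ ν : Idx n) : ℝ := (Matrix.of G)⁻¹ ν μ

/-- The volume factor, the square root of `|det G|`. -/
def vol (G : Idx n → Idx n → ℝ) : ℝ := Real.sqrt |(Matrix.of G).det|

/-- Symmetric and skew-symmetric part. -/
def symPart (T : Idx n → Idx n → ℝ) (μ ν : Idx n) : ℝ := (1 / 2) * (T μ ν + T ν μ)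

def skewPart (T : Idx n → Idx n → ℝ) (μ ν : Idx n) : ℝ := (1 / 2) * (T μ ν - T ν μ)

/-- `W_ν = ½ (W^γ_{νγ} - W^γ_{γν}) = W^γ_{[νγ]}`. -/
def traceVec (W : Idx n → Idx n → Idx n → ℝ) (ν : Idx n) : ℝ :=
  (1 / 2) * ∑ γ, (W γ ν γ - W γ γ ν)

/-- `Γ^γ_{μν} = W^γ_{μν} + ⅔ δ^γ_μ W_ν`. -/
def gammaOf (W : Idx n → Idx n → Idx n → ℝ) (γ μ ν : Idx n) : ℝ :=
  W γ μ ν + (2 / 3) * (delta γ μ * traceVec W ν)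

/-- `W` is the unconstrained connection belonging to `Γ`: `W^γ_{μν} = Γ^γ_{μν} - ⅔ δ^γ_μ W_ν`
with `W_ν = W^γ_{[νγ]}`. -/
def IsUnconstrainedOf (U : Set (Chart n)) (Γ W : Chart n → Idx n → Idx n → Idx n → ℝ) : Prop :=
  ∀ u ∈ U, ∀ γ μ ν, W u γ μ ν = Γ u γ μ ν - (2 / 3) * (delta γ μ * traceVec (W u) ν)

/-- The contracted curvature `_ΓR_{μν}`, as a function of the coefficients `Γ` and of their
derivatives, `dΓ ρ γ μ ν = e_ρ Γ^γ_{μν}`. -/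
def ricciGamma (Γ : Idx n → Idx n → Idx n → ℝ) (dΓ : Idx n → Idx n → Idx n → Idx n → ℝ)
    (μ ν : Idx n) : ℝ :=
  ∑ β, dΓ β β μ ν
    - (1 / 2) * (∑ γ, symPart (fun α β => dΓ ν γ α β) μ γ
      + ∑ γ, symPart (fun α β => dΓ μ γ α β) ν γ)
    - ∑ α, ∑ β, Γ β α ν * Γ α μ β
    + ∑ α, (∑ γ, symPart (Γ γ) α γ) * Γ α μ ν

/-- `_WR_{μν} = _ΓR_{μν} + ⅔ e_{[ν} W_{μ]}`, where `dw ρ μ = e_ρ W_μ`. -/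
def ricciW (Γ : Idx n → Idx n → Idx n → ℝ) (dΓ : Idx n → Idx n → Idx n → Idx n → ℝ)
    (dw : Idx n → Idx n → ℝ) (μ ν : Idx n) : ℝ :=
  ricciGamma Γ dΓ μ ν + (2 / 3) * skewPart dw ν μ

/-- Values of the fields: N-adapted components of a nonsymmetric metric `G_{μν}` and of a
connection `W^γ_{μν}`. -/
abbrev Field (n : ℕ) : Type := (Idx n → Idx n → ℝ) × (Idx n → Idx n → Idx n → ℝ)

/-- The Lagrangian density as a function of the values `p` of the fields and the values `q` of
their N-elongated derivatives; `lam` is the cosmological constant, `mu` the constant of the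
skew-symmetric part, `σ` the source density. -/
def lagrangian (lam mu : ℝ) (σ : Idx n → Idx n → ℝ) (p : Field n) (q : Idx n → Field n) : ℝ :=
  vol p.1 * ∑ μ, ∑ ν, invMetric p.1 μ ν *
      ricciW (gammaOf p.2) (fun ρ => gammaOf (q ρ).2) (fun ρ => traceVec (q ρ).2) μ ν
    - 2 * lam * vol p.1
    - mu ^ 2 / 4 * (vol p.1 * ∑ μ, ∑ ν, invMetric p.1 μ ν * skewPart p.1 ν μ)
    - 1 / 6 * (vol p.1 * ∑ μ, ∑ ν, invMetric p.1 μ ν * (traceVec p.2 μ * traceVec p.2 ν))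
    - 8 * Real.pi * ∑ μ, ∑ ν, invMetric p.1 μ ν * σ μ ν

/-- The N-elongated derivatives `e_ρ φ` of the fields. -/
def jet (N : NConnection n) (φ : Chart n → Field n) (u : Chart n) : Idx n → Field n :=
  fun ρ => fderiv ℝ φ u (frame N u ρ)

/-- The N-adapted variational principle: `φ` satisfies the Euler-Lagrange equations
`∂𝓛/∂φ - e_ρ (∂𝓛/∂(e_ρ φ)) = 0` on `U`, where partial derivatives are replaced by N-elongated
ones and all components of the fields are varied independently. -/
def IsNStationary (N : NConnection n) (U : Set (Chart n))
    (𝓛 : Chart n → Field n → (Idx n → Field n) → ℝ) (φ : Chart n → Field n) : Prop :=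
  ∀ u ∈ U, ∀ h : Field n,
    fderiv ℝ (fun p => 𝓛 u p (jet N φ u)) (φ u) h
      - ∑ ρ, eD N ρ (fun v => fderiv ℝ (fun q => 𝓛 v (φ v) q) (jet N φ v) (Pi.single ρ h)) u = 0

/-- `_WR_{μν}` of the connections `Γ`, `W` at `u`. -/
def ricciWAt (N : NConnection n) (Γ W : Chart n → Idx n → Idx n → Idx n → ℝ) (u : Chart n)
    (μ ν : Idx n) : ℝ :=
  ricciW (Γ u) (fun ρ γ α β => eD N ρ (fun v => Γ v γ α β) u)
    (fun ρ α => eD N ρ (fun v => traceVec (W v) α) u) μ ν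

/-- `T_{μν} - ½ G_{μν} G^{αβ} T_{αβ}`. -/
def traceReversed (G T : Idx n → Idx n → ℝ) (μ ν : Idx n) : ℝ :=
  T μ ν - (1 / 2) * (G μ ν * ∑ α, ∑ β, invMetric G α β * T α β)

/-- `S_{μν} = a_{μν} + G^{[σρ]} (G_{μσ} G_{ρν} + ½ a_{ρσ} G_{μν})`, `a_{μν} = G_{[μν]}`. -/
def massTensor (G : Idx n → Idx n → ℝ) (μ ν : Idx n) : ℝ :=
  skewPart G μ ν + ∑ ρ, ∑ σ, skewPart (invMetric G) σ ρ *
    (G μ σ * G ρ ν + (1 / 2) * (skewPart G ρ σ * G μ ν))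

/-- `2 e_ν (√|G| G^{[νμ]}) = √|G| G^{(νμ)} W_ν` on `U`. -/
def SkewFieldEquation (N : NConnection n) (U : Set (Chart n)) (G : Chart n → Idx n → Idx n → ℝ)
    (W : Chart n → Idx n → Idx n → Idx n → ℝ) : Prop :=
  ∀ u ∈ U, ∀ μ, 2 * ∑ ν, eD N ν (fun v => vol (G v) * skewPart (invMetric (G v)) ν μ) u
    = vol (G u) * ∑ ν, symPart (invMetric (G u)) ν μ * traceVec (W u) ν

/-- The N-adapted field equations of nonsymmetric gravity with source `Y_{μν}`, for the metric `G`
and the connections `Γ`, `W`. -/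
structure FieldEquations (N : NConnection n) (U : Set (Chart n)) (lam mu : ℝ)
    (Y : Chart n → Idx n → Idx n → ℝ) (G : Chart n → Idx n → Idx n → ℝ)
    (Γ W : Chart n → Idx n → Idx n → Idx n → ℝ) : Prop where
  metric_eq : ∀ u ∈ U, ∀ μ ν,
    traceReversed (G u) (ricciWAt N Γ W u) μ ν + lam * G u μ ν + mu ^ 2 / 4 * massTensor (G u) μ ν
      - 1 / 6 * traceReversed (G u) (fun α β => traceVec (W u) α * traceVec (W u) β) μ ν
      = 8 * Real.pi * Y u μ ν
  skew_eq : SkewFieldEquation N U G W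
  connection_eq : ∀ u ∈ U, ∀ μ ν σ,
    (vol (G u))⁻¹ * eD N σ (fun v => vol (G v) * invMetric (G v) μ ν) u
      + ∑ ρ, invMetric (G u) ρ ν * W u μ ρ σ
      + ∑ ρ, invMetric (G u) μ ρ * W u ν σ ρ
      - invMetric (G u) μ ν * ∑ ρ, W u ρ σ ρ
      + 1 / 6 * ∑ β, traceVec (W u) β * (delta ν σ * symPart (invMetric (G u)) μ β
          - delta μ σ * symPart (invMetric (G u)) ν β)
      + 2 / 3 * (delta ν σ * ∑ ρ, invMetric (G u) μ ρ * traceVec (W u) ρ) = 0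

end NGT

end

/-!
Write `A = g⁻¹ a`; adjoints are taken with respect to `g`. The block inverse defining `ǎ`
gives `a ǎ = ᵗm`, `ǎ a = m` and `l ǎ = 0` (`pointFacts`); these determine `l` and `ǎ` from `g` and
`a` alone, so nothing depends on `ξ`. The type condition says `ǎ = ν g⁻¹ a g⁻¹`, that is
`ν A² = m = 1 - l` with `A l = l A = 0`.

*Compatibility.* The deformation `Δ` is `½ g⁻¹ Dg` plus one half of the skew-adjoint part of
`X = ǎ Da + 3 l Dl - Dl`. The first summand alone makes the symmetric metric parallel
(`covDeriv_symm_deformed`). Modulo a commuting correction built from `g⁻¹ Dg`, the second one is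
`¼ (ν [A, DA] + 3 [l, Dl])`, and differentiating `ν A² = 1 - l` and `A l = l A = 0` turns
`DA + [Δ, A] = 0` into an identity of matrices (`add_commutator_eq_zero`). A connection for which
`g` and `a` are already parallel has `Dl = 0`, hence `Δ = 0` (`Setup.star_eq_self`).

*Euler-Lagrange equations.* Put `𝔤 = √|G| G^{μν}`. The Lagrangian is affine in the derivatives of
the fields with coefficients linear in `𝔤`, so the divergence term only involves `e_ρ 𝔤^{μν}`.
Varying the metric by `δG = -G H G` gives the metric equation (`fderiv_lagrangian_metric`). For the
connection, `W ↦ (Γ, W_ν)` is, in four dimensions, a bijection onto pairs of a connection with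
vanishing torsion trace and a covector. Varying `W_ν` gives the skew field equation; varying `Γ`
gives an equation up to a multiplier for the trace constraint, and contracting it with the help of
the skew equation evaluates the multiplier (`variation_eq_zero_iff`).

*Determination of the connections.* In four dimensions `W_ν = W^γ_{[νγ]}` forces the torsion trace
of `Γ` to vanish (`traceVec_eq_zero_of_unconstrained`). On a two-dimensional block two connections
compatible with `g` differ by `g⁻¹ ε ⊗ s`, and the trace condition is a nonsingular linear system
for `s` (`eq_zero_of_normalTrace`, `normalTrace_rotTensor`); adding such a term keeps `a = f ε`
parallel. Finally `G^{(νμ)}` is nonsingular since `G^{-1} + ᵗG^{-1} = G^{-1} (G + ᵗG) ᵗG^{-1}`, so the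
skew field equation has exactly one solution `W_ν` (`det_symPart_inv_ne_zero`).
-/

namespace NGT

/-! ### Algebra of the deformation tensor -/

/-- For a connection deformed by `Δ = ½ (g⁻¹ Dg + ½ (X - X*))`, where `X* = g⁻¹ ᵗX g` is the adjoint,
the derivative `Dg - ᵗΔ g - g Δ` of `g` vanishes whatever `X` is: the skew-adjoint summand does not
contribute. Here `p = g⁻¹`. -/
theorem covDeriv_symm_deformed {n : ℕ} {g p X Dg : Matrix (Fin n) (Fin n) ℝ} (hgp : g * p = 1)
    (hg : gᵀ = g) (hp : pᵀ = p) (hDg : Dgᵀ = Dg) :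
    Dg - ((1 / 2 : ℝ) • (p * Dg + (1 / 2 : ℝ) • (X - p * Xᵀ * g)))ᵀ * g
      - g * ((1 / 2 : ℝ) • (p * Dg + (1 / 2 : ℝ) • (X - p * Xᵀ * g))) = 0 := by
  have hpg : p * g = 1 := mul_eq_one_comm.mp hgp
  simp only [Matrix.transpose_smul, Matrix.transpose_add, Matrix.transpose_sub,
    Matrix.transpose_mul, Matrix.transpose_transpose, hg, hp, hDg]
  have e1 : g * (p * Dg) = Dg := by rw [← mul_assoc, hgp, one_mul]
  have e2 : g * (p * Xᵀ * g) = Xᵀ * g := by rw [mul_assoc p, ← mul_assoc, hgp, one_mul]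
  have e3 : Dg * p * g = Dg := by rw [mul_assoc, hpg, mul_one]
  have e4 : g * (X * p) * g = g * X := by rw [mul_assoc, mul_assoc, hpg, mul_one]
  simp only [smul_mul_assoc, mul_smul_comm, mul_add, add_mul, mul_sub, sub_mul, e1, e2, e3, e4]
  module

/-- The commutator identity behind `*D a = 0`. Here `A = g⁻¹ a`, `DA` and `Dl` are its covariant
derivative and that of `l`, and `E = g⁻¹ Dg`. The summands containing `E` commute with `A`, and the
other ones give `[Δ, A] = -DA` by means of the differentiated relations `hD`, `hDAl`, `hDlA`. -/
theorem add_commutator_eq_zero {n : ℕ} {A l DA Dl E : Matrix (Fin n) (Fin n) ℝ} {ν : ℝ}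
    (hAA : ν • (A * A) = 1 - l) (hAl : A * l = 0) (hlA : l * A = 0)
    (hD : ν • (DA * A + A * DA) = -Dl) (hDAl : DA * l + A * Dl = 0) (hDlA : Dl * A + l * DA = 0)
    {Δ : Matrix (Fin n) (Fin n) ℝ} (hΔ : (4 : ℝ) • Δ = ν • (A * DA - DA * A)
      + (3 : ℝ) • (l * Dl - Dl * l) + (ν • (A * E * A) + E - E * l - l * E
        + (3 : ℝ) • (l * E * l))) :
    DA + Δ * A - A * Δ = 0 := by
  have hll : l * l = l := by
    have := congrArg (l * ·) hAA
    simp only [mul_smul_comm, ← mul_assoc, hlA, zero_mul, smul_zero, mul_sub, mul_one] at this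
    exact (sub_eq_zero.mp this.symm).symm
  have h4 : (4 : ℝ) • (DA + Δ * A - A * Δ) = 0 := by
    linear_combination (norm := skip) hD * A + A * hD - (2 : ℝ) • (DA * hAA) - (2 : ℝ) • (hAA * DA)
      - hDlA - hDAl + (3 : ℝ) • (l * hDlA) + (3 : ℝ) • (hDAl * l) - (3 : ℝ) • (hll * DA)
      - (3 : ℝ) • (DA * hll) - (3 : ℝ) • (Dl * hlA) - (3 : ℝ) • (hAl * Dl) + A * E * hAA
      - hAA * (E * A) - E * hlA + (3 : ℝ) • (l * E * hlA) + hAl * E - (3 : ℝ) • (hAl * (E * l))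
      + hΔ * A - A * hΔ
    simp only [smul_mul_assoc, mul_smul_comm, mul_add, add_mul, mul_sub, sub_mul, mul_assoc,
      mul_one, one_mul, mul_zero, zero_mul, smul_zero, mul_neg, neg_mul]
    module
  simpa using h4

/-- The derivative of `a` for the deformed connection vanishes. The tensor `p Da - p Dg p a` is the
covariant derivative of `A = p a`, `p = g⁻¹`; the last hypotheses on it are the derivatives of
`ν A² = 1 - l` and `A l = l A = 0`. -/
theorem covDeriv_skew_deformed {n : ℕ} {g p a l Q Dg Da Dl : Matrix (Fin n) (Fin n) ℝ} {ν : ℝ}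
    (hgp : g * p = 1) (hg : gᵀ = g) (hp : pᵀ = p) (ha : aᵀ = -a)
    (hDg : Dgᵀ = Dg) (hDa : Daᵀ = -Da) (hl : lᵀ * g = g * l)
    (hDl : Dlᵀ * g + lᵀ * Dg = Dg * l + g * Dl)
    (hal : a * l = 0) (hla : l * p * a = 0) (hQ : Q = ν • (p * a * p)) (hQa : Q * a = 1 - l)
    (hD : ν • ((p * Da - p * Dg * p * a) * (p * a) + p * a * (p * Da - p * Dg * p * a)) = -Dl)
    (hDAl : (p * Da - p * Dg * p * a) * l + p * a * Dl = 0)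
    (hDlA : Dl * (p * a) + l * (p * Da - p * Dg * p * a) = 0)
    {X Δ : Matrix (Fin n) (Fin n) ℝ}
    (hX : X = Q * Da + (3 : ℝ) • (l * Dl) - Dl)
    (hΔ : Δ = (1 / 2 : ℝ) • (p * Dg + (1 / 2 : ℝ) • (X - p * Xᵀ * g))) :
    Da - Δᵀ * a - a * Δ = 0 := by
  have hpg : p * g = 1 := mul_eq_one_comm.mp hgp
  have hmet := covDeriv_symm_deformed (X := X) hgp hg hp hDg
  rw [← hΔ] at hmet
  obtain ⟨A, hA⟩ : ∃ A, A = p * a := ⟨_, rfl⟩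
  obtain ⟨E, hE⟩ : ∃ E, E = p * Dg := ⟨_, rfl⟩
  obtain ⟨DA, hDA⟩ : ∃ DA, DA = p * Da - p * Dg * p * a := ⟨_, rfl⟩
  rw [← hDA, ← hA] at hD
  rw [← hDA, ← hA] at hDAl hDlA
  have haA : a = g * A := by rw [hA, ← mul_assoc, hgp, one_mul]
  have hDgE : Dg = g * E := by rw [hE, ← mul_assoc, hgp, one_mul]
  have hDaA : Da = g * (DA + E * A) := by
    rw [hDA, hE, hA, ← mul_assoc (p * Dg), sub_add_cancel, ← mul_assoc, hgp, one_mul]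
  have hAt : Aᵀ = -(g * A * p) := by
    rw [hA, Matrix.transpose_mul, ha, hp, neg_mul, ← mul_assoc, hgp, one_mul]
  have hEt : Eᵀ = g * E * p := by
    rw [hE, Matrix.transpose_mul, hDg, hp, ← mul_assoc, hgp, one_mul]
  have hDAt : DAᵀ = g * (A * E - DA - E * A) * p := by
    have : DAᵀ = -(Da * p) + a * p * Dg * p := by
      rw [hDA]
      simp only [Matrix.transpose_sub, Matrix.transpose_mul, hp, hDg, ha, hDa, neg_mul, mul_assoc]
      abel
    rw [this, haA, hDgE, hDaA]
    have e : g * A * p * (g * E) * p = g * A * E * p := by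
      rw [mul_assoc (g * A), ← mul_assoc p g, hpg, one_mul]
    rw [e]
    noncomm_ring
  have hlt : lᵀ = g * l * p := by rw [← hl, mul_assoc, hgp, mul_one]
  have hDlt : Dlᵀ = g * (E * l + Dl - l * E) * p := by
    have : Dlᵀ = (Dg * l + g * Dl - lᵀ * Dg) * p := by
      rw [← hDl, add_sub_cancel_right, mul_assoc, hgp, mul_one]
    rw [this, hlt, hDgE]
    have e : g * l * p * (g * E) = g * l * E := by
      rw [mul_assoc (g * l), ← mul_assoc p g, hpg, one_mul]
    rw [e]
    noncomm_ring
  have hXA : X = ν • (A * DA + A * E * A) + (3 : ℝ) • (l * Dl) - Dl := by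
    have e : p * a * p * (g * (DA + E * A)) = A * (DA + E * A) := by
      rw [← hA, mul_assoc A, ← mul_assoc p, hpg, one_mul]
    rw [hX, hQ, hDaA, smul_mul_assoc, e, mul_add, mul_assoc]
  have hcan : ∀ Y Z : Matrix (Fin n) (Fin n) ℝ, g * Y * p * (g * Z * p) = g * (Y * Z) * p := by
    intro Y Z
    rw [mul_assoc (g * Y), ← mul_assoc p, ← mul_assoc p, hpg, one_mul]; noncomm_ring
  have hXt : p * Xᵀ * g = ν • ((DA + E * A - A * E) * A + A * E * A)
      + (3 : ℝ) • ((E * l + Dl - l * E) * l) - (E * l + Dl - l * E) := by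
    have hXt' : Xᵀ = g * (ν • ((DA + E * A - A * E) * A + A * E * A)
      + (3 : ℝ) • ((E * l + Dl - l * E) * l) - (E * l + Dl - l * E)) * p := by
      rw [hXA]
      simp only [Matrix.transpose_smul, Matrix.transpose_add, Matrix.transpose_sub,
        Matrix.transpose_mul, hAt, hEt, hDAt, hlt, hDlt, mul_neg, neg_mul, hcan]
      simp only [smul_mul_assoc, mul_smul_comm, mul_add, add_mul, mul_sub, sub_mul, mul_assoc]
      module
    rw [hXt', ← mul_assoc, ← mul_assoc, hpg, one_mul, mul_assoc, hpg, mul_one]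
  have hAA : ν • (A * A) = 1 - l := by rw [← hQa, hQ, hA]; simp only [smul_mul_assoc, mul_assoc]
  have hAl : A * l = 0 := by rw [hA, mul_assoc, hal, mul_zero]
  have hlA : l * A = 0 := by rw [hA, ← mul_assoc, hla]
  have hll : l * l = l := by
    have := congrArg (l * ·) hAA
    simp only [mul_smul_comm, ← mul_assoc, hlA, zero_mul, smul_zero, mul_sub, mul_one] at this
    exact (sub_eq_zero.mp this.symm).symm
  -- `4 Δ = 2 E + X - X*`; the terms are collected using `ν E A² = E (1 - l)` and `E l² = E l`.
  have key := add_commutator_eq_zero (E := E) (Δ := Δ) hAA hAl hlA hD hDAl hDlA (by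
    rw [hΔ, ← hE, hXt, hXA]
    linear_combination (norm := skip) - E * hAA - (3 : ℝ) • (E * hll)
    simp only [mul_smul_comm, add_mul, mul_sub, sub_mul, neg_mul, mul_assoc, mul_one]
    module)
  have hΔt : Δᵀ = (Dg - g * Δ) * p := by
    have : Δᵀ * g = Dg - g * Δ := by
      rw [sub_sub, add_comm, ← sub_sub] at hmet
      exact (sub_eq_zero.mp hmet).symm
    rw [← this, mul_assoc, hgp, mul_one]
  have : Da - Δᵀ * a - a * Δ = g * (DA + Δ * A - A * Δ) := by
    rw [hΔt, mul_assoc, ← hA, hDaA, hDgE, haA]; noncomm_ring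
  rw [this, key, mul_zero]

/-- By the rank condition the columns of `ξ` span the kernel of `a`. -/
theorem exists_kernel_coord {n k : ℕ} {g a : Matrix (Fin n) (Fin n) ℝ}
    {ξ : Matrix (Fin n) (Fin k) ℝ} (hr : a.rank + k = n) (hker : a * ξ = 0)
    (horth : ξᵀ * g * ξ = 1) (v : Fin n → ℝ) (hv : a *ᵥ v = 0) : ∃ z, v = ξ *ᵥ z := by
  have hle : LinearMap.range ξ.mulVecLin ≤ LinearMap.ker a.mulVecLin := by
    rintro _ ⟨z, rfl⟩
    simp [Matrix.mulVec_mulVec, hker]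
  have hinj : Function.Injective ξ.mulVecLin := by
    intro x y hxy
    have := congrArg (fun w => (ξᵀ * g) *ᵥ w) hxy
    simpa [Matrix.mulVec_mulVec, horth] using this
  have h1 := LinearMap.finrank_range_add_finrank_ker a.mulVecLin
  have h2 := LinearMap.finrank_range_of_inj hinj
  have h3 : Module.finrank ℝ (LinearMap.range a.mulVecLin) = a.rank := rfl
  have heq := Submodule.eq_of_le_of_finrank_eq hle (by
    rw [h2]; simp only [Module.finrank_fin_fun] at h1 ⊢; omega)
  have : v ∈ LinearMap.range ξ.mulVecLin := by rw [heq]; simpa using hv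
  obtain ⟨z, hz⟩ := this
  exact ⟨z, hz.symm⟩

/-- The extension of `a` by `η` is nonsingular. -/
theorem det_extension_ne_zero {n k : ℕ} {g a : Matrix (Fin n) (Fin n) ℝ}
    {ξ : Matrix (Fin n) (Fin k) ℝ} (hg : gᵀ = g) (ha : aᵀ = -a) (hr : a.rank + k = n)
    (hker : a * ξ = 0) (horth : ξᵀ * g * ξ = 1) :
    (Matrix.fromBlocks a (-(etaMat g ξ)ᵀ) (etaMat g ξ) 0).det ≠ 0 := by
  intro h0
  obtain ⟨v, hv, hBv⟩ := Matrix.exists_mulVec_eq_zero_iff.mpr h0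
  obtain ⟨x, y, rfl⟩ : ∃ x y, v = Sum.elim x y := ⟨v ∘ Sum.inl, v ∘ Sum.inr, by simp⟩
  rw [Matrix.fromBlocks_mulVec] at hBv
  have h1 : a *ᵥ x + -(etaMat g ξ)ᵀ *ᵥ y = 0 := by
    funext i; simpa using congrFun hBv (Sum.inl i)
  have h2 : etaMat g ξ *ᵥ x = 0 := by
    funext i; simpa using congrFun hBv (Sum.inr i)
  have hka : ξᵀ * a = 0 := by
    have := congrArg Matrix.transpose hker
    simpa [Matrix.transpose_mul, ha] using this
  have hke : ξᵀ * (etaMat g ξ)ᵀ = 1 := by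
    rw [etaMat, Matrix.transpose_transpose, ← Matrix.mul_assoc, horth]
  have hy : y = 0 := by
    have := congrArg (fun w => ξᵀ *ᵥ w) h1
    simpa [Matrix.mulVec_add, Matrix.mulVec_mulVec, hka, hke, Matrix.neg_mulVec, Matrix.mulVec_neg]
      using this
  subst hy
  obtain ⟨z, rfl⟩ := exists_kernel_coord hr hker horth x (by simpa using h1)
  have hez : etaMat g ξ * ξ = 1 := by
    rw [etaMat, Matrix.transpose_mul, hg, horth]
  rw [Matrix.mulVec_mulVec, hez, Matrix.one_mulVec] at h2
  subst h2
  apply hv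
  funext i
  rcases i with i | i <;> simp

/-- The algebraic relations between `a`, the projector `l` and `ǎ` at a point. -/
structure PointFacts {n k : ℕ} (g a : Matrix (Fin n) (Fin n) ℝ) (ξ : Matrix (Fin n) (Fin k) ℝ) :
    Prop where
  a_mul_l : a * lMat g ξ = 0
  a_mul_check : a * aCheck g a ξ = (mMat g ξ)ᵀ
  l_mul_check : lMat g ξ * aCheck g a ξ = 0
  check_mul_a : aCheck g a ξ * a = mMat g ξ
  self_adjoint : (lMat g ξ)ᵀ * g = g * lMat g ξ

theorem pointFacts {n k : ℕ} {g a : Matrix (Fin n) (Fin n) ℝ}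
    {ξ : Matrix (Fin n) (Fin k) ℝ} (hg : gᵀ = g) (ha : aᵀ = -a) (hr : a.rank + k = n)
    (hker : a * ξ = 0) (horth : ξᵀ * g * ξ = 1) : PointFacts g a ξ := by
  have hdet := det_extension_ne_zero hg ha hr hker horth
  obtain ⟨B, hB⟩ : ∃ B, B = Matrix.fromBlocks a (-(etaMat g ξ)ᵀ) (etaMat g ξ) 0 := ⟨_, rfl⟩
  have hcheck : aCheck g a ξ = B⁻¹.toBlocks₁₁ := by rw [aCheck, hB]
  rw [← hB] at hdet
  have hu : IsUnit B.det := hdet.isUnit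
  have h1 := Matrix.mul_nonsing_inv B hu
  have h2 := Matrix.nonsing_inv_mul B hu
  rw [← Matrix.fromBlocks_toBlocks B⁻¹, hB, Matrix.fromBlocks_multiply, ← Matrix.fromBlocks_one,
    Matrix.fromBlocks_inj, ← hB, ← hcheck] at h1 h2
  obtain ⟨h11, -, h21, -⟩ := h1
  obtain ⟨k11, -, -, -⟩ := h2
  have hka : ξᵀ * a = 0 := by
    have := congrArg Matrix.transpose hker
    simpa [Matrix.transpose_mul, ha] using this
  have hke : ξᵀ * (etaMat g ξ)ᵀ = 1 := by
    rw [etaMat, Matrix.transpose_transpose, ← Matrix.mul_assoc, horth]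
  have hez : etaMat g ξ * ξ = 1 := by
    rw [etaMat, Matrix.transpose_mul, hg, horth]
  have hS : -B⁻¹.toBlocks₂₁ = ξᵀ := by
    have := congrArg (ξᵀ * ·) h11
    simpa [hka, hke, Matrix.mul_add, ← Matrix.mul_assoc] using this
  have hR : B⁻¹.toBlocks₁₂ = ξ := by
    have := congrArg (· * ξ) k11
    simpa [Matrix.add_mul, Matrix.mul_assoc, hker, hez] using this
  have hlt : (lMat g ξ)ᵀ = (etaMat g ξ)ᵀ * ξᵀ := by rw [lMat, Matrix.transpose_mul]
  refine ⟨?_, ?_, ?_, ?_, ?_⟩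
  · rw [lMat, ← Matrix.mul_assoc, hker, Matrix.zero_mul]
  · rw [mMat, Matrix.transpose_sub, Matrix.transpose_one, hlt, ← hS, ← h11]
    simp
  · rw [lMat, Matrix.mul_assoc]
    have : etaMat g ξ * aCheck g a ξ = 0 := by simpa using h21
    rw [this, Matrix.mul_zero]
  · rw [mMat, lMat, ← k11, hR]
    simp
  · rw [hlt, lMat, etaMat, Matrix.transpose_transpose, Matrix.transpose_mul, hg]
    simp only [Matrix.mul_assoc]

/-- The projector `l` is the identity on the kernel of `a`. -/
theorem PointFacts.fix {n k r : ℕ} {g a : Matrix (Fin n) (Fin n) ℝ}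
    {ξ : Matrix (Fin n) (Fin k) ℝ} (h : PointFacts g a ξ) {x : Matrix (Fin n) (Fin r) ℝ}
    (hx : a * x = 0) : lMat g ξ * x = x := by
  have := congrArg (· * x) h.check_mul_a
  simp only [mMat, Matrix.mul_assoc, hx, Matrix.mul_zero, Matrix.sub_mul, Matrix.one_mul] at this
  exact (sub_eq_zero.mp this.symm).symm

/-- Both projectors are self-adjoint with the same image, hence equal. -/
theorem PointFacts.lMat_unique {n k k' : ℕ} {g a : Matrix (Fin n) (Fin n) ℝ}
    {ξ : Matrix (Fin n) (Fin k) ℝ} {ξ' : Matrix (Fin n) (Fin k') ℝ} (hg : g.det ≠ 0)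
    (h : PointFacts g a ξ) (h' : PointFacts g a ξ') : lMat g ξ = lMat g ξ' := by
  have h1 := h.fix h'.a_mul_l
  have h2 := h'.fix h.a_mul_l
  have hu : IsUnit g.det := hg.isUnit
  have e : g * lMat g ξ' = g * (lMat g ξ' * lMat g ξ) := by
    rw [← h'.self_adjoint, ← h1, Matrix.transpose_mul, Matrix.mul_assoc, h.self_adjoint,
      ← Matrix.mul_assoc, h'.self_adjoint, Matrix.mul_assoc, h1]
  have := congrArg (g⁻¹ * ·) e
  simp only [← Matrix.mul_assoc, Matrix.nonsing_inv_mul g hu, Matrix.one_mul] at this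
  rw [this, h2]

theorem PointFacts.aCheck_unique {n k k' : ℕ} {g a : Matrix (Fin n) (Fin n) ℝ}
    {ξ : Matrix (Fin n) (Fin k) ℝ} {ξ' : Matrix (Fin n) (Fin k') ℝ} (hg : g.det ≠ 0)
    (h : PointFacts g a ξ) (h' : PointFacts g a ξ') : aCheck g a ξ = aCheck g a ξ' := by
  have hl := h.lMat_unique hg h'
  have h1 : a * (aCheck g a ξ - aCheck g a ξ') = 0 := by
    rw [Matrix.mul_sub, h.a_mul_check, h'.a_mul_check, mMat, mMat, hl, sub_self]
  have h2 := h.fix h1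
  rw [Matrix.mul_sub, h.l_mul_check, hl, h'.l_mul_check, sub_self] at h2
  exact sub_eq_zero.mp h2.symm

/-! ### Smooth matrix functions and N-elongated derivatives -/

/-- Smoothness of all entries of a matrix-valued function on `U`. -/
def SmoothMat {E ι κ : Type*} [NormedAddCommGroup E] [NormedSpace ℝ E] (U : Set E)
    (t : E → Matrix ι κ ℝ) : Prop :=
  ∀ i j, ContDiffOn ℝ ∞ (fun u => t u i j) U

section
variable {E ι κ τ : Type*} [NormedAddCommGroup E] [NormedSpace ℝ E] {U : Set E}

theorem SmoothMat.add {s t : E → Matrix ι κ ℝ} (hs : SmoothMat U s) (ht : SmoothMat U t) :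
    SmoothMat U fun u => s u + t u := fun i j => (hs i j).add (ht i j)

theorem SmoothMat.sub {s t : E → Matrix ι κ ℝ} (hs : SmoothMat U s) (ht : SmoothMat U t) :
    SmoothMat U fun u => s u - t u := fun i j => (hs i j).sub (ht i j)

theorem SmoothMat.const (c : Matrix ι κ ℝ) : SmoothMat U fun _ => c :=
  fun _ _ => contDiffOn_const

theorem SmoothMat.transpose {s : E → Matrix ι κ ℝ} (hs : SmoothMat U s) :
    SmoothMat U fun u => (s u)ᵀ := fun i j => hs j i

theorem SmoothMat.mul [Fintype κ] {s : E → Matrix ι κ ℝ} {t : E → Matrix κ τ ℝ}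
    (hs : SmoothMat U s) (ht : SmoothMat U t) : SmoothMat U fun u => s u * t u := by
  intro i j
  simp only [Matrix.mul_apply]
  exact ContDiffOn.sum fun x _ => (hs i x).mul (ht x j)

theorem SmoothMat.const_smul {s : E → Matrix ι κ ℝ} (hs : SmoothMat U s) (c : ℝ) :
    SmoothMat U fun u => c • s u := fun i j => contDiffOn_const.mul (hs i j)

theorem SmoothMat.congr {s t : E → Matrix ι κ ℝ} (hs : SmoothMat U s)
    (h : ∀ u ∈ U, t u = s u) : SmoothMat U t :=
  fun i j => (hs i j).congr fun u hu => by rw [h u hu]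

theorem SmoothMat.det [Fintype ι] [DecidableEq ι] {s : E → Matrix ι ι ℝ}
    (hs : SmoothMat U s) : ContDiffOn ℝ ∞ (fun u => (s u).det) U := by
  simp only [Matrix.det_apply']
  exact ContDiffOn.sum fun σ _ => contDiffOn_const.mul (contDiffOn_prod fun i _ => hs _ _)

theorem SmoothMat.inv [Fintype ι] [DecidableEq ι] {s : E → Matrix ι ι ℝ}
    (hs : SmoothMat U s) (h0 : ∀ u ∈ U, (s u).det ≠ 0) : SmoothMat U fun u => (s u)⁻¹ := by
  intro i j
  have : (fun u => (s u)⁻¹ i j) = fun u => ((s u).det)⁻¹ * ((s u).updateRow j (Pi.single i 1)).det := by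
    funext u
    rw [Matrix.inv_def, Matrix.smul_apply, Matrix.adjugate_apply, Ring.inverse_eq_inv', smul_eq_mul]
  rw [this]
  refine (hs.det.inv h0).mul (SmoothMat.det fun x y => ?_)
  by_cases hx : x = j
  · subst hx; simpa using contDiffOn_const
  · simpa [Matrix.updateRow_ne hx] using hs x y

end

section
variable {m : ℕ} {U : Set (Chart m)} {N : NConnection m} {ι κ τ : Type*}

theorem contDiffOn_frame (hN : ∀ a i, ContDiffOn ℝ ∞ (fun u => N u a i) U) (ν : Idx m) :
    ContDiffOn ℝ ∞ (fun u => frame N u ν) U := by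
  rcases ν with i | a
  · exact contDiffOn_const.prodMk (contDiffOn_pi.2 fun a => (hN a i).neg)
  · exact contDiffOn_const

theorem contDiffOn_eD (hU : IsOpen U) (hN : ∀ a i, ContDiffOn ℝ ∞ (fun u => N u a i) U)
    (ν : Idx m) {f : Chart m → ℝ} (hf : ContDiffOn ℝ ∞ f U) : ContDiffOn ℝ ∞ (eD N ν f) U :=
  (hf.fderiv_of_isOpen hU (by simp)).clm_apply (contDiffOn_frame hN ν)

theorem eD_congr (hU : IsOpen U) {u : Chart m} (hu : u ∈ U) {f f' : Chart m → ℝ}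
    (h : ∀ v ∈ U, f v = f' v) (ν : Idx m) : eD N ν f u = eD N ν f' u := by
  have : f =ᶠ[nhds u] f' := Filter.eventually_of_mem (hU.mem_nhds hu) h
  rw [eD, eD, this.fderiv_eq]

theorem differentiableAt_of_smooth (hU : IsOpen U) {u : Chart m} (hu : u ∈ U) {f : Chart m → ℝ}
    (hf : ContDiffOn ℝ ∞ f U) : DifferentiableAt ℝ f u :=
  (hf.differentiableOn (by simp)).differentiableAt (hU.mem_nhds hu)

theorem eD_add (ν : Idx m) {u : Chart m} {f f' : Chart m → ℝ} (hf : DifferentiableAt ℝ f u)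
    (hf' : DifferentiableAt ℝ f' u) : eD N ν (fun v => f v + f' v) u = eD N ν f u + eD N ν f' u := by
  rw [eD, fderiv_fun_add hf hf']; rfl

theorem eD_sub (ν : Idx m) {u : Chart m} {f f' : Chart m → ℝ} (hf : DifferentiableAt ℝ f u)
    (hf' : DifferentiableAt ℝ f' u) : eD N ν (fun v => f v - f' v) u = eD N ν f u - eD N ν f' u := by
  rw [eD, fderiv_fun_sub hf hf']; rfl

theorem eD_mul (ν : Idx m) {u : Chart m} {f f' : Chart m → ℝ} (hf : DifferentiableAt ℝ f u)
    (hf' : DifferentiableAt ℝ f' u) :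
    eD N ν (fun v => f v * f' v) u = eD N ν f u * f' u + f u * eD N ν f' u := by
  rw [eD, fderiv_fun_mul hf hf']
  simp only [eD, add_apply, smul_apply, smul_eq_mul]
  ring

theorem eD_const (ν : Idx m) (u : Chart m) (c : ℝ) : eD N ν (fun _ => c) u = 0 := by
  simp [eD]

theorem eD_const_mul (ν : Idx m) {u : Chart m} (c : ℝ) {f : Chart m → ℝ}
    (hf : DifferentiableAt ℝ f u) : eD N ν (fun v => c * f v) u = c * eD N ν f u := by
  rw [eD_mul ν (differentiableAt_const c) hf, eD_const, zero_mul, zero_add]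

theorem eD_sum [Fintype κ] (ν : Idx m) {u : Chart m} {f : κ → Chart m → ℝ}
    (hf : ∀ x, DifferentiableAt ℝ (f x) u) :
    eD N ν (fun v => ∑ x, f x v) u = ∑ x, eD N ν (f x) u := by
  rw [eD, fderiv_fun_sum fun x _ => hf x, sum_apply]; rfl

/-- The entrywise N-elongated derivative of a matrix. -/
noncomputable def eMat (N : NConnection m) (γ : Idx m) (t : Chart m → Matrix ι κ ℝ) (u : Chart m) :
    Matrix ι κ ℝ := Matrix.of fun i j => eD N γ (fun v => t v i j) u

theorem SmoothMat.eMat (hU : IsOpen U) (hN : ∀ a i, ContDiffOn ℝ ∞ (fun u => N u a i) U)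
    (γ : Idx m) {t : Chart m → Matrix ι κ ℝ} (ht : SmoothMat U t) : SmoothMat U (eMat N γ t) :=
  fun i j => contDiffOn_eD hU hN γ (ht i j)

theorem eMat_congr (hU : IsOpen U) {u : Chart m} (hu : u ∈ U) {s t : Chart m → Matrix ι κ ℝ}
    (h : ∀ v ∈ U, s v = t v) (γ : Idx m) : eMat N γ s u = eMat N γ t u := by
  ext i j
  exact eD_congr hU hu (fun v hv => by rw [h v hv]) γ

theorem eMat_transpose (γ : Idx m) (t : Chart m → Matrix ι κ ℝ) (u : Chart m) :
    eMat N γ (fun v => (t v)ᵀ) u = (eMat N γ t u)ᵀ := rfl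

theorem eMat_mul [Fintype κ] (hU : IsOpen U) {u : Chart m} (hu : u ∈ U)
    {s : Chart m → Matrix ι κ ℝ} {t : Chart m → Matrix κ τ ℝ}
    (hs : SmoothMat U s) (ht : SmoothMat U t) (γ : Idx m) :
    eMat N γ (fun v => s v * t v) u = eMat N γ s u * t u + s u * eMat N γ t u := by
  ext i j
  simp only [eMat, Matrix.of_apply, Matrix.mul_apply, Matrix.add_apply]
  have h1 := fun x => differentiableAt_of_smooth hU hu (hs i x)
  have h2 := fun x => differentiableAt_of_smooth hU hu (ht x j)
  rw [eD_sum (f := fun x v => s v i x * t v x j) γ fun x => (h1 x).mul (h2 x),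
    ← Finset.sum_add_distrib]
  exact Finset.sum_congr rfl fun x _ => eD_mul γ (h1 x) (h2 x)

theorem eMat_const (c : Matrix ι κ ℝ) (γ : Idx m) (u : Chart m) :
    eMat N γ (fun _ => c) u = 0 := by
  ext i j; simp [eMat, eD]

theorem eMat_sub (hU : IsOpen U) {u : Chart m} (hu : u ∈ U) {s t : Chart m → Matrix ι κ ℝ}
    (hs : SmoothMat U s) (ht : SmoothMat U t) (γ : Idx m) :
    eMat N γ (fun v => s v - t v) u = eMat N γ s u - eMat N γ t u := by
  ext i j
  exact eD_sub γ (differentiableAt_of_smooth hU hu (hs i j))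
    (differentiableAt_of_smooth hU hu (ht i j))

theorem eMat_const_smul (hU : IsOpen U) {u : Chart m} (hu : u ∈ U) (c : ℝ)
    {t : Chart m → Matrix ι κ ℝ} (ht : SmoothMat U t) (γ : Idx m) :
    eMat N γ (fun v => c • t v) u = c • eMat N γ t u := by
  ext i j
  exact eD_const_mul γ c (differentiableAt_of_smooth hU hu (ht i j))

theorem eMat_inv [Fintype ι] [DecidableEq ι] (hU : IsOpen U) {u : Chart m} (hu : u ∈ U)
    {s : Chart m → Matrix ι ι ℝ} (hs : SmoothMat U s) (h0 : ∀ u ∈ U, (s u).det ≠ 0) (γ : Idx m) :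
    eMat N γ (fun v => (s v)⁻¹) u = -((s u)⁻¹ * eMat N γ s u * (s u)⁻¹) := by
  have h1 : eMat N γ (fun v => s v * (s v)⁻¹) u = 0 := by
    rw [← eMat_const (N := N) 1 γ u]
    exact eMat_congr hU hu (fun v hv => Matrix.mul_nonsing_inv _ (h0 v hv).isUnit) γ
  rw [eMat_mul hU hu hs (hs.inv h0)] at h1
  have h2 := congrArg ((s u)⁻¹ * ·) h1
  simp only [Matrix.mul_add, ← Matrix.mul_assoc, Matrix.nonsing_inv_mul _ (h0 u hu).isUnit,
    Matrix.one_mul, Matrix.mul_zero] at h2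
  exact (neg_eq_of_add_eq_zero_right h2).symm

end

/-! ### The metric compatible d-connection -/

section
variable {n k : ℕ} {U : Set (Chart n)} {N : NConnection n}
  {g a : Chart n → Matrix (Fin n) (Fin n) ℝ} {ξ : Chart n → Matrix (Fin n) (Fin k) ℝ}

/-- A nonsymmetric d-metric with kernel frame `ξ` for which `g ǎ ᵗg = ν a`, with a constant `ν`, on an
open set. -/
structure Setup (U : Set (Chart n)) (N : NConnection n)
    (g a : Chart n → Matrix (Fin n) (Fin n) ℝ) (ξ : Chart n → Matrix (Fin n) (Fin k) ℝ) (ν : ℝ) :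
    Prop where
  isOpen : IsOpen U
  smooth_N : ∀ a i, ContDiffOn ℝ ∞ (fun u => N u a i) U
  metric : IsNonsymDMetric U k g a
  kernel : IsKernelFrame U g a ξ
  type_eq : ∀ u ∈ U, g u * aCheck (g u) (a u) (ξ u) * (g u)ᵀ = ν • a u

variable {ν : ℝ} (S : Setup U N g a ξ ν)
include S

theorem Setup.pointFacts {u : Chart n} (hu : u ∈ U) : PointFacts (g u) (a u) (ξ u) :=
  NGT.pointFacts (S.metric.symm u hu) (S.metric.skew u hu) (S.metric.rank_eq u hu)
    (S.kernel.kernel u hu) (S.kernel.orthonormal u hu)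

theorem Setup.g_mul_inv {u : Chart n} (hu : u ∈ U) : g u * (g u)⁻¹ = 1 :=
  Matrix.mul_nonsing_inv _ (S.metric.det_ne u hu).isUnit

theorem Setup.inv_mul_g {u : Chart n} (hu : u ∈ U) : (g u)⁻¹ * g u = 1 :=
  Matrix.nonsing_inv_mul _ (S.metric.det_ne u hu).isUnit

theorem Setup.inv_symm {u : Chart n} (hu : u ∈ U) : ((g u)⁻¹)ᵀ = (g u)⁻¹ := by
  rw [Matrix.transpose_nonsing_inv, S.metric.symm u hu]

theorem Setup.smooth_g : SmoothMat U g := S.metric.smooth_sym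
theorem Setup.smooth_a : SmoothMat U a := S.metric.smooth_skew
theorem Setup.smooth_inv : SmoothMat U fun u => (g u)⁻¹ := S.smooth_g.inv S.metric.det_ne

theorem Setup.smooth_l : SmoothMat U fun u => lMat (g u) (ξ u) := by
  have hξ : SmoothMat U ξ := S.kernel.smooth
  exact hξ.mul (S.smooth_g.mul hξ).transpose

theorem Setup.aCheck_eq {u : Chart n} (hu : u ∈ U) :
    aCheck (g u) (a u) (ξ u) = ν • ((g u)⁻¹ * a u * (g u)⁻¹) := by
  have h := congrArg (fun x => (g u)⁻¹ * x * (g u)⁻¹) (S.type_eq u hu)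
  simp only [S.metric.symm u hu, ← Matrix.mul_assoc, S.inv_mul_g hu, Matrix.one_mul] at h
  rw [Matrix.mul_assoc, S.g_mul_inv hu, Matrix.mul_one] at h
  rw [h, Matrix.mul_smul, Matrix.smul_mul]

theorem Setup.smooth_aCheck : SmoothMat U fun u => aCheck (g u) (a u) (ξ u) :=
  (((S.smooth_inv.mul S.smooth_a).mul S.smooth_inv).const_smul ν).congr
    fun _ hu => S.aCheck_eq hu

omit S in
theorem covLow_eq (D : DConn n) (t : Chart n → Matrix (Fin n) (Fin n) ℝ) (γ : Idx n)
    (u : Chart n) : Matrix.of (D.covLow N t γ u)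
      = eMat N γ t u - (D.dir u γ)ᵀ * t u - t u * D.dir u γ := by
  ext i j
  simp [DConn.covLow, eMat, Matrix.mul_apply, mul_comm]

omit S in
theorem covMixed_eq (D : DConn n) (t : Chart n → Matrix (Fin n) (Fin n) ℝ) (γ : Idx n)
    (u : Chart n) : Matrix.of (D.covMixed N t γ u)
      = eMat N γ t u + D.dir u γ * t u - t u * D.dir u γ := by
  ext i j
  simp [DConn.covMixed, eMat, Matrix.mul_apply, mul_comm]

omit S in
/-- The tensor `ǎ Da + 3 l Dl - Dl` to which the Obata projector is applied in the deformation. -/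
noncomputable def obataArg (N : NConnection n) (g a : Chart n → Matrix (Fin n) (Fin n) ℝ)
    (ξ : Chart n → Matrix (Fin n) (Fin k) ℝ) (D : DConn n) (γ : Idx n) (u : Chart n) :
    Matrix (Fin n) (Fin n) ℝ :=
  aCheck (g u) (a u) (ξ u) * Matrix.of (D.covLow N a γ u)
    + (3 : ℝ) • (lMat (g u) (ξ u) * Matrix.of (D.covMixed N (fun v => lMat (g v) (ξ v)) γ u))
    - Matrix.of (D.covMixed N (fun v => lMat (g v) (ξ v)) γ u)

omit S in
/-- The Obata projector takes `X` to its skew-adjoint part `½ (X - g⁻¹ ᵗX g)`. -/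
theorem obataO_apply (g X : Matrix (Fin n) (Fin n) ℝ) (i j : Fin n) :
    ∑ s, ∑ r, obataO (-1) g i r s j * X s r = ((1 / 2 : ℝ) • (X - g⁻¹ * Xᵀ * g)) i j := by
  have : ∀ s r, obataO (-1) g i r s j * X s r = (1 / 2) * ((if s = i then if j = r then X s r else 0
      else 0) - g⁻¹ i r * X s r * g s j) := by
    intro s r
    simp only [obataO, delta]
    split_ifs <;> ring
  simp only [this, ← Finset.mul_sum, Finset.sum_sub_distrib]
  simp [Matrix.mul_apply, Finset.sum_mul]

omit S in
theorem deformation_eq (D : DConn n) (γ : Idx n) (u : Chart n) :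
    Matrix.of (deformation N g a ξ D γ u)
      = (1 / 2 : ℝ) • ((g u)⁻¹ * Matrix.of (D.covLow N g γ u) + (1 / 2 : ℝ) •
        (obataArg N g a ξ D γ u - (g u)⁻¹ * (obataArg N g a ξ D γ u)ᵀ * g u)) := by
  ext i j
  rw [Matrix.smul_apply, Matrix.add_apply, ← obataO_apply]
  simp [deformation, obataArg, Matrix.mul_apply]

omit S in
theorem starConn_dir (D : DConn n) (u : Chart n) (γ : Idx n) :
    (starConn N g a ξ D).dir u γ = D.dir u γ + Matrix.of (deformation N g a ξ D γ u) := by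
  rcases γ with l | l <;> rfl

/-- `g⁻¹ Da - g⁻¹ Dg g⁻¹ a` is the covariant derivative of the endomorphism `g⁻¹ a`. -/
theorem Setup.eMat_A (D : DConn n) (γ : Idx n) {u : Chart n} (hu : u ∈ U) :
    (g u)⁻¹ * Matrix.of (D.covLow N a γ u)
        - (g u)⁻¹ * Matrix.of (D.covLow N g γ u) * (g u)⁻¹ * a u
      = eMat N γ (fun v => (g v)⁻¹ * a v) u + D.dir u γ * ((g u)⁻¹ * a u)
        - ((g u)⁻¹ * a u) * D.dir u γ := by
  rw [eMat_mul S.isOpen hu S.smooth_inv S.smooth_a, eMat_inv S.isOpen hu S.smooth_g S.metric.det_ne,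
    covLow_eq, covLow_eq]
  have h1 := S.inv_mul_g hu
  have h2 := S.g_mul_inv hu
  linear_combination (norm := skip) (g u)⁻¹ * (D.dir u γ)ᵀ * h2 * a u
    + h1 * D.dir u γ * (g u)⁻¹ * a u
  noncomm_ring

/-- What symmetry of `g` and `a`, self-adjointness of `l` and the relations `ν A² = 1 - l`,
`A l = l A = 0` for `A = p a`, `p = g⁻¹`, imply for the covariant derivatives at a point. -/
structure DerivFacts (ν : ℝ) (g p a l Dg Da Dl : Matrix (Fin n) (Fin n) ℝ) : Prop where
  symm_Dg : Dgᵀ = Dg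
  skew_Da : Daᵀ = -Da
  self_adjoint : Dlᵀ * g + lᵀ * Dg = Dg * l + g * Dl
  sq : ν • ((p * Da - p * Dg * p * a) * (p * a) + p * a * (p * Da - p * Dg * p * a)) = -Dl
  mul_l : (p * Da - p * Dg * p * a) * l + p * a * Dl = 0
  l_mul : Dl * (p * a) + l * (p * Da - p * Dg * p * a) = 0

theorem Setup.l_mul_inv_a {u : Chart n} (hu : u ∈ U) :
    lMat (g u) (ξ u) * (g u)⁻¹ * a u = 0 := by
  have hl := (S.pointFacts hu).self_adjoint
  have h2 : lMat (g u) (ξ u) * (g u)⁻¹ = (g u)⁻¹ * (lMat (g u) (ξ u))ᵀ := by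
    have := congrArg (fun x => (g u)⁻¹ * x * (g u)⁻¹) hl
    simp only [← Matrix.mul_assoc, S.inv_mul_g hu, Matrix.one_mul] at this
    rw [Matrix.mul_assoc, S.g_mul_inv hu, Matrix.mul_one] at this
    exact this.symm
  have h3 : (lMat (g u) (ξ u))ᵀ * a u = 0 := by
    have := congrArg Matrix.transpose (S.pointFacts hu).a_mul_l
    simpa [Matrix.transpose_mul, S.metric.skew u hu] using this
  rw [h2, Matrix.mul_assoc, h3, Matrix.mul_zero]

theorem Setup.sq_eq {u : Chart n} (hu : u ∈ U) :
    ν • (((g u)⁻¹ * a u) * ((g u)⁻¹ * a u)) = 1 - lMat (g u) (ξ u) := by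
  rw [← mMat, ← (S.pointFacts hu).check_mul_a, S.aCheck_eq hu]
  simp only [Matrix.mul_assoc, Matrix.smul_mul]

theorem Setup.derivFacts (D : DConn n) (γ : Idx n) {u : Chart n} (hu : u ∈ U) :
    DerivFacts ν (g u) (g u)⁻¹ (a u) (lMat (g u) (ξ u)) (Matrix.of (D.covLow N g γ u))
      (Matrix.of (D.covLow N a γ u))
      (Matrix.of (D.covMixed N (fun v => lMat (g v) (ξ v)) γ u)) := by
  have hU := S.isOpen
  have hA : SmoothMat U fun v => (g v)⁻¹ * a v := S.smooth_inv.mul S.smooth_a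
  have hdg : (eMat N γ g u)ᵀ = eMat N γ g u := by
    rw [← eMat_transpose]; exact eMat_congr hU hu S.metric.symm γ
  have hda : (eMat N γ a u)ᵀ = -eMat N γ a u := by
    rw [← eMat_transpose, ← neg_one_smul ℝ (eMat N γ a u), ← eMat_const_smul hU hu _ S.smooth_a]
    exact eMat_congr hU hu (fun v hv => by rw [S.metric.skew v hv, neg_one_smul]) γ
  have hl := (S.pointFacts hu).self_adjoint
  have hdl : (eMat N γ (fun v => lMat (g v) (ξ v)) u)ᵀ * g u
      + (lMat (g u) (ξ u))ᵀ * eMat N γ g u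
      = eMat N γ g u * lMat (g u) (ξ u) + g u * eMat N γ (fun v => lMat (g v) (ξ v)) u := by
    rw [← eMat_transpose, ← eMat_mul hU hu S.smooth_l.transpose S.smooth_g,
      ← eMat_mul hU hu S.smooth_g S.smooth_l]
    exact eMat_congr hU hu (fun v hv => (S.pointFacts hv).self_adjoint) γ
  have hAA : ν • (eMat N γ (fun v => (g v)⁻¹ * a v) u * ((g u)⁻¹ * a u)
      + ((g u)⁻¹ * a u) * eMat N γ (fun v => (g v)⁻¹ * a v) u)
      = -eMat N γ (fun v => lMat (g v) (ξ v)) u := by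
    rw [← eMat_mul hU hu hA hA, ← eMat_const_smul hU hu _ (hA.mul hA),
      eMat_congr hU hu (fun v hv => S.sq_eq hv), eMat_sub hU hu (SmoothMat.const 1) S.smooth_l,
      eMat_const, zero_sub]
  have hAl : eMat N γ (fun v => (g v)⁻¹ * a v) u * lMat (g u) (ξ u)
      + ((g u)⁻¹ * a u) * eMat N γ (fun v => lMat (g v) (ξ v)) u = 0 := by
    rw [← eMat_mul hU hu hA S.smooth_l, ← eMat_const (N := N) 0 γ u]
    refine eMat_congr hU hu (fun v hv => ?_) γ
    rw [Matrix.mul_assoc, (S.pointFacts hv).a_mul_l, Matrix.mul_zero]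
  have hlA : eMat N γ (fun v => lMat (g v) (ξ v)) u * ((g u)⁻¹ * a u)
      + lMat (g u) (ξ u) * eMat N γ (fun v => (g v)⁻¹ * a v) u = 0 := by
    rw [← eMat_mul hU hu S.smooth_l hA, ← eMat_const (N := N) 0 γ u]
    refine eMat_congr hU hu (fun v hv => ?_) γ
    rw [← Matrix.mul_assoc, S.l_mul_inv_a hv]
  have hsq := S.sq_eq hu
  have hAl0 : (g u)⁻¹ * a u * lMat (g u) (ξ u) = 0 := by
    rw [Matrix.mul_assoc, (S.pointFacts hu).a_mul_l, Matrix.mul_zero]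
  have hlA0 : lMat (g u) (ξ u) * ((g u)⁻¹ * a u) = 0 := by
    rw [← Matrix.mul_assoc, S.l_mul_inv_a hu]
  refine ⟨?_, ?_, ?_, ?_, ?_, ?_⟩
  · rw [covLow_eq]
    simp only [Matrix.transpose_sub, Matrix.transpose_mul, Matrix.transpose_transpose, hdg,
      S.metric.symm u hu]
    abel
  · rw [covLow_eq]
    simp only [Matrix.transpose_sub, Matrix.transpose_mul, Matrix.transpose_transpose, hda,
      S.metric.skew u hu, Matrix.neg_mul, Matrix.mul_neg]
    abel
  · rw [covLow_eq, covMixed_eq]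
    simp only [Matrix.transpose_sub, Matrix.transpose_add, Matrix.transpose_mul]
    linear_combination (norm := skip) hdl - (D.dir u γ)ᵀ * hl - hl * D.dir u γ
    noncomm_ring
  · rw [S.eMat_A D γ hu, covMixed_eq]
    linear_combination (norm := skip) hAA + D.dir u γ * hsq - hsq * D.dir u γ
    simp only [smul_mul_assoc, mul_smul_comm, mul_add, add_mul, mul_sub, sub_mul, mul_assoc,
      one_mul, mul_one]
    module
  · rw [S.eMat_A D γ hu, covMixed_eq]
    linear_combination (norm := skip) hAl + D.dir u γ * hAl0 - hAl0 * D.dir u γ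
    noncomm_ring
  · rw [S.eMat_A D γ hu, covMixed_eq]
    linear_combination (norm := skip) hlA + D.dir u γ * hlA0 - hlA0 * D.dir u γ
    noncomm_ring

/-- `*D g = 0`. -/
theorem Setup.covLow_star_symm (D : DConn n) (γ : Idx n) {u : Chart n} (hu : u ∈ U) :
    Matrix.of ((starConn N g a ξ D).covLow N g γ u) = 0 := by
  have h := covDeriv_symm_deformed (X := obataArg N g a ξ D γ u) (S.g_mul_inv hu) (S.metric.symm u hu)
    (S.inv_symm hu) (S.derivFacts D γ hu).symm_Dg
  rw [← deformation_eq] at h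
  rw [← h, covLow_eq, covLow_eq, starConn_dir, Matrix.transpose_add]
  noncomm_ring

/-- `*D a = 0`. -/
theorem Setup.covLow_star_skew (D : DConn n) (γ : Idx n) {u : Chart n} (hu : u ∈ U) :
    Matrix.of ((starConn N g a ξ D).covLow N a γ u) = 0 := by
  have F := S.derivFacts D γ hu
  have P := S.pointFacts hu
  have h := covDeriv_skew_deformed (X := obataArg N g a ξ D γ u) (S.g_mul_inv hu) (S.metric.symm u hu)
    (S.inv_symm hu) (S.metric.skew u hu) F.symm_Dg F.skew_Da P.self_adjoint F.self_adjoint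
    P.a_mul_l (S.l_mul_inv_a hu) (S.aCheck_eq hu) P.check_mul_a F.sq F.mul_l F.l_mul
    rfl (deformation_eq D γ u)
  rw [← h, covLow_eq, covLow_eq, starConn_dir, Matrix.transpose_add]
  noncomm_ring

/-- A connection for which `g` and `a` are parallel is not changed: then `g⁻¹ a` is parallel, hence
so is `l = 1 - ν (g⁻¹ a)²`. -/
theorem Setup.star_eq_self (D : DConn n) (γ : Idx n) {u : Chart n} (hu : u ∈ U)
    (hg : Matrix.of (D.covLow N g γ u) = 0) (ha : Matrix.of (D.covLow N a γ u) = 0) :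
    (starConn N g a ξ D).dir u γ = D.dir u γ := by
  -- With `Dg = Da = 0` the differentiated relation reads `Dl = 0`.
  have hl := (S.derivFacts D γ hu).sq
  rw [hg, ha] at hl
  simp only [Matrix.mul_zero, Matrix.zero_mul, sub_zero, add_zero, smul_zero] at hl
  rw [starConn_dir, deformation_eq, obataArg, hg, ha, neg_eq_zero.mp hl.symm]
  simp

theorem Setup.smooth_dir_star (D : DConn n) (hD : D.IsSmoothOn U) (γ : Idx n) :
    SmoothMat U fun u => (starConn N g a ξ D).dir u γ := by
  have hdir : SmoothMat U fun u => D.dir u γ := by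
    rcases γ with l | l
    · exact fun i j => hD.1 i j l
    · exact fun i j => hD.2 i j l
  have hlow : ∀ t, SmoothMat U t → SmoothMat U fun u => Matrix.of (D.covLow N t γ u) := by
    intro t ht
    simp only [covLow_eq]
    exact ((ht.eMat S.isOpen S.smooth_N γ).sub (hdir.transpose.mul ht)).sub (ht.mul hdir)
  have hmix : ∀ t, SmoothMat U t → SmoothMat U fun u => Matrix.of (D.covMixed N t γ u) := by
    intro t ht
    simp only [covMixed_eq]
    exact ((ht.eMat S.isOpen S.smooth_N γ).add (hdir.mul ht)).sub (ht.mul hdir)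
  have harg : SmoothMat U fun u => obataArg N g a ξ D γ u :=
    ((S.smooth_aCheck.mul (hlow a S.smooth_a)).add
      ((S.smooth_l.mul (hmix _ S.smooth_l)).const_smul 3)).sub (hmix _ S.smooth_l)
  simp only [starConn_dir, deformation_eq]
  exact hdir.add (((S.smooth_inv.mul (hlow g S.smooth_g)).add ((harg.sub
    ((S.smooth_inv.mul harg.transpose).mul S.smooth_g)).const_smul _)).const_smul _)

theorem Setup.smooth_star (D : DConn n) (hD : D.IsSmoothOn U) :
    (starConn N g a ξ D).IsSmoothOn U :=
  ⟨fun i j l => S.smooth_dir_star D hD (Sum.inl l) i j,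
    fun i j l => S.smooth_dir_star D hD (Sum.inr l) i j⟩

omit S in
theorem isMetricCompatible_of_covLow (D : DConn n) (hU : IsOpen U) (hg : SmoothMat U g)
    (ha : SmoothMat U a) (h1 : ∀ u ∈ U, ∀ γ, Matrix.of (D.covLow N g γ u) = 0)
    (h2 : ∀ u ∈ U, ∀ γ, Matrix.of (D.covLow N a γ u) = 0) :
    IsMetricCompatible N U D (fullMetric g a) := by
  have key : ∀ u ∈ U, ∀ γ i j, eD N γ (fun v => g v i j + a v i j) u
      - ∑ s, D.dir u γ s i * (g u s j + a u s j) - ∑ s, D.dir u γ s j * (g u i s + a u i s) = 0 := by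
    intro u hu γ i j
    have e1 := congrFun (congrFun (h1 u hu γ) i) j
    have e2 := congrFun (congrFun (h2 u hu γ) i) j
    simp only [Matrix.of_apply, Matrix.zero_apply, DConn.covLow] at e1 e2
    rw [eD_add γ (differentiableAt_of_smooth hU hu (hg i j))
      (differentiableAt_of_smooth hU hu (ha i j))]
    simp only [mul_add, Finset.sum_add_distrib]
    linarith
  intro u hu ν α β
  rcases ν with l | l <;> rcases α with i | i <;> rcases β with j | j <;>
    simp only [Fintype.sum_sum_type, DConn.coeff, fullMetric, zero_mul, mul_zero,
      Finset.sum_const_zero, add_zero, zero_add, eD_const, sub_zero] <;>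
    first | exact key u hu (Sum.inl l) i j | exact key u hu (Sum.inr l) i j

theorem Setup.star_compatible (D : DConn n) :
    IsMetricCompatible N U (starConn N g a ξ D) (fullMetric g a) :=
  isMetricCompatible_of_covLow _ S.isOpen S.smooth_g S.smooth_a
    (fun _ hu γ => S.covLow_star_symm D γ hu) (fun _ hu γ => S.covLow_star_skew D γ hu)

theorem Setup.star_unique (D : DConn n) {k' : ℕ} {ξ' : Chart n → Matrix (Fin n) (Fin k') ℝ}
    (h' : ∀ u ∈ U, PointFacts (g u) (a u) (ξ' u)) {u : Chart n} (hu : u ∈ U) :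
    (starConn N g a ξ' D).coeff u = (starConn N g a ξ D).coeff u := by
  have hl : ∀ v ∈ U, lMat (g v) (ξ' v) = lMat (g v) (ξ v) := fun v hv =>
    (h' v hv).lMat_unique (S.metric.det_ne v hv) (S.pointFacts hv)
  have hdir : ∀ γ, (starConn N g a ξ' D).dir u γ = (starConn N g a ξ D).dir u γ := by
    intro γ
    rw [starConn_dir, starConn_dir, deformation_eq, deformation_eq, obataArg, obataArg, covMixed_eq,
      covMixed_eq, hl u hu, eMat_congr S.isOpen hu hl,
      (h' u hu).aCheck_unique (S.metric.det_ne u hu) (S.pointFacts hu)]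
  have hL : ∀ i j l, (starConn N g a ξ' D).L u i j l = (starConn N g a ξ D).L u i j l :=
    fun i j l => congrFun (congrFun (hdir (Sum.inl l)) i) j
  have hC : ∀ i j l, (starConn N g a ξ' D).C u i j l = (starConn N g a ξ D).C u i j l :=
    fun i j l => congrFun (congrFun (hdir (Sum.inr l)) i) j
  funext γ μ ρ
  rcases γ with i | i <;> rcases μ with j | j <;> rcases ρ with l | l <;>
    simp only [DConn.coeff, hL, hC]

end

/-! ### N-adapted linear connections -/

section
variable {n : ℕ} {U : Set (Chart n)} {N : NConnection n}

theorem coframe_add (u v w : Chart n) (γ : Idx n) :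
    coframe N u (v + w) γ = coframe N u v γ + coframe N u w γ := by
  rcases γ with i | a
  · rfl
  · simp only [coframe, Prod.fst_add, Prod.snd_add, Pi.add_apply, mul_add, Finset.sum_add_distrib]
    ring

theorem coframe_smul (u : Chart n) (c : ℝ) (v : Chart n) (γ : Idx n) :
    coframe N u (c • v) γ = c * coframe N u v γ := by
  rcases γ with i | a
  · rfl
  · simp only [coframe, Prod.smul_fst, Prod.smul_snd, Pi.smul_apply, smul_eq_mul, mul_add,
      Finset.mul_sum]
    congr 1
    exact Finset.sum_congr rfl fun i _ => by ring

/-- The evaluation of a coframe element, as a linear map. -/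
def coframeLin (N : NConnection n) (u : Chart n) (γ : Idx n) : Chart n →ₗ[ℝ] ℝ where
  toFun v := coframe N u v γ
  map_add' v w := coframe_add u v w γ
  map_smul' c v := coframe_smul u c v γ

theorem coframe_frame (u : Chart n) (μ γ : Idx n) :
    coframe N u (frame N u μ) γ = if γ = μ then 1 else 0 := by
  rcases μ with i | a <;> rcases γ with j | b <;>
    simp [coframe, frame, Pi.single_apply]

theorem coframe_sum (u : Chart n) (c : Idx n → ℝ) (γ : Idx n) :
    coframe N u (∑ μ, c μ • frame N u μ) γ = c γ := by
  change coframeLin N u γ _ = _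
  rw [map_sum]
  have : ∀ μ, coframeLin N u γ (c μ • frame N u μ) = if γ = μ then c μ else 0 := by
    intro μ
    rw [map_smul]
    change c μ * coframe N u (frame N u μ) γ = _
    rw [coframe_frame]; simp
  simp [this]

theorem coframe_ext {u v w : Chart n} (h : ∀ γ, coframe N u v γ = coframe N u w γ) : v = w := by
  have h1 : v.1 = w.1 := funext fun i => h (Sum.inl i)
  refine Prod.ext h1 (funext fun a => ?_)
  have := h (Sum.inr a)
  simpa [coframe, h1] using this

theorem eq_sum_frame (u v : Chart n) : v = ∑ μ, coframe N u v μ • frame N u μ :=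
  coframe_ext fun γ => (coframe_sum u _ γ).symm

theorem mem_horizontal_iff {u v : Chart n} :
    v ∈ horizontal N u ↔ ∀ a, coframe N u v (Sum.inr a) = 0 := by
  constructor
  · intro hv a
    have : horizontal N u ≤ LinearMap.ker (coframeLin N u (Sum.inr a)) := by
      rw [horizontal, Submodule.span_le]
      rintro _ ⟨i, rfl⟩
      change coframe N u (frame N u (Sum.inl i)) (Sum.inr a) = 0
      simp [coframe_frame]
    exact this hv
  · intro h
    rw [eq_sum_frame (N := N) u v, Fintype.sum_sum_type]
    simp only [h, zero_smul, Finset.sum_const_zero, add_zero]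
    exact Submodule.sum_mem _ fun i _ => Submodule.smul_mem _ _ (Submodule.subset_span ⟨i, rfl⟩)

theorem mem_vertical_iff {u v : Chart n} :
    v ∈ vertical N u ↔ ∀ i, coframe N u v (Sum.inl i) = 0 := by
  constructor
  · intro hv a
    have : vertical N u ≤ LinearMap.ker (coframeLin N u (Sum.inl a)) := by
      rw [vertical, Submodule.span_le]
      rintro _ ⟨i, rfl⟩
      change coframe N u (frame N u (Sum.inr i)) (Sum.inl a) = 0
      simp [coframe_frame]
    exact this hv
  · intro h
    rw [eq_sum_frame (N := N) u v, Fintype.sum_sum_type]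
    simp only [h, zero_smul, Finset.sum_const_zero, zero_add]
    exact Submodule.sum_mem _ fun i _ => Submodule.smul_mem _ _ (Submodule.subset_span ⟨i, rfl⟩)

theorem almostComplex_eq (u v : Chart n) : almostComplex N u v
    = ∑ μ, (Sum.elim (fun j => coframe N u v (Sum.inr j))
      (fun j => -coframe N u v (Sum.inl j)) μ : ℝ) • frame N u μ := by
  simp only [almostComplex, Fintype.sum_sum_type, Finset.sum_add_distrib, Sum.elim_inl,
    Sum.elim_inr, neg_smul, sub_eq_add_neg]

theorem coframe_almostComplex_inl (u v : Chart n) (i : Fin n) :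
    coframe N u (almostComplex N u v) (Sum.inl i) = coframe N u v (Sum.inr i) := by
  rw [almostComplex_eq, coframe_sum]; rfl

theorem coframe_almostComplex_inr (u v : Chart n) (i : Fin n) :
    coframe N u (almostComplex N u v) (Sum.inr i) = -coframe N u v (Sum.inl i) := by
  rw [almostComplex_eq, coframe_sum]; rfl

theorem contDiffOn_coframe (hN : ∀ a i, ContDiffOn ℝ ∞ (fun u => N u a i) U)
    {Y : Chart n → Chart n} (hY : ContDiffOn ℝ ∞ Y U) (γ : Idx n) :
    ContDiffOn ℝ ∞ (fun v => coframe N v (Y v) γ) U := by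
  have h1 : ∀ i, ContDiffOn ℝ ∞ (fun v => (Y v).1 i) U := contDiffOn_pi.1 hY.fst
  have h2 : ∀ i, ContDiffOn ℝ ∞ (fun v => (Y v).2 i) U := contDiffOn_pi.1 hY.snd
  rcases γ with i | a
  · exact h1 i
  · exact (h2 a).add (ContDiffOn.sum fun i _ => (hN a i).mul (h1 i))

theorem contDiffOn_coeff {D : DConn n} (hD : D.IsSmoothOn U) (γ μ ν : Idx n) :
    ContDiffOn ℝ ∞ (fun u => D.coeff u γ μ ν) U := by
  rcases γ with i | i <;> rcases μ with j | j <;> rcases ν with l | l <;>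
    first | exact hD.1 i j l | exact hD.2 i j l | exact contDiffOn_const

theorem coframe_covDeriv (D : DConn n) (X Y : Chart n → Chart n) (u : Chart n) (γ : Idx n) :
    coframe N u (covDeriv N D X Y u) γ = fderiv ℝ (fun v => coframe N v (Y v) γ) u (X u)
      + ∑ μ, ∑ ν, D.coeff u γ μ ν * coframe N u (Y u) μ * coframe N u (X u) ν :=
  coframe_sum u _ γ

theorem fderiv_congr_of_isOpen (hU : IsOpen U) {u : Chart n} (hu : u ∈ U) {f f' : Chart n → ℝ}
    (h : ∀ v ∈ U, f v = f' v) : fderiv ℝ f u = fderiv ℝ f' u :=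
  Filter.EventuallyEq.fderiv_eq (Filter.eventually_of_mem (hU.mem_nhds hu) h)

theorem isNormalDConnection (hU : IsOpen U) (hN : ∀ a i, ContDiffOn ℝ ∞ (fun u => N u a i) U)
    {D : DConn n} (hD : D.IsSmoothOn U) : IsNormalDConnection N U D where
  smooth X Y hX hY := by
    refine ContDiffOn.sum fun γ _ => ContDiffOn.fun_smul (ContDiffOn.add ?_ ?_)
      (contDiffOn_frame hN γ)
    · exact ((contDiffOn_coframe hN hY γ).fderiv_of_isOpen hU (by simp)).clm_apply hX
    · exact ContDiffOn.sum fun μ _ => ContDiffOn.sum fun ν _ =>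
        ((contDiffOn_coeff hD γ μ ν).mul (contDiffOn_coframe hN hY μ)).mul
          (contDiffOn_coframe hN hX ν)
  add_left X Z Y u _ := by
    refine coframe_ext (N := N) (u := u) fun γ => ?_
    simp only [coframe_add, coframe_covDeriv, Pi.add_apply, map_add, mul_add,
      Finset.sum_add_distrib]
    ring
  smul_left f X Y u _ := by
    refine coframe_ext (N := N) (u := u) fun γ => ?_
    simp only [coframe_smul, coframe_covDeriv, map_smul, smul_eq_mul, mul_add, Finset.mul_sum]
    congr 1
    exact Finset.sum_congr rfl fun μ _ => Finset.sum_congr rfl fun ν _ => by ring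
  add_right X Y Z hY hZ u hu := by
    refine coframe_ext (N := N) (u := u) fun γ => ?_
    have e : fderiv ℝ (fun v => coframe N v ((Y + Z) v) γ) u
        = fderiv ℝ (fun v => coframe N v (Y v) γ) u + fderiv ℝ (fun v => coframe N v (Z v) γ) u := by
      simp only [Pi.add_apply, coframe_add]
      exact fderiv_fun_add (differentiableAt_of_smooth hU hu (contDiffOn_coframe hN hY γ))
        (differentiableAt_of_smooth hU hu (contDiffOn_coframe hN hZ γ))
    rw [coframe_add, coframe_covDeriv, coframe_covDeriv, coframe_covDeriv, e]
    simp only [Pi.add_apply, coframe_add, add_apply, mul_add, add_mul, Finset.sum_add_distrib]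
    ring
  leibniz f X Y hf hY u hu := by
    refine coframe_ext (N := N) (u := u) fun γ => ?_
    have e : fderiv ℝ (fun v => coframe N v (f v • Y v) γ) u (X u)
        = f u * fderiv ℝ (fun v => coframe N v (Y v) γ) u (X u)
          + fderiv ℝ f u (X u) * coframe N u (Y u) γ := by
      simp only [coframe_smul]
      rw [fderiv_fun_mul (differentiableAt_of_smooth hU hu hf)
        (differentiableAt_of_smooth hU hu (contDiffOn_coframe hN hY γ))]
      simp only [add_apply, smul_apply, smul_eq_mul]
      ring
    rw [coframe_add, coframe_smul, coframe_smul, coframe_covDeriv, coframe_covDeriv, e]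
    simp only [coframe_smul, mul_add, Finset.mul_sum]
    have : ∀ μ ν, D.coeff u γ μ ν * (f u * coframe N u (Y u) μ) * coframe N u (X u) ν
      = f u * (D.coeff u γ μ ν * coframe N u (Y u) μ * coframe N u (X u) ν) := fun μ ν => by ring
    simp only [this]
    ring
  preserves_horizontal X Y _ hYh u hu := by
    rw [mem_horizontal_iff]
    intro a
    have h := fun v hv => mem_horizontal_iff.1 (hYh v hv)
    rw [coframe_covDeriv, fderiv_congr_of_isOpen hU hu (fun v hv => h v hv a)]
    simp [Fintype.sum_sum_type, h u hu, DConn.coeff]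
  preserves_vertical X Y _ hYv u hu := by
    rw [mem_vertical_iff]
    intro a
    have h := fun v hv => mem_vertical_iff.1 (hYv v hv)
    rw [coframe_covDeriv, fderiv_congr_of_isOpen hU hu (fun v hv => h v hv a)]
    simp [Fintype.sum_sum_type, h u hu, DConn.coeff]
  parallel_almostComplex X Y _ u _ := by
    refine coframe_ext (N := N) (u := u) fun γ => ?_
    rcases γ with i | i
    · rw [coframe_almostComplex_inl, coframe_covDeriv, coframe_covDeriv]
      simp only [coframe_almostComplex_inl]
      simp [Fintype.sum_sum_type, DConn.coeff, coframe_almostComplex_inl]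
    · rw [coframe_almostComplex_inr, coframe_covDeriv, coframe_covDeriv]
      simp only [coframe_almostComplex_inr]
      simp [Fintype.sum_sum_type, DConn.coeff, coframe_almostComplex_inr, fderiv_fun_neg,
        Finset.sum_add_distrib]
      ring

end

/-! ### Trace-free metric connections in dimension 2 + 2 -/

section
variable {n k : ℕ} {U : Set (Chart n)} {N : NConnection n}
  {g a : Chart n → Matrix (Fin n) (Fin n) ℝ} {ξ : Chart n → Matrix (Fin n) (Fin k) ℝ} {ν : ℝ}

/-- Adding `-⅔ δ^γ_μ w_ν` to a connection in `2n` dimensions adds `(2n - 1)/3 w_ν` to its torsion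
trace. The factor is one exactly for `n = 2`. -/
theorem traceVec_sub_delta (Γ : Idx n → Idx n → Idx n → ℝ) (w : Idx n → ℝ) (μ : Idx n) :
    traceVec (fun γ α β => Γ γ α β - (2 / 3) * (delta γ α * w β)) μ
      = traceVec Γ μ + (2 * n - 1) / 3 * w μ := by
  have h1 : ∑ γ : Idx n, delta γ μ * w γ = w μ := by simp [delta]
  have h2 : ∑ γ : Idx n, delta γ γ * w μ = (2 * n) * w μ := by
    simp [delta, two_mul]
  have h3 : ∀ γ, (Γ γ μ γ - 2 / 3 * (delta γ μ * w γ)) - (Γ γ γ μ - 2 / 3 * (delta γ γ * w μ))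
      = (Γ γ μ γ - Γ γ γ μ) - 2 / 3 * (delta γ μ * w γ) + 2 / 3 * (delta γ γ * w μ) := fun γ => by
    ring
  simp only [traceVec, h3]
  rw [Finset.sum_add_distrib, Finset.sum_sub_distrib, ← Finset.mul_sum, ← Finset.mul_sum, h1, h2]
  ring

/-- `T^i_{ji} - 2 T^i_{ij}`, which is twice the torsion trace of a d-connection with coefficients `T`
in its block: the subtracted trace appears twice since the h- and the v-block both contribute. -/
def normalTrace (T : Fin n → Fin n → Fin n → ℝ) (j : Fin n) : ℝ :=
  ∑ i, T i j i - 2 * ∑ i, T i i j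

theorem traceVec_coeff_inl (D : DConn n) (u : Chart n) (j : Fin n) :
    traceVec (D.coeff u) (Sum.inl j) = (1 / 2) * normalTrace (D.L u) j := by
  simp only [traceVec, normalTrace, Fintype.sum_sum_type, DConn.coeff, Finset.sum_sub_distrib,
    Finset.sum_const_zero]
  ring

theorem traceVec_coeff_inr (D : DConn n) (u : Chart n) (j : Fin n) :
    traceVec (D.coeff u) (Sum.inr j) = (1 / 2) * normalTrace (D.C u) j := by
  simp only [traceVec, normalTrace, Fintype.sum_sum_type, DConn.coeff, Finset.sum_sub_distrib,
    Finset.sum_const_zero]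
  ring

theorem traceVec_coeff_eq_zero_iff (D : DConn n) (u : Chart n) :
    (∀ μ, traceVec (D.coeff u) μ = 0) ↔
      (∀ j, normalTrace (D.L u) j = 0) ∧ ∀ j, normalTrace (D.C u) j = 0 := by
  constructor
  · intro h
    refine ⟨fun j => ?_, fun j => ?_⟩
    · have := h (Sum.inl j); rw [traceVec_coeff_inl] at this; linarith
    · have := h (Sum.inr j); rw [traceVec_coeff_inr] at this; linarith
  · rintro ⟨h1, h2⟩ (j | j)
    · rw [traceVec_coeff_inl, h1, mul_zero]
    · rw [traceVec_coeff_inr, h2, mul_zero]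

theorem normalTrace_sub (S T : Fin n → Fin n → Fin n → ℝ) (j : Fin n) :
    normalTrace (fun i j l => S i j l - T i j l) j = normalTrace S j - normalTrace T j := by
  simp only [normalTrace, Finset.sum_sub_distrib]; ring

/-- In dimension two the difference of two metric connections is determined by its trace: it has the
form `S_l = g⁻¹ ε s_l`, and the trace condition reads `s_i (g⁻¹ ε)^i_j = 0`. -/
theorem eq_zero_of_normalTrace {g : Matrix (Fin 2) (Fin 2) ℝ} (hg : gᵀ = g) (hd : g.det ≠ 0)
    {S : Fin 2 → Fin 2 → Fin 2 → ℝ}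
    (hS : ∀ l, (Matrix.of fun i j => S i j l)ᵀ * g + g * (Matrix.of fun i j => S i j l) = 0)
    (ht : ∀ j, normalTrace S j = 0) : S = 0 := by
  have hsym : g 1 0 = g 0 1 := congrFun (congrFun hg 0) 1
  rw [Matrix.det_fin_two, hsym] at hd
  have E : ∀ l i j, ((Matrix.of fun i j => S i j l)ᵀ * g + g * (Matrix.of fun i j => S i j l)) i j
      = 0 := fun l i j => by rw [hS l]; rfl
  have E00 := fun l => E l 0 0
  have E01 := fun l => E l 0 1
  have E11 := fun l => E l 1 1
  simp only [Matrix.add_apply, Matrix.mul_apply, Matrix.transpose_apply, Matrix.of_apply,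
    Fin.sum_univ_two, hsym] at E00 E01 E11
  have t0 := ht 0
  have t1 := ht 1
  simp only [normalTrace, Fin.sum_univ_two] at t0 t1
  set x := g 0 0
  set y := g 0 1
  set z := g 1 1
  -- `t l` is the skew component of `g S_l`, and the four equations below solve `g S_l = t_l ε`.
  obtain ⟨t, hT⟩ : ∃ t : Fin 2 → ℝ, ∀ l, t l = x * S 0 1 l + y * S 1 1 l := ⟨_, fun _ => rfl⟩
  have A00 : ∀ l, (x * z - y * y) * S 0 0 l = y * t l := fun l => by
    rw [hT]; linear_combination (z / 2) * E00 l - y * E01 l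
  have A10 : ∀ l, (x * z - y * y) * S 1 0 l = -(x * t l) := fun l => by
    rw [hT]; linear_combination x * E01 l - (y / 2) * E00 l
  have A01 : ∀ l, (x * z - y * y) * S 0 1 l = z * t l := fun l => by
    rw [hT]; linear_combination -(y / 2) * E11 l
  have A11 : ∀ l, (x * z - y * y) * S 1 1 l = -(y * t l) := fun l => by
    rw [hT]; linear_combination (x / 2) * E11 l
  have B0 : y * t 0 - x * t 1 = 0 := by
    linear_combination (x * z - y * y) * t0 - A00 0 - A10 1 + 2 * (A00 0 + A11 0)
  have B1 : z * t 0 - y * t 1 = 0 := by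
    linear_combination (x * z - y * y) * t1 - A01 0 - A11 1 + 2 * (A00 1 + A11 1)
  have T0 : t 0 = 0 := by
    refine (mul_eq_zero.mp ?_).resolve_left hd
    linear_combination x * B1 - y * B0
  have T1 : t 1 = 0 := by
    refine (mul_eq_zero.mp ?_).resolve_left hd
    linear_combination y * B1 - z * B0
  have T : ∀ l, t l = 0 := by
    intro l; fin_cases l
    · exact T0
    · exact T1
  funext i j l
  have h0 : ∀ r, (x * z - y * y) * r = 0 → r = 0 := fun r hr => (mul_eq_zero.mp hr).resolve_left hd
  refine h0 _ ?_
  fin_cases i <;> fin_cases j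
  · exact (A00 l).trans (by rw [T, mul_zero])
  · exact (A01 l).trans (by rw [T, mul_zero])
  · exact (A10 l).trans (by rw [T, mul_zero, neg_zero])
  · exact (A11 l).trans (by rw [T, mul_zero, neg_zero])

/-- The Levi-Civita symbol in dimension two, `ε_{01} = 1`. -/
def eps : Matrix (Fin 2) (Fin 2) ℝ := !![0, 1; -1, 0]

theorem eps_transpose : epsᵀ = -eps := by
  ext i j; fin_cases i <;> fin_cases j <;> simp [eps]

theorem eps_mul_eps : eps * eps = -1 := by
  ext i j; fin_cases i <;> fin_cases j <;> simp [eps]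

theorem eq_smul_eps {a : Matrix (Fin 2) (Fin 2) ℝ} (ha : aᵀ = -a) : a = a 0 1 • eps := by
  have h : ∀ i j, a j i = -a i j := fun i j => congrFun (congrFun ha i) j
  have h0 : a 0 0 = 0 := by linarith [h 0 0]
  have h1 : a 1 1 = 0 := by linarith [h 1 1]
  ext i j; fin_cases i <;> fin_cases j <;> simp [eps, h0, h1, h 0 1]

/-- The tensor `(g⁻¹ ε)^i_j s_l` with `s = -g ε t`. The choice of `s` makes
`(g⁻¹ ε)^i_j s_i = -t_j`. -/
noncomputable def rotTensor (g : Matrix (Fin 2) (Fin 2) ℝ) (t : Fin 2 → ℝ) (i j l : Fin 2) : ℝ :=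
  (g⁻¹ * eps) i j * (-(g * eps) *ᵥ t) l

theorem normalTrace_rotTensor {g : Matrix (Fin 2) (Fin 2) ℝ} (hg : gᵀ = g) (hd : g.det ≠ 0)
    (t : Fin 2 → ℝ) (j : Fin 2) : normalTrace (rotTensor g t) j = -t j := by
  have hp : (g⁻¹)ᵀ = g⁻¹ := by rw [Matrix.transpose_nonsing_inv, hg]
  have htr : ∑ i, (g⁻¹ * eps) i i = 0 := by
    have h1 : (g⁻¹ * eps).trace = -(g⁻¹ * eps).trace := by
      conv_lhs => rw [← Matrix.trace_transpose, Matrix.transpose_mul, hp, eps_transpose,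
        Matrix.neg_mul, Matrix.trace_neg, Matrix.trace_mul_comm]
    have : (g⁻¹ * eps).trace = 0 := by linarith
    exact this
  have h2 : ∑ i, (g⁻¹ * eps) i j * (-(g * eps) *ᵥ t) i
      = ((g⁻¹ * eps)ᵀ *ᵥ (-(g * eps) *ᵥ t)) j := rfl
  have h3 : (g⁻¹ * eps)ᵀ * -(g * eps) = -1 := by
    rw [Matrix.transpose_mul, hp, eps_transpose, Matrix.neg_mul, Matrix.neg_mul, Matrix.mul_neg,
      neg_neg, Matrix.mul_assoc, ← Matrix.mul_assoc g⁻¹, Matrix.nonsing_inv_mul _ hd.isUnit,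
      Matrix.one_mul, eps_mul_eps]
  simp only [normalTrace, rotTensor]
  rw [h2, Matrix.mulVec_mulVec, h3, ← Finset.sum_mul, htr, Matrix.neg_mulVec, Matrix.one_mulVec]
  simp

end

section
variable {k : ℕ} {U : Set (Chart 2)} {N : NConnection 2}
  {g a : Chart 2 → Matrix (Fin 2) (Fin 2) ℝ} {ξ : Chart 2 → Matrix (Fin 2) (Fin k) ℝ} {ν : ℝ}

/-- A d-connection with `*Γ` torsion-trace free: a compatible connection, corrected by rotations that
keep `g` and `a` parallel. -/
theorem Setup.exists_traceFree (S : Setup U N g a ξ ν) : ∃ D : DConn 2, D.IsSmoothOn U ∧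
    ∀ u ∈ U, ∀ μ, traceVec ((starConn N g a ξ D).coeff u) μ = 0 := by
  obtain ⟨D₀, hD₀⟩ : ∃ D₀ : DConn 2, D₀ = starConn N g a ξ ⟨fun _ _ _ _ => 0, fun _ _ _ _ => 0⟩ :=
    ⟨_, rfl⟩
  have hs₀ : D₀.IsSmoothOn U := by
    rw [hD₀]
    exact S.smooth_star _ ⟨fun _ _ _ => contDiffOn_const, fun _ _ _ => contDiffOn_const⟩
  have hg₀ : ∀ γ, ∀ u ∈ U, Matrix.of (D₀.covLow N g γ u) = 0 := fun γ u hu => by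
    rw [hD₀]; exact S.covLow_star_symm _ γ hu
  have ha₀ : ∀ γ, ∀ u ∈ U, Matrix.of (D₀.covLow N a γ u) = 0 := fun γ u hu => by
    rw [hD₀]; exact S.covLow_star_skew _ γ hu
  let D : DConn 2 := ⟨fun u i j l => D₀.L u i j l + rotTensor (g u) (normalTrace (D₀.L u)) i j l,
    fun u i j l => D₀.C u i j l + rotTensor (g u) (normalTrace (D₀.C u)) i j l⟩
  have hrot : ∀ T : Chart 2 → Fin 2 → Fin 2 → Fin 2 → ℝ,
      (∀ i j l, ContDiffOn ℝ ∞ (fun u => T u i j l) U) → ∀ i j l,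
      ContDiffOn ℝ ∞ (fun u => rotTensor (g u) (normalTrace (T u)) i j l) U := by
    intro T hT i j l
    have h1 := (S.smooth_inv.mul (SmoothMat.const eps)) i j
    have h2 := S.smooth_g.mul (SmoothMat.const eps)
    have ht : ∀ m, ContDiffOn ℝ ∞ (fun u => normalTrace (T u) m) U := fun m =>
      (ContDiffOn.sum fun i _ => hT i m i).sub
        (contDiffOn_const.mul (ContDiffOn.sum fun i _ => hT i i m))
    have h3 : ContDiffOn ℝ ∞ (fun u => ∑ m, -(g u * eps) l m * normalTrace (T u) m) U :=
      ContDiffOn.sum fun m _ => (h2 l m).neg.mul (ht m)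
    exact h1.mul h3
  have hdir : ∀ γ u, ∃ s : ℝ, D.dir u γ = D₀.dir u γ + s • ((g u)⁻¹ * eps) := by
    intro γ u
    rcases γ with l | l
    · refine ⟨(-(g u * eps) *ᵥ normalTrace (D₀.L u)) l, ?_⟩
      ext i j
      simp [D, DConn.dir, rotTensor, mul_comm]
    · refine ⟨(-(g u * eps) *ᵥ normalTrace (D₀.C u)) l, ?_⟩
      ext i j
      simp [D, DConn.dir, rotTensor, mul_comm]
  -- Adding a multiple of `g⁻¹ ε` keeps `g` parallel, and `a` as well because `a = f ε`.
  have hpe : ∀ u ∈ U, ((g u)⁻¹ * eps)ᵀ = -(eps * (g u)⁻¹) := fun u hu => by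
    rw [Matrix.transpose_mul, eps_transpose, S.inv_symm hu, Matrix.neg_mul]
  have hg : ∀ γ, ∀ u ∈ U, Matrix.of (D.covLow N g γ u) = 0 := by
    intro γ u hu
    obtain ⟨s, hs⟩ := hdir γ u
    have h0 : (s • ((g u)⁻¹ * eps))ᵀ * g u + g u * (s • ((g u)⁻¹ * eps)) = 0 := by
      rw [Matrix.transpose_smul, hpe u hu, Matrix.smul_mul, Matrix.mul_smul, ← Matrix.mul_assoc,
        S.g_mul_inv hu, Matrix.neg_mul, Matrix.mul_assoc, S.inv_mul_g hu]
      simp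
    have h1 := hg₀ γ u hu
    rw [covLow_eq] at h1 ⊢
    rw [hs, Matrix.transpose_add]
    linear_combination (norm := noncomm_ring) h1 - h0
  have ha : ∀ γ, ∀ u ∈ U, Matrix.of (D.covLow N a γ u) = 0 := by
    intro γ u hu
    obtain ⟨s, hs⟩ := hdir γ u
    have h0 : (s • ((g u)⁻¹ * eps))ᵀ * a u + a u * (s • ((g u)⁻¹ * eps)) = 0 := by
      rw [eq_smul_eps (S.metric.skew u hu), Matrix.transpose_smul, hpe u hu]
      simp only [Matrix.smul_mul, Matrix.mul_smul, Matrix.neg_mul, Matrix.mul_assoc]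
      module
    have h1 := ha₀ γ u hu
    rw [covLow_eq] at h1 ⊢
    rw [hs, Matrix.transpose_add]
    linear_combination (norm := noncomm_ring) h1 - h0
  refine ⟨D, ⟨fun i j l => (hs₀.1 i j l).add (hrot _ hs₀.1 i j l),
    fun i j l => (hs₀.2 i j l).add (hrot _ hs₀.2 i j l)⟩, fun u hu => ?_⟩
  have hstar : ∀ γ, (starConn N g a ξ D).dir u γ = D.dir u γ := fun γ =>
    S.star_eq_self D γ hu (hg γ u hu) (ha γ u hu)
  have hL : (starConn N g a ξ D).L u = D.L u := by
    funext i j l; exact congrFun (congrFun (hstar (Sum.inl l)) i) j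
  have hC : (starConn N g a ξ D).C u = D.C u := by
    funext i j l; exact congrFun (congrFun (hstar (Sum.inr l)) i) j
  have hadd : ∀ (T : Fin 2 → Fin 2 → Fin 2 → ℝ) j,
      normalTrace (fun i j l => T i j l + rotTensor (g u) (normalTrace T) i j l) j = 0 := by
    intro T j
    have h1 := normalTrace_rotTensor (S.metric.symm u hu) (S.metric.det_ne u hu) (normalTrace T) j
    simp only [normalTrace, Finset.sum_add_distrib] at h1 ⊢
    linarith
  rw [traceVec_coeff_eq_zero_iff, hL, hC]
  exact ⟨hadd (D₀.L u), hadd (D₀.C u)⟩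

theorem Setup.star_eq_of_traceFree (S : Setup U N g a ξ ν) {D D' : DConn 2} {u : Chart 2}
    (hu : u ∈ U) (h : ∀ μ, traceVec ((starConn N g a ξ D).coeff u) μ = 0)
    (h' : ∀ μ, traceVec ((starConn N g a ξ D').coeff u) μ = 0) :
    (starConn N g a ξ D).coeff u = (starConn N g a ξ D').coeff u := by
  rw [traceVec_coeff_eq_zero_iff] at h h'
  have hdiff : ∀ γ, ((starConn N g a ξ D).dir u γ - (starConn N g a ξ D').dir u γ)ᵀ * g u
      + g u * ((starConn N g a ξ D).dir u γ - (starConn N g a ξ D').dir u γ) = 0 := by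
    intro γ
    have h1 := S.covLow_star_symm D γ hu
    have h2 := S.covLow_star_symm D' γ hu
    rw [covLow_eq] at h1 h2
    rw [Matrix.transpose_sub]
    linear_combination (norm := noncomm_ring) h2 - h1
  have hL := eq_zero_of_normalTrace (S.metric.symm u hu) (S.metric.det_ne u hu)
    (S := fun i j l => (starConn N g a ξ D).L u i j l - (starConn N g a ξ D').L u i j l)
    (fun l => hdiff (Sum.inl l)) (fun j => by rw [normalTrace_sub, h.1, h'.1, sub_self])
  have hC := eq_zero_of_normalTrace (S.metric.symm u hu) (S.metric.det_ne u hu)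
    (S := fun i j l => (starConn N g a ξ D).C u i j l - (starConn N g a ξ D').C u i j l)
    (fun l => hdiff (Sum.inr l)) (fun j => by rw [normalTrace_sub, h.2, h'.2, sub_self])
  have hL' : ∀ i j l, (starConn N g a ξ D).L u i j l = (starConn N g a ξ D').L u i j l :=
    fun i j l => sub_eq_zero.mp (congrFun (congrFun (congrFun hL i) j) l)
  have hC' : ∀ i j l, (starConn N g a ξ D).C u i j l = (starConn N g a ξ D').C u i j l :=
    fun i j l => sub_eq_zero.mp (congrFun (congrFun (congrFun hC i) j) l)
  funext γ μ ρ
  rcases γ with i | i <;> rcases μ with j | j <;> rcases ρ with l | l <;>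
    simp only [DConn.coeff, hL', hC']

end

/-! ### The trace vector and the skew field equation -/

section
variable {n k : ℕ} {U : Set (Chart n)} {N : NConnection n}
  {g a : Chart n → Matrix (Fin n) (Fin n) ℝ} {ξ : Chart n → Matrix (Fin n) (Fin k) ℝ} {ν : ℝ}

theorem of_fullMetric (g a : Chart n → Matrix (Fin n) (Fin n) ℝ) (u : Chart n) :
    Matrix.of (fullMetric g a u) = Matrix.fromBlocks (g u + a u) 0 0 (g u + a u) := by
  ext μ ρ
  rcases μ with i | i <;> rcases ρ with j | j <;> rfl

theorem det_fullMetric (g a : Chart n → Matrix (Fin n) (Fin n) ℝ) (u : Chart n) :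
    (Matrix.of (fullMetric g a u)).det = (g u + a u).det * (g u + a u).det := by
  rw [of_fullMetric, Matrix.det_fromBlocks_zero₂₁]

theorem vol_pos {G : Idx n → Idx n → ℝ} (h : (Matrix.of G).det ≠ 0) : 0 < vol G :=
  Real.sqrt_pos.2 (abs_pos.2 h)

/-- The symmetric part of the inverse of `M` is `M⁻¹ (½ (M + ᵗM)) ᵗM⁻¹`. -/
theorem det_symPart_inv_ne_zero {G : Idx n → Idx n → ℝ} (h : (Matrix.of G).det ≠ 0)
    (hs : (Matrix.of G + (Matrix.of G)ᵀ).det ≠ 0) :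
    (Matrix.of (symPart (invMetric G))).det ≠ 0 := by
  obtain ⟨M, hM⟩ : ∃ M, M = Matrix.of G := ⟨_, rfl⟩
  have hP : Matrix.of (symPart (invMetric G)) = (1 / 2 : ℝ) • ((M⁻¹)ᵀ + M⁻¹) := by
    ext μ ρ; simp [symPart, invMetric, hM]
  rw [← hM] at h hs
  have e1 : M * M⁻¹ = 1 := Matrix.mul_nonsing_inv _ h.isUnit
  have e2 : (M⁻¹)ᵀ * Mᵀ = 1 := by rw [← Matrix.transpose_mul, e1, Matrix.transpose_one]
  have key : M * Matrix.of (symPart (invMetric G)) * Mᵀ = (1 / 2 : ℝ) • (M + Mᵀ) := by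
    rw [hP, Matrix.mul_smul, Matrix.smul_mul, Matrix.mul_add, Matrix.add_mul, e1, Matrix.one_mul,
      Matrix.mul_assoc, e2, Matrix.mul_one]
  intro h0
  have := congrArg Matrix.det key
  rw [Matrix.det_mul, Matrix.det_mul, h0, mul_zero, zero_mul, Matrix.det_smul] at this
  exact mul_ne_zero (by positivity) hs this.symm

variable (S : Setup U N g a ξ ν) (hdet : ∀ u ∈ U, (g u + a u).det ≠ 0)
include S hdet

omit S in
theorem det_fullMetric_ne_zero {u : Chart n} (hu : u ∈ U) :
    (Matrix.of (fullMetric g a u)).det ≠ 0 := by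
  rw [det_fullMetric]; exact mul_ne_zero (hdet u hu) (hdet u hu)

theorem Setup.det_symPart_ne_zero {u : Chart n} (hu : u ∈ U) :
    (Matrix.of (symPart (invMetric (fullMetric g a u)))).det ≠ 0 := by
  refine det_symPart_inv_ne_zero (det_fullMetric_ne_zero hdet hu) ?_
  have : Matrix.of (fullMetric g a u) + (Matrix.of (fullMetric g a u))ᵀ
      = Matrix.fromBlocks ((2 : ℝ) • g u) 0 0 ((2 : ℝ) • g u) := by
    rw [of_fullMetric, Matrix.fromBlocks_transpose, Matrix.fromBlocks_add, Matrix.transpose_add,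
      S.metric.symm u hu, S.metric.skew u hu]
    congr 1 <;> simp only [two_smul, Matrix.transpose_zero, add_zero] <;> abel
  have h2 : ((2 : ℝ) • g u).det ≠ 0 := by
    rw [Matrix.det_smul]; exact mul_ne_zero (by positivity) (S.metric.det_ne u hu)
  rw [this, Matrix.det_fromBlocks_zero₂₁]
  exact mul_ne_zero h2 h2

omit hdet in
theorem Setup.smooth_fullMetric : SmoothMat U fun u => Matrix.of (fullMetric g a u) := by
  intro μ ρ
  rcases μ with i | i <;> rcases ρ with j | j <;>
    first
      | exact (S.smooth_g i j).add (S.smooth_a i j)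
      | exact contDiffOn_const

omit S hdet in
theorem contDiffOn_vol {G : Chart n → Idx n → Idx n → ℝ}
    (hG : SmoothMat U fun u => Matrix.of (G u)) (h0 : ∀ u ∈ U, (Matrix.of (G u)).det ≠ 0) :
    ContDiffOn ℝ ∞ (fun u => vol (G u)) U := by
  have h1 : ContDiffOn ℝ ∞ ((fun x : ℝ => |x|) ∘ fun u => (Matrix.of (G u)).det) U :=
    fun u hu => (contDiffAt_abs (h0 u hu)).comp_contDiffWithinAt u (hG.det u hu)
  exact h1.sqrt fun u hu => abs_ne_zero.2 (h0 u hu)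

omit S hdet in
theorem contDiffOn_invMetric {G : Chart n → Idx n → Idx n → ℝ}
    (hG : SmoothMat U fun u => Matrix.of (G u)) (h0 : ∀ u ∈ U, (Matrix.of (G u)).det ≠ 0)
    (μ ρ : Idx n) : ContDiffOn ℝ ∞ (fun u => invMetric (G u) μ ρ) U :=
  hG.inv h0 ρ μ

omit S hdet in
theorem sum_symPart_mul (P : Idx n → Idx n → ℝ) (w : Idx n → ℝ) (μ : Idx n) :
    ∑ ρ, symPart P ρ μ * w ρ = (Matrix.of (symPart P) *ᵥ w) μ := by
  refine Finset.sum_congr rfl fun ρ _ => ?_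
  simp only [symPart, Matrix.of_apply]; ring

/-- The skew field equation, as a linear system for `W_ν`, has a smooth solution. -/
theorem Setup.exists_traceVec : ∃ w : Chart n → Idx n → ℝ,
    (∀ ρ, ContDiffOn ℝ ∞ (fun u => w u ρ) U) ∧ ∀ u ∈ U, ∀ μ,
      2 * ∑ ρ, eD N ρ (fun v => vol (fullMetric g a v)
          * skewPart (invMetric (fullMetric g a v)) ρ μ) u
        = vol (fullMetric g a u)
          * ∑ ρ, symPart (invMetric (fullMetric g a u)) ρ μ * w u ρ := by
  have hG := S.smooth_fullMetric
  have h0 : ∀ u ∈ U, (Matrix.of (fullMetric g a u)).det ≠ 0 := fun u hu =>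
    det_fullMetric_ne_zero hdet hu
  have hvol := contDiffOn_vol hG h0
  have hinv := contDiffOn_invMetric hG h0
  let b : Chart n → Idx n → ℝ := fun u μ => (vol (fullMetric g a u))⁻¹ *
    (2 * ∑ ρ, eD N ρ (fun v => vol (fullMetric g a v)
          * skewPart (invMetric (fullMetric g a v)) ρ μ) u)
  have hb : ∀ μ, ContDiffOn ℝ ∞ (fun u => b u μ) U := fun μ =>
    (hvol.inv fun u hu => (vol_pos (h0 u hu)).ne').mul (contDiffOn_const.mul
      (ContDiffOn.sum fun ρ _ => contDiffOn_eD S.isOpen S.smooth_N ρ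
        (hvol.mul (contDiffOn_const.mul ((hinv ρ μ).sub (hinv μ ρ))))))
  have hP : SmoothMat U fun u => Matrix.of (symPart (invMetric (fullMetric g a u))) :=
    fun μ ρ => contDiffOn_const.mul ((hinv μ ρ).add (hinv ρ μ))
  have hPi := hP.inv fun u hu => S.det_symPart_ne_zero hdet hu
  refine ⟨fun u => (Matrix.of (symPart (invMetric (fullMetric g a u))))⁻¹ *ᵥ b u,
    fun ρ => ?_, fun u hu μ => ?_⟩
  · exact (ContDiffOn.sum fun μ _ => (hPi ρ μ).mul (hb μ) : ContDiffOn ℝ ∞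
      (fun u => ∑ μ, (Matrix.of (symPart (invMetric (fullMetric g a u))))⁻¹ ρ μ * b u μ) U)
  rw [sum_symPart_mul, Matrix.mulVec_mulVec,
    Matrix.mul_nonsing_inv _ (S.det_symPart_ne_zero hdet hu).isUnit, Matrix.one_mulVec]
  simp only [b]
  rw [mul_inv_cancel_left₀ (vol_pos (h0 u hu)).ne']

theorem Setup.traceVec_unique {W W' : Chart n → Idx n → Idx n → Idx n → ℝ}
    (h : SkewFieldEquation N U (fullMetric g a) W) (h' : SkewFieldEquation N U (fullMetric g a) W')
    {u : Chart n} (hu : u ∈ U) : traceVec (W u) = traceVec (W' u) := by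
  have hv := (vol_pos (det_fullMetric_ne_zero hdet hu)).ne'
  have e : Matrix.of (symPart (invMetric (fullMetric g a u))) *ᵥ traceVec (W u)
      = Matrix.of (symPart (invMetric (fullMetric g a u))) *ᵥ traceVec (W' u) := by
    funext μ
    rw [← sum_symPart_mul, ← sum_symPart_mul]
    exact mul_left_cancel₀ hv ((h u hu μ).symm.trans (h' u hu μ))
  exact Matrix.mulVec_injective_iff_isUnit.2
    ((Matrix.isUnit_iff_isUnit_det _).2 (S.det_symPart_ne_zero hdet hu).isUnit) e

end

section
variable {k : ℕ} {U : Set (Chart 2)} {N : NConnection 2}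
  {g a : Chart 2 → Matrix (Fin 2) (Fin 2) ℝ} {ξ : Chart 2 → Matrix (Fin 2) (Fin k) ℝ} {ν : ℝ}

/-- In four dimensions the definition of `W` forces the torsion trace of `Γ` to vanish, because
`traceVec W = traceVec Γ + traceVec W`. -/
theorem traceVec_eq_zero_of_unconstrained {Γ W : Chart 2 → Idx 2 → Idx 2 → Idx 2 → ℝ}
    (h : IsUnconstrainedOf U Γ W) {u : Chart 2} (hu : u ∈ U) (μ : Idx 2) :
    traceVec (Γ u) μ = 0 := by
  have h1 : W u = fun γ α β => Γ u γ α β - (2 / 3) * (delta γ α * traceVec (W u) β) := by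
    funext γ α β; exact h u hu γ α β
  have h2 := traceVec_sub_delta (Γ u) (traceVec (W u)) μ
  rw [← h1] at h2
  push_cast at h2
  linarith

theorem Setup.exists_connections (S : Setup U N g a ξ ν) (hdet : ∀ u ∈ U, (g u + a u).det ≠ 0) :
    ∃ (D : DConn 2) (W : Chart 2 → Idx 2 → Idx 2 → Idx 2 → ℝ),
      D.IsSmoothOn U ∧ (∀ γ μ ν, ContDiffOn ℝ ∞ (fun u => W u γ μ ν) U) ∧
      IsUnconstrainedOf U (starConn N g a ξ D).coeff W ∧
      SkewFieldEquation N U (fullMetric g a) W := by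
  obtain ⟨D, hD, htr⟩ := S.exists_traceFree
  obtain ⟨w, hw, hweq⟩ := S.exists_traceVec hdet
  have hW : ∀ u ∈ U, traceVec (fun γ α β => (starConn N g a ξ D).coeff u γ α β
      - (2 / 3) * (delta γ α * w u β)) = w u := by
    intro u hu
    funext μ
    rw [traceVec_sub_delta, htr u hu]
    push_cast; ring
  refine ⟨D, fun u γ α β => (starConn N g a ξ D).coeff u γ α β - (2 / 3) * (delta γ α * w u β),
    hD, fun γ μ ρ => (contDiffOn_coeff (S.smooth_star D hD) γ μ ρ).sub
      (contDiffOn_const.mul (contDiffOn_const.mul (hw ρ))), fun u hu γ μ ρ => ?_,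
    fun u hu μ => ?_⟩
  · rw [hW u hu]
  · rw [hW u hu]; exact hweq u hu μ

theorem Setup.connections_unique (S : Setup U N g a ξ ν) (hdet : ∀ u ∈ U, (g u + a u).det ≠ 0)
    {D D' : DConn 2} {W W' : Chart 2 → Idx 2 → Idx 2 → Idx 2 → ℝ}
    (h : IsUnconstrainedOf U (starConn N g a ξ D).coeff W)
    (h' : IsUnconstrainedOf U (starConn N g a ξ D').coeff W')
    (hs : SkewFieldEquation N U (fullMetric g a) W)
    (hs' : SkewFieldEquation N U (fullMetric g a) W') {u : Chart 2} (hu : u ∈ U) :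
    (starConn N g a ξ D).coeff u = (starConn N g a ξ D').coeff u ∧ W u = W' u := by
  have e := S.star_eq_of_traceFree hu (fun μ => traceVec_eq_zero_of_unconstrained h hu μ)
    (fun μ => traceVec_eq_zero_of_unconstrained h' hu μ)
  refine ⟨e, ?_⟩
  funext γ μ ρ
  rw [h u hu, h' u hu, e, S.traceVec_unique hdet hs hs' hu]

end

/-! ### Algebra of the variation of the connection -/

section
variable {ι : Type*} [Fintype ι] [DecidableEq ι]

/-- `𝔤^{μν}_{;σ} = e_σ 𝔤^{μν} + 𝔤^{ρν} Γ^μ_{ρσ} + 𝔤^{μρ} Γ^ν_{σρ} - 𝔤^{μν} Γ^ρ_{σρ}` for a density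
`c = 𝔤` with derivatives `dc σ μ ν = e_σ 𝔤^{μν}`. -/
noncomputable def densityDeriv (c : ι → ι → ℝ) (dc : ι → ι → ι → ℝ) (Γ : ι → ι → ι → ℝ) (σ μ ν : ι) : ℝ :=
  dc σ μ ν + ∑ ρ, c ρ ν * Γ μ ρ σ + ∑ ρ, c μ ρ * Γ ν σ ρ - c μ ν * ∑ ρ, Γ ρ σ ρ

/-- `e_τ 𝔤^{(μτ)} + 𝔤^{αβ} Γ^μ_{αβ}`, one half of the symmetrized contraction of `densityDeriv` if `Γ`
has no torsion trace. -/
noncomputable def densityDiv (c : ι → ι → ℝ) (dc : ι → ι → ι → ℝ) (Γ : ι → ι → ι → ℝ) (μ : ι) : ℝ :=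
  ∑ τ, (1 / 2) * (dc τ μ τ + dc τ τ μ) + ∑ α, ∑ β, c α β * Γ μ α β

/-- The coefficient of the variation of `W_μ`, `-⅔ e_τ 𝔤^{[μτ]} - ⅓ 𝔤^{(μν)} W_ν`. -/
noncomputable def traceEL (c : ι → ι → ℝ) (dc : ι → ι → ι → ℝ) (w : ι → ℝ) (μ : ι) : ℝ :=
  -(1 / 3) * ∑ τ, (dc τ μ τ - dc τ τ μ) - (1 / 6) * ∑ ν, (c μ ν + c ν μ) * w ν

omit [DecidableEq ι] in
theorem sum_rev3 (f : ι → ι → ι → ℝ) : ∑ a, ∑ b, ∑ d, f a b d = ∑ d, ∑ b, ∑ a, f a b d := by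
  calc ∑ a, ∑ b, ∑ d, f a b d = ∑ a, ∑ d, ∑ b, f a b d :=
        Finset.sum_congr rfl fun a _ => Finset.sum_comm
    _ = ∑ d, ∑ a, ∑ b, f a b d := Finset.sum_comm
    _ = _ := Finset.sum_congr rfl fun a _ => Finset.sum_comm

omit [DecidableEq ι] in
theorem sum_rot3 (f : ι → ι → ι → ℝ) : ∑ a, ∑ b, ∑ d, f a b d = ∑ d, ∑ a, ∑ b, f a b d := by
  rw [sum_rev3]
  exact Finset.sum_congr rfl fun a _ => Finset.sum_comm

omit [DecidableEq ι] in
theorem sum_rev4 (f : ι → ι → ι → ι → ℝ) :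
    ∑ a, ∑ b, ∑ d, ∑ e, f a b d e = ∑ e, ∑ d, ∑ b, ∑ a, f a b d e := by
  calc ∑ a, ∑ b, ∑ d, ∑ e, f a b d e = ∑ a, ∑ e, ∑ d, ∑ b, f a b d e :=
        Finset.sum_congr rfl fun a _ => sum_rev3 _
    _ = ∑ e, ∑ a, ∑ d, ∑ b, f a b d e := Finset.sum_comm
    _ = _ := Finset.sum_congr rfl fun e _ => (sum_rot3 fun d b a => f a b d e).symm

theorem sum_delta_right (X : ι → ℝ) (K : ι → ι → ι → ℝ) :
    ∑ σ, ∑ μ, ∑ ν, delta ν σ * X μ * K σ μ ν = ∑ μ, X μ * ∑ σ, K σ μ σ := by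
  simp only [delta, ite_mul, one_mul, zero_mul, Finset.sum_ite_eq', Finset.mem_univ, if_true,
    Finset.mul_sum]
  exact Finset.sum_comm

theorem sum_delta_left (X : ι → ℝ) (K : ι → ι → ι → ℝ) :
    ∑ σ, ∑ μ, ∑ ν, delta μ σ * X ν * K σ μ ν = ∑ μ, X μ * ∑ σ, K σ σ μ := by
  have : ∀ σ, ∑ μ, ∑ ν, delta μ σ * X ν * K σ μ ν = ∑ ν, X ν * K σ σ ν := by
    intro σ
    rw [Finset.sum_comm]
    simp [delta]
  simp only [this, Finset.mul_sum]
  exact Finset.sum_comm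

/-- The variation of the Lagrangian with respect to the connection, with `K = δΓ`, `k_μ = δW_μ` and
`κ_μ = δΓ^λ_{(μλ)}`: the divergence term is subtracted and the result is ordered by the
coefficients of `K`, `κ` and `k`. -/
theorem variation_eq (c : ι → ι → ℝ) (dc : ι → ι → ι → ℝ) (Γ K : ι → ι → ι → ℝ) (w k κ : ι → ℝ) :
    ∑ μ, ∑ ν, c μ ν * (-(∑ α, ∑ β, (K β α ν * Γ α μ β + Γ β α ν * K α μ β))
        + ∑ α, (κ α * Γ α μ ν + (∑ ρ, Γ ρ α ρ) * K α μ ν))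
      - 1 / 6 * ∑ μ, ∑ ν, c μ ν * (k μ * w ν + w μ * k ν)
      - ∑ ρ, ∑ μ, ∑ ν, dc ρ μ ν * (K ρ μ ν - 1 / 2 * (delta ν ρ * κ μ + delta μ ρ * κ ν)
        + 1 / 3 * (delta ν ρ * k μ - delta μ ρ * k ν))
      = ∑ σ, ∑ μ, ∑ ν, -densityDeriv c dc Γ σ μ ν * K σ μ ν
        + ∑ μ, densityDiv c dc Γ μ * κ μ + ∑ μ, traceEL c dc w μ * k μ := by
  have t1 : ∑ μ, ∑ ν, c μ ν * ∑ α, ∑ β, K β α ν * Γ α μ β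
      = ∑ σ, ∑ μ, ∑ ν, (∑ ρ, c ρ ν * Γ μ ρ σ) * K σ μ ν := by
    simp only [Finset.mul_sum, Finset.sum_mul]
    rw [sum_rev4]
    exact Finset.sum_congr rfl fun _ _ => Finset.sum_congr rfl fun _ _ =>
      Finset.sum_congr rfl fun _ _ => Finset.sum_congr rfl fun _ _ => by ring
  have t2 : ∑ μ, ∑ ν, c μ ν * ∑ α, ∑ β, Γ β α ν * K α μ β
      = ∑ σ, ∑ μ, ∑ ν, (∑ ρ, c μ ρ * Γ ν σ ρ) * K σ μ ν := by
    simp only [Finset.mul_sum, Finset.sum_mul]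
    calc _ = ∑ μ, ∑ α, ∑ β, ∑ ν, c μ ν * (Γ β α ν * K α μ β) :=
          Finset.sum_congr rfl fun μ _ =>
            (sum_rot3 fun α β ν => c μ ν * (Γ β α ν * K α μ β)).symm
      _ = ∑ α, ∑ μ, ∑ β, ∑ ν, c μ ν * (Γ β α ν * K α μ β) := Finset.sum_comm
      _ = _ := Finset.sum_congr rfl fun _ _ => Finset.sum_congr rfl fun _ _ =>
          Finset.sum_congr rfl fun _ _ => Finset.sum_congr rfl fun _ _ => by ring
  have t3 : ∑ μ, ∑ ν, c μ ν * ∑ α, κ α * Γ α μ ν = ∑ μ, (∑ α, ∑ β, c α β * Γ μ α β) * κ μ := by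
    simp only [Finset.mul_sum, Finset.sum_mul]
    rw [sum_rot3]
    exact Finset.sum_congr rfl fun _ _ => Finset.sum_congr rfl fun _ _ =>
      Finset.sum_congr rfl fun _ _ => by ring
  have t4 : ∑ μ, ∑ ν, c μ ν * ∑ α, (∑ ρ, Γ ρ α ρ) * K α μ ν
      = ∑ σ, ∑ μ, ∑ ν, (c μ ν * ∑ ρ, Γ ρ σ ρ) * K σ μ ν := by
    calc _ = ∑ μ, ∑ ν, ∑ α, c μ ν * ((∑ ρ, Γ ρ α ρ) * K α μ ν) := by
          simp only [Finset.mul_sum]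
      _ = _ := by
          rw [sum_rot3]
          exact Finset.sum_congr rfl fun _ _ => Finset.sum_congr rfl fun _ _ =>
            Finset.sum_congr rfl fun _ _ => by ring
  have t5 : ∑ μ, ∑ ν, c μ ν * (k μ * w ν + w μ * k ν) = ∑ μ, (∑ ν, (c μ ν + c ν μ) * w ν) * k μ := by
    have e : ∑ μ, ∑ ν, c μ ν * (w μ * k ν) = ∑ μ, ∑ ν, c ν μ * (w ν * k μ) := Finset.sum_comm
    simp only [mul_add, Finset.sum_add_distrib]
    rw [e, ← Finset.sum_add_distrib]
    refine Finset.sum_congr rfl fun μ _ => ?_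
    rw [← Finset.sum_add_distrib, Finset.sum_mul]
    exact Finset.sum_congr rfl fun ν _ => by ring
  have t6 : ∀ x : ι → ℝ, ∑ ρ, ∑ μ, ∑ ν, dc ρ μ ν * (delta ν ρ * x μ)
      = ∑ μ, (∑ τ, dc τ μ τ) * x μ := by
    intro x
    simp only [delta, ite_mul, mul_ite, one_mul, zero_mul, mul_zero, Finset.sum_ite_eq',
      Finset.mem_univ, if_true, Finset.sum_mul]
    exact Finset.sum_comm
  have t7 : ∀ x : ι → ℝ, ∑ ρ, ∑ μ, ∑ ν, dc ρ μ ν * (delta μ ρ * x ν)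
      = ∑ μ, (∑ τ, dc τ τ μ) * x μ := by
    intro x
    have : ∀ ρ, ∑ μ, ∑ ν, dc ρ μ ν * (delta μ ρ * x ν) = ∑ ν, dc ρ ρ ν * x ν := by
      intro ρ
      rw [Finset.sum_comm]
      simp [delta]
    simp only [this, Finset.sum_mul]
    exact Finset.sum_comm
  have l1 : ∑ μ, ∑ ν, c μ ν * (-(∑ α, ∑ β, (K β α ν * Γ α μ β + Γ β α ν * K α μ β))
        + ∑ α, (κ α * Γ α μ ν + (∑ ρ, Γ ρ α ρ) * K α μ ν))
      = -(∑ μ, ∑ ν, c μ ν * ∑ α, ∑ β, K β α ν * Γ α μ β)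
        - ∑ μ, ∑ ν, c μ ν * ∑ α, ∑ β, Γ β α ν * K α μ β
        + ∑ μ, ∑ ν, c μ ν * ∑ α, κ α * Γ α μ ν
        + ∑ μ, ∑ ν, c μ ν * ∑ α, (∑ ρ, Γ ρ α ρ) * K α μ ν := by
    simp only [Finset.sum_add_distrib, mul_add, mul_neg, Finset.sum_neg_distrib]
    ring
  have l2 : ∑ ρ, ∑ μ, ∑ ν, dc ρ μ ν * (K ρ μ ν - 1 / 2 * (delta ν ρ * κ μ + delta μ ρ * κ ν)
        + 1 / 3 * (delta ν ρ * k μ - delta μ ρ * k ν))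
      = ∑ ρ, ∑ μ, ∑ ν, dc ρ μ ν * K ρ μ ν
        - 1 / 2 * (∑ ρ, ∑ μ, ∑ ν, dc ρ μ ν * (delta ν ρ * κ μ)
          + ∑ ρ, ∑ μ, ∑ ν, dc ρ μ ν * (delta μ ρ * κ ν))
        + 1 / 3 * (∑ ρ, ∑ μ, ∑ ν, dc ρ μ ν * (delta ν ρ * k μ)
          - ∑ ρ, ∑ μ, ∑ ν, dc ρ μ ν * (delta μ ρ * k ν)) := by
    simp only [← Finset.sum_add_distrib, ← Finset.sum_sub_distrib, Finset.mul_sum]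
    refine Finset.sum_congr rfl fun ρ _ => Finset.sum_congr rfl fun μ _ =>
      Finset.sum_congr rfl fun ν _ => by ring
  have r1 : ∑ σ, ∑ μ, ∑ ν, -densityDeriv c dc Γ σ μ ν * K σ μ ν
      = -(∑ ρ, ∑ μ, ∑ ν, dc ρ μ ν * K ρ μ ν)
        - ∑ σ, ∑ μ, ∑ ν, (∑ ρ, c ρ ν * Γ μ ρ σ) * K σ μ ν
        - ∑ σ, ∑ μ, ∑ ν, (∑ ρ, c μ ρ * Γ ν σ ρ) * K σ μ ν
        + ∑ σ, ∑ μ, ∑ ν, (c μ ν * ∑ ρ, Γ ρ σ ρ) * K σ μ ν := by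
    simp only [← Finset.sum_add_distrib, ← Finset.sum_sub_distrib, ← Finset.sum_neg_distrib]
    refine Finset.sum_congr rfl fun ρ _ => Finset.sum_congr rfl fun μ _ =>
      Finset.sum_congr rfl fun ν _ => by rw [densityDeriv]; ring
  have r2 : ∑ μ, densityDiv c dc Γ μ * κ μ = 1 / 2 * (∑ μ, (∑ τ, dc τ μ τ) * κ μ
      + ∑ μ, (∑ τ, dc τ τ μ) * κ μ) + ∑ μ, (∑ α, ∑ β, c α β * Γ μ α β) * κ μ := by
    rw [← Finset.sum_add_distrib, Finset.mul_sum, ← Finset.sum_add_distrib]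
    refine Finset.sum_congr rfl fun ρ _ => ?_
    rw [densityDiv, ← Finset.mul_sum, Finset.sum_add_distrib]; ring
  have r3 : ∑ μ, traceEL c dc w μ * k μ = -(1 / 3) * (∑ μ, (∑ τ, dc τ μ τ) * k μ
      - ∑ μ, (∑ τ, dc τ τ μ) * k μ) - 1 / 6 * ∑ μ, (∑ ν, (c μ ν + c ν μ) * w ν) * k μ := by
    rw [← Finset.sum_sub_distrib, Finset.mul_sum, Finset.mul_sum, ← Finset.sum_sub_distrib]
    refine Finset.sum_congr rfl fun ρ _ => ?_
    rw [traceEL, Finset.sum_sub_distrib]; ring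
  rw [l1, l2, r1, r2, r3, t1, t2, t3, t4, t5, t6, t7, t6, t7]
  ring

omit [DecidableEq ι] in
theorem sum_densityDeriv_right {c : ι → ι → ℝ} {dc Γ : ι → ι → ι → ℝ}
    (hΓ : ∀ μ, ∑ ρ, Γ ρ μ ρ = ∑ ρ, Γ ρ ρ μ) (μ : ι) :
    ∑ σ, densityDeriv c dc Γ σ μ σ = ∑ σ, dc σ μ σ + ∑ α, ∑ β, c α β * Γ μ α β := by
  have e : ∑ σ, ∑ ρ, c μ ρ * Γ σ σ ρ = ∑ ρ, c μ ρ * ∑ σ, Γ σ ρ σ := by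
    rw [Finset.sum_comm]
    exact Finset.sum_congr rfl fun ρ _ => by rw [hΓ, Finset.mul_sum]
  have e2 : ∑ σ, ∑ ρ, c ρ σ * Γ μ ρ σ = ∑ α, ∑ β, c α β * Γ μ α β := Finset.sum_comm
  simp only [densityDeriv, Finset.sum_sub_distrib, Finset.sum_add_distrib]
  rw [e, e2]; ring

omit [DecidableEq ι] in
theorem sum_densityDeriv_left {c : ι → ι → ℝ} {dc Γ : ι → ι → ι → ℝ} (μ : ι) :
    ∑ σ, densityDeriv c dc Γ σ σ μ = ∑ σ, dc σ σ μ + ∑ α, ∑ β, c α β * Γ μ α β := by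
  have e : ∑ σ, ∑ ρ, c ρ μ * Γ σ ρ σ = ∑ σ, c σ μ * ∑ ρ, Γ ρ σ ρ := by
    rw [Finset.sum_comm]
    exact Finset.sum_congr rfl fun ρ _ => by rw [Finset.mul_sum]
  simp only [densityDeriv, Finset.sum_sub_distrib, Finset.sum_add_distrib]
  rw [e]; ring

theorem sum_delta_mul (X : ι → ℝ) (μ : ι) : ∑ σ, delta μ σ * X σ = X μ := by simp [delta]

theorem sum_delta_self : ∑ σ : ι, delta σ σ = Fintype.card ι := by simp [delta]

/-- `-⅙ 𝔤^{(μν)} w_ν`, the value of the multiplier belonging to the trace constraint. -/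
noncomputable def traceCov (c : ι → ι → ℝ) (w : ι → ℝ) (μ : ι) : ℝ :=
  -(1 / 12) * ∑ ν, (c μ ν + c ν μ) * w ν

/-- The variation vanishes for all covectors `k` and all trace-free `K` iff the coefficient of `k`
vanishes and `densityDeriv` is the multiplier term with the multiplier `traceCov`. -/
theorem variation_eq_zero_iff (h4 : Fintype.card ι = 4) {c : ι → ι → ℝ} {dc Γ : ι → ι → ι → ℝ}
    (hΓ : ∀ μ, ∑ ρ, Γ ρ μ ρ = ∑ ρ, Γ ρ ρ μ) (w : ι → ℝ)  :
    ((∀ k : ι → ℝ, ∑ μ, traceEL c dc w μ * k μ = 0) ∧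
      ∀ K : ι → ι → ι → ℝ, (∀ μ, ∑ ρ, K ρ μ ρ = ∑ ρ, K ρ ρ μ) →
        ∑ σ, ∑ μ, ∑ ν, -densityDeriv c dc Γ σ μ ν * K σ μ ν
          + ∑ μ, densityDiv c dc Γ μ * ∑ ρ, K ρ μ ρ = 0) ↔
    (∀ μ, traceEL c dc w μ = 0) ∧ ∀ σ μ ν, densityDeriv c dc Γ σ μ ν
      = delta ν σ * traceCov c w μ - delta μ σ * traceCov c w ν := by
  have hcard : ∑ σ : ι, delta σ σ = 4 := by rw [sum_delta_self, h4]; norm_num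
  have hdiv : ∀ μ, ∑ σ, densityDeriv c dc Γ σ μ σ + ∑ σ, densityDeriv c dc Γ σ σ μ
      = 2 * densityDiv c dc Γ μ := by
    intro μ
    rw [sum_densityDeriv_right hΓ, sum_densityDeriv_left, densityDiv, ← Finset.mul_sum,
      Finset.sum_add_distrib]
    ring
  have hpair : ∀ (V : ι → ℝ) (K : ι → ι → ι → ℝ), (∀ μ, ∑ ρ, K ρ μ ρ = ∑ ρ, K ρ ρ μ) →
      ∑ σ, ∑ μ, ∑ ν, (delta ν σ * V μ - delta μ σ * V ν) * K σ μ ν = 0 := by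
    intro V K hK
    simp only [sub_mul, Finset.sum_sub_distrib]
    rw [sum_delta_right, sum_delta_left]
    simp only [hK, sub_self]
  have hV1 : ∀ (V : ι → ℝ) (μ : ι), ∑ σ, (delta σ σ * V μ - delta μ σ * V σ) = 3 * V μ := by
    intro V μ
    rw [Finset.sum_sub_distrib, ← Finset.sum_mul, hcard, sum_delta_mul]; ring
  have hV2 : ∀ (V : ι → ℝ) (μ : ι), ∑ σ, (delta μ σ * V σ - delta σ σ * V μ) = -(3 * V μ) := by
    intro V μ
    rw [Finset.sum_sub_distrib, ← Finset.sum_mul, hcard, sum_delta_mul]; ring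
  constructor
  · rintro ⟨h1, h2⟩
    have hU : ∀ μ, traceEL c dc w μ = 0 := by
      intro μ
      have := h1 (Pi.single μ 1)
      simpa [Pi.single_apply] using this
    refine ⟨hU, ?_⟩
    -- The coefficient of `K`, with the multiplier term added. By `hU` the multiplier makes this array
    -- trace-free, so it may be inserted for `K`; the variation is then a sum of squares.
    let K : ι → ι → ι → ℝ := fun σ μ ν => -densityDeriv c dc Γ σ μ ν
      + 1 / 2 * (delta ν σ * densityDiv c dc Γ μ + delta μ σ * densityDiv c dc Γ ν)
      + (delta ν σ * traceCov c w μ - delta μ σ * traceCov c w ν)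
    have hZ1 : ∀ μ, ∑ σ, (delta σ σ * densityDiv c dc Γ μ + delta μ σ * densityDiv c dc Γ σ)
        = 5 * densityDiv c dc Γ μ := by
      intro μ
      rw [Finset.sum_add_distrib, ← Finset.sum_mul, hcard, sum_delta_mul]; ring
    have hZ2 : ∀ μ, ∑ σ, (delta μ σ * densityDiv c dc Γ σ + delta σ σ * densityDiv c dc Γ μ)
        = 5 * densityDiv c dc Γ μ := by
      intro μ
      rw [Finset.sum_add_distrib, ← Finset.sum_mul, hcard, sum_delta_mul]; ring
    have hK1 : ∀ μ, ∑ σ, K σ μ σ = -∑ σ, densityDeriv c dc Γ σ μ σ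
        + 5 / 2 * densityDiv c dc Γ μ + 3 * traceCov c w μ := by
      intro μ
      simp only [K, Finset.sum_add_distrib, ← Finset.mul_sum, Finset.sum_neg_distrib]
      rw [← Finset.sum_add_distrib, hZ1, hV1]; ring
    have hK2 : ∀ μ, ∑ σ, K σ σ μ = -∑ σ, densityDeriv c dc Γ σ σ μ
        + 5 / 2 * densityDiv c dc Γ μ - 3 * traceCov c w μ := by
      intro μ
      simp only [K, Finset.sum_add_distrib, ← Finset.mul_sum, Finset.sum_neg_distrib]
      rw [← Finset.sum_add_distrib, hZ2, hV2]; ring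
    have hKtr : ∀ μ, ∑ ρ, K ρ μ ρ = ∑ ρ, K ρ ρ μ := by
      intro μ
      rw [hK1, hK2, sum_densityDeriv_right hΓ, sum_densityDeriv_left]
      have := hU μ
      rw [traceEL, Finset.sum_sub_distrib] at this
      rw [traceCov]
      linarith
    have hsq : ∑ σ, ∑ μ, ∑ ν, K σ μ ν * K σ μ ν = 0 := by
      have e1 := h2 K hKtr
      have e2 := hpair (traceCov c w) K hKtr
      have e3 := sum_delta_right (densityDiv c dc Γ) K
      have e4 := sum_delta_left (densityDiv c dc Γ) K
      have e5 : ∑ σ, ∑ μ, ∑ ν, K σ μ ν * K σ μ ν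
          = ∑ σ, ∑ μ, ∑ ν, -densityDeriv c dc Γ σ μ ν * K σ μ ν
            + 1 / 2 * (∑ σ, ∑ μ, ∑ ν, delta ν σ * densityDiv c dc Γ μ * K σ μ ν
              + ∑ σ, ∑ μ, ∑ ν, delta μ σ * densityDiv c dc Γ ν * K σ μ ν)
            + ∑ σ, ∑ μ, ∑ ν, (delta ν σ * traceCov c w μ - delta μ σ * traceCov c w ν)
              * K σ μ ν := by
        simp only [← Finset.sum_add_distrib, Finset.mul_sum]
        refine Finset.sum_congr rfl fun σ _ => Finset.sum_congr rfl fun μ _ =>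
          Finset.sum_congr rfl fun ν _ => ?_
        simp only [K]; ring
      simp only [← hKtr] at e4
      rw [e5, e2, e3, e4]
      linarith
    have hK0 : ∀ σ μ ν, K σ μ ν = 0 := by
      intro σ μ ν
      have h1 := (Finset.sum_eq_zero_iff_of_nonneg fun σ _ => Finset.sum_nonneg fun μ _ =>
        Finset.sum_nonneg fun ν _ => mul_self_nonneg (K σ μ ν)).1 hsq σ (Finset.mem_univ _)
      have h2 := (Finset.sum_eq_zero_iff_of_nonneg fun μ _ =>
        Finset.sum_nonneg fun ν _ => mul_self_nonneg (K σ μ ν)).1 h1 μ (Finset.mem_univ _)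
      exact mul_self_eq_zero.1 ((Finset.sum_eq_zero_iff_of_nonneg fun ν _ =>
        mul_self_nonneg (K σ μ ν)).1 h2 ν (Finset.mem_univ _))
    have hZ : ∀ μ, densityDiv c dc Γ μ = 0 := by
      intro μ
      have a1 := hK1 μ
      have a2 := hK2 μ
      simp only [hK0, Finset.sum_const_zero] at a1 a2
      linarith [hdiv μ]
    intro σ μ ν
    have := hK0 σ μ ν
    simp only [K, hZ, mul_zero, add_zero] at this
    linarith
  · rintro ⟨hU, hD⟩
    have hZ : ∀ μ, densityDiv c dc Γ μ = 0 := by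
      intro μ
      have := hdiv μ
      simp only [hD] at this
      rw [hV1, hV2] at this
      linarith
    refine ⟨fun k => by simp [hU], fun K hK => ?_⟩
    have := hpair (traceCov c w) K hK
    simp only [hZ, hD, zero_mul, Finset.sum_const_zero, add_zero, neg_mul, Finset.sum_neg_distrib,
      this, neg_zero]

end

/-! ### Variation of the volume and of the inverse metric -/

/-- For a differentiable function the derivative may be computed along a line. -/
theorem fderiv_eq_of_line {E : Type*} [NormedAddCommGroup E] [NormedSpace ℝ E] {f : E → ℝ}
    {x h : E} {c : ℝ} (hf : DifferentiableAt ℝ f x)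
    (hl : HasDerivAt (fun t : ℝ => f (x + t • h)) c 0) : fderiv ℝ f x h = c :=
  (hf.hasFDerivAt.hasLineDerivAt h).unique hl

section
variable {n : ℕ}

theorem isOpen_nondegenerate :
    IsOpen {G : Idx n → Idx n → ℝ | (Matrix.of G).det ≠ 0} := by
  have : Continuous fun G : Idx n → Idx n → ℝ => (Matrix.of G).det :=
    Continuous.matrix_det (continuous_matrix fun i j => continuous_apply_apply i j)
  exact isOpen_ne_fun this continuous_const

theorem smoothMat_of (U : Set (Idx n → Idx n → ℝ)) :
    SmoothMat U fun G : Idx n → Idx n → ℝ => Matrix.of G := fun i j =>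
  (contDiff_apply_apply ℝ ℝ i j).contDiffOn

theorem differentiableAt_invMetric {G : Idx n → Idx n → ℝ} (h : (Matrix.of G).det ≠ 0)
    (μ ν : Idx n) : DifferentiableAt ℝ (fun G => invMetric G μ ν) G :=
  (((smoothMat_of {G : Idx n → Idx n → ℝ | (Matrix.of G).det ≠ 0}).inv (fun _ hG => hG) ν μ
    ).differentiableOn (by simp)).differentiableAt (isOpen_nondegenerate.mem_nhds h)

theorem differentiableAt_vol {G : Idx n → Idx n → ℝ} (h : (Matrix.of G).det ≠ 0) :
    DifferentiableAt ℝ (fun G => vol G) G := by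
  have h1 : DifferentiableAt ℝ (fun G : Idx n → Idx n → ℝ => (Matrix.of G).det) G :=
    ((smoothMat_of Set.univ).det.differentiableOn (by simp)).differentiableAt Filter.univ_mem
  exact (h1.abs h).sqrt (abs_ne_zero.2 h)

/-- The variation `δG = -G H G` of the metric, which is chosen so that `δ(G⁻¹) = H`. -/
def variation (G : Idx n → Idx n → ℝ) (H : Matrix (Idx n) (Idx n) ℝ) : Idx n → Idx n → ℝ :=
  fun μ ν => -(Matrix.of G * H * Matrix.of G) μ ν

theorem of_line (G : Idx n → Idx n → ℝ) (H : Matrix (Idx n) (Idx n) ℝ) (t : ℝ) :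
    Matrix.of (G + t • variation G H) = Matrix.of G * (1 + t • -(H * Matrix.of G)) := by
  have : Matrix.of (G + t • variation G H)
      = Matrix.of G + t • -(Matrix.of G * H * Matrix.of G) := rfl
  rw [this, Matrix.mul_add, Matrix.mul_one, Matrix.mul_smul, Matrix.mul_neg, Matrix.mul_assoc]

theorem hasDerivAt_det_line (M : Matrix (Idx n) (Idx n) ℝ) :
    HasDerivAt (fun t : ℝ => (1 + t • M).det) M.trace 0 := by
  rw [funext fun t : ℝ => Matrix.det_one_add_smul t M]
  have h := ((((hasDerivAt_id (0 : ℝ)).const_mul M.trace).const_add 1).add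
    (((Polynomial.hasDerivAt (1 + (Polynomial.X : Polynomial ℝ) • M.map Polynomial.C).det.divX.divX
      0)).mul ((hasDerivAt_id (0 : ℝ)).pow 2)))
  refine h.congr_deriv ?_
  simp

theorem hasDerivAt_vol_line {G : Idx n → Idx n → ℝ} (H : Matrix (Idx n) (Idx n) ℝ) :
    HasDerivAt (fun t : ℝ => vol (G + t • variation G H))
      (-(1 / 2) * vol G * (H * Matrix.of G).trace) 0 := by
  have h1 := hasDerivAt_det_line (-(H * Matrix.of G))
  have hpos : 0 < (1 + (0 : ℝ) • -(H * Matrix.of G)).det := by simp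
  have habs : HasDerivAt (fun t : ℝ => |(1 + t • -(H * Matrix.of G)).det|)
      (1 * (-(H * Matrix.of G)).trace) 0 :=
    HasDerivAt.comp (h₂ := fun x : ℝ => |x|) (0 : ℝ) (hasDerivAt_abs_pos hpos) h1
  have h2 := habs.sqrt (abs_pos.2 hpos.ne').ne'
  have h3 := h2.const_mul (vol G)
  have e : (fun t : ℝ => vol (G + t • variation G H))
      = fun t : ℝ => vol G * Real.sqrt |(1 + t • -(H * Matrix.of G)).det| := by
    funext t
    rw [vol, of_line, Matrix.det_mul, abs_mul, Real.sqrt_mul (abs_nonneg _)]; rfl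
  rw [e]
  refine h3.congr_deriv ?_
  simp; ring

theorem hasDerivAt_invMetric_line {G : Idx n → Idx n → ℝ} (h : (Matrix.of G).det ≠ 0)
    (H : Matrix (Idx n) (Idx n) ℝ) (μ ν : Idx n) :
    HasDerivAt (fun t : ℝ => invMetric (G + t • variation G H) μ ν) (H ν μ) 0 := by
  have hl : HasDerivAt (fun t : ℝ => G + t • variation G H) (variation G H) 0 := by
    simpa using ((hasDerivAt_id (0 : ℝ)).smul_const (variation G H)).const_add G
  have hd : ∀ i j, ∃ d, HasDerivAt (fun t : ℝ => (Matrix.of (G + t • variation G H))⁻¹ i j) d 0 := by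
    intro i j
    have h1 : DifferentiableAt ℝ (fun G => invMetric G j i) (G + (0 : ℝ) • variation G H) := by
      rw [zero_smul, add_zero]; exact differentiableAt_invMetric h j i
    have h2 := h1.hasFDerivAt.comp_hasDerivAt (0 : ℝ) hl
    exact ⟨_, h2⟩
  choose d hd using hd
  have hle : ∀ j k, HasDerivAt (fun t : ℝ => Matrix.of (G + t • variation G H) j k)
      (variation G H j k) 0 := fun j k => hasDerivAt_pi.1 (hasDerivAt_pi.1 hl j) k
  have hnear : ∀ᶠ t : ℝ in nhds 0, (Matrix.of (G + t • variation G H)).det ≠ 0 := by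
    refine hl.continuousAt.eventually_mem (isOpen_nondegenerate.mem_nhds ?_)
    simpa using h
  -- differentiate `G⁻¹ G = 1`
  have key : Matrix.of d * Matrix.of G + (Matrix.of G)⁻¹ * Matrix.of (variation G H) = 0 := by
    ext i k
    have h1 : HasDerivAt (fun t : ℝ => ∑ j, (Matrix.of (G + t • variation G H))⁻¹ i j
        * Matrix.of (G + t • variation G H) j k)
        (∑ j, (d i j * Matrix.of (G + (0 : ℝ) • variation G H) j k
          + (Matrix.of (G + (0 : ℝ) • variation G H))⁻¹ i j * variation G H j k)) 0 :=
      HasDerivAt.fun_sum fun j _ => (hd i j).mul (hle j k)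
    have h2 : HasDerivAt (fun t : ℝ => ∑ j, (Matrix.of (G + t • variation G H))⁻¹ i j
        * Matrix.of (G + t • variation G H) j k) 0 0 := by
      refine (hasDerivAt_const (0 : ℝ) ((1 : Matrix (Idx n) (Idx n) ℝ) i k)).congr_of_eventuallyEq ?_
      filter_upwards [hnear] with t ht
      rw [← Matrix.mul_apply, Matrix.nonsing_inv_mul _ ht.isUnit]
    have h3 := h1.unique h2
    rw [zero_smul, add_zero, Finset.sum_add_distrib] at h3
    exact h3
  have e1 : Matrix.of (variation G H) = -(Matrix.of G * H * Matrix.of G) := rfl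
  rw [e1, Matrix.mul_neg, ← Matrix.mul_assoc, ← Matrix.mul_assoc,
    Matrix.nonsing_inv_mul _ h.isUnit, Matrix.one_mul, ← sub_eq_add_neg, ← Matrix.sub_mul] at key
  have key2 := congrArg (· * (Matrix.of G)⁻¹) key
  simp only [Matrix.mul_assoc, Matrix.mul_nonsing_inv _ h.isUnit, Matrix.mul_one,
    Matrix.zero_mul] at key2
  have : d ν μ = H ν μ := congrFun (congrFun (sub_eq_zero.mp key2) ν) μ
  rw [← this]
  exact hd ν μ

end

/-! ### Partial derivatives of the Lagrangian -/

section
variable {n : ℕ}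

theorem differentiable_traceVec (μ : Idx n) :
    Differentiable ℝ fun W : Idx n → Idx n → Idx n → ℝ => traceVec W μ := by
  unfold traceVec; fun_prop

theorem differentiable_gammaOf (γ μ ν : Idx n) :
    Differentiable ℝ fun W : Idx n → Idx n → Idx n → ℝ => gammaOf W γ μ ν := by
  unfold gammaOf
  have := differentiable_traceVec (n := n)
  fun_prop

theorem differentiableAt_lagrangian_field (lam mu : ℝ) (σ : Idx n → Idx n → ℝ) {p : Field n}
    (q : Idx n → Field n) (h : (Matrix.of p.1).det ≠ 0) :
    DifferentiableAt ℝ (fun p => lagrangian lam mu σ p q) p := by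
  have hv : DifferentiableAt ℝ (fun p : Field n => vol p.1) p :=
    (differentiableAt_vol h).comp p differentiableAt_fst
  have hi : ∀ μ ν, DifferentiableAt ℝ (fun p : Field n => invMetric p.1 μ ν) p := fun μ ν =>
    (differentiableAt_invMetric h μ ν).comp p differentiableAt_fst
  have hg : ∀ γ μ ν, DifferentiableAt ℝ (fun p : Field n => gammaOf p.2 γ μ ν) p := fun γ μ ν =>
    ((differentiable_gammaOf γ μ ν) _).comp p differentiableAt_snd
  have ht : ∀ μ, DifferentiableAt ℝ (fun p : Field n => traceVec p.2 μ) p := fun μ =>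
    ((differentiable_traceVec μ) _).comp p differentiableAt_snd
  unfold lagrangian ricciW ricciGamma symPart skewPart
  fun_prop

theorem differentiableAt_lagrangian_jet (lam mu : ℝ) (σ : Idx n → Idx n → ℝ) (p : Field n)
    (q : Idx n → Field n) :
    DifferentiableAt ℝ (fun q => lagrangian lam mu σ p q) q := by
  have hq : ∀ ρ, DifferentiableAt ℝ (fun q : Idx n → Field n => (q ρ).2) q := fun ρ => by fun_prop
  have hg : ∀ ρ γ μ ν, DifferentiableAt ℝ (fun q : Idx n → Field n => gammaOf (q ρ).2 γ μ ν) q :=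
    fun ρ γ μ ν => ((differentiable_gammaOf γ μ ν) _).comp q (hq ρ)
  have ht : ∀ ρ μ, DifferentiableAt ℝ (fun q : Idx n → Field n => traceVec (q ρ).2 μ) q :=
    fun ρ μ => ((differentiable_traceVec μ) _).comp q (hq ρ)
  unfold lagrangian ricciW ricciGamma symPart skewPart
  fun_prop

theorem traceVec_add_smul (W h : Idx n → Idx n → Idx n → ℝ) (t : ℝ) (μ : Idx n) :
    traceVec (W + t • h) μ = traceVec W μ + t * traceVec h μ := by
  simp only [traceVec, Pi.add_apply, Pi.smul_apply, smul_eq_mul]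
  have : ∀ γ, W γ μ γ + t * h γ μ γ - (W γ γ μ + t * h γ γ μ)
      = (W γ μ γ - W γ γ μ) + t * (h γ μ γ - h γ γ μ) := fun γ => by ring
  simp only [this, Finset.sum_add_distrib, ← Finset.mul_sum]
  ring

theorem gammaOf_add_smul (W h : Idx n → Idx n → Idx n → ℝ) (t : ℝ) (γ μ ν : Idx n) :
    gammaOf (W + t • h) γ μ ν = gammaOf W γ μ ν + t * gammaOf h γ μ ν := by
  simp only [gammaOf, traceVec_add_smul, Pi.add_apply, Pi.smul_apply, smul_eq_mul]
  ring

theorem hasDerivAt_affine (x y : ℝ) : HasDerivAt (fun t : ℝ => x + t * y) y 0 := by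
  simpa using ((hasDerivAt_id (0 : ℝ)).mul_const y).const_add x

theorem hasDerivAt_ricciW_field (Γ K : Idx n → Idx n → Idx n → ℝ)
    (dΓ : Idx n → Idx n → Idx n → Idx n → ℝ) (dw : Idx n → Idx n → ℝ)
    (μ ν : Idx n) :
    HasDerivAt (fun t : ℝ => ricciW (fun γ α β => Γ γ α β + t * K γ α β) dΓ dw μ ν)
      (-(∑ α, ∑ β, (K β α ν * Γ α μ β + Γ β α ν * K α μ β))
        + ∑ α, ((∑ γ, symPart (K γ) α γ) * Γ α μ ν + (∑ γ, symPart (Γ γ) α γ) * K α μ ν)) 0 := by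
  have hc : ∀ γ α β, HasDerivAt (fun t : ℝ => Γ γ α β + t * K γ α β) (K γ α β) 0 :=
    fun γ α β => hasDerivAt_affine _ _
  have h1 := HasDerivAt.fun_sum (u := Finset.univ) fun (α : Idx n) _ =>
    HasDerivAt.fun_sum (u := Finset.univ) fun (β : Idx n) _ => (hc β α ν).mul (hc α μ β)
  have h2 := HasDerivAt.fun_sum (u := Finset.univ) fun (α : Idx n) _ =>
    (HasDerivAt.fun_sum (u := Finset.univ) fun (γ : Idx n) _ =>
      ((hc γ α γ).add (hc γ γ α)).const_mul (1 / 2)).mul (hc α μ ν)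
  have h3 := ((h1.const_sub (∑ β, dΓ β β μ ν
    - (1 / 2) * (∑ γ, symPart (fun α β => dΓ ν γ α β) μ γ
      + ∑ γ, symPart (fun α β => dΓ μ γ α β) ν γ))).add h2).add_const ((2 / 3) * skewPart dw ν μ)
  refine (h3.congr_deriv ?_)
  simp only [symPart, Pi.add_apply, zero_mul, add_zero]

theorem hasDerivAt_ricciW_jet (Γ : Idx n → Idx n → Idx n → ℝ)
    (dΓ dK : Idx n → Idx n → Idx n → Idx n → ℝ) (dw dk : Idx n → Idx n → ℝ) (μ ν : Idx n) :
    HasDerivAt (fun t : ℝ => ricciW Γ (fun ρ γ α β => dΓ ρ γ α β + t * dK ρ γ α β)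
      (fun ρ α => dw ρ α + t * dk ρ α) μ ν)
      (∑ β, dK β β μ ν - 1 / 2 * (∑ γ, symPart (dK ν γ) μ γ + ∑ γ, symPart (dK μ γ) ν γ)
        + 2 / 3 * skewPart dk ν μ) 0 := by
  have hc : ∀ ρ γ α β, HasDerivAt (fun t : ℝ => dΓ ρ γ α β + t * dK ρ γ α β) (dK ρ γ α β) 0 :=
    fun ρ γ α β => hasDerivAt_affine _ _
  have hk : ∀ ρ α, HasDerivAt (fun t : ℝ => dw ρ α + t * dk ρ α) (dk ρ α) 0 :=
    fun ρ α => hasDerivAt_affine _ _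
  have hs : ∀ ρ α, HasDerivAt (fun t : ℝ => ∑ γ, symPart (fun a b => dΓ ρ γ a b + t * dK ρ γ a b) α γ)
      (∑ γ, symPart (dK ρ γ) α γ) 0 := fun ρ α =>
    HasDerivAt.fun_sum fun γ _ => ((hc ρ γ α γ).add (hc ρ γ γ α)).const_mul (1 / 2)
  have h1 : HasDerivAt (fun t : ℝ => ∑ β, (dΓ β β μ ν + t * dK β β μ ν)) (∑ β, dK β β μ ν) 0 :=
    HasDerivAt.fun_sum fun β _ => hc β β μ ν
  have h2 := (((h1.sub (((hs ν μ).add (hs μ ν)).const_mul (1 / 2))).sub_const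
    (∑ α, ∑ β, Γ β α ν * Γ α μ β)).add_const (∑ α, (∑ γ, symPart (Γ γ) α γ) * Γ α μ ν)).add
      ((((hk ν μ).sub (hk μ ν)).const_mul (1 / 2)).const_mul (2 / 3))
  exact h2

theorem fderiv_lagrangian_connection (lam mu : ℝ) (σ : Idx n → Idx n → ℝ) {p : Field n}
    (q : Idx n → Field n) (hp : (Matrix.of p.1).det ≠ 0) (h : Idx n → Idx n → Idx n → ℝ) :
    fderiv ℝ (fun p => lagrangian lam mu σ p q) p (0, h)
      = ∑ μ, ∑ ν, vol p.1 * invMetric p.1 μ ν *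
          (-(∑ α, ∑ β, (gammaOf h β α ν * gammaOf p.2 α μ β + gammaOf p.2 β α ν * gammaOf h α μ β))
            + ∑ α, ((∑ γ, symPart (gammaOf h γ) α γ) * gammaOf p.2 α μ ν
              + (∑ γ, symPart (gammaOf p.2 γ) α γ) * gammaOf h α μ ν))
        - 1 / 6 * ∑ μ, ∑ ν, vol p.1 * invMetric p.1 μ ν
          * (traceVec h μ * traceVec p.2 ν + traceVec p.2 μ * traceVec h ν) := by
  refine fderiv_eq_of_line (differentiableAt_lagrangian_field lam mu σ q hp) ?_
  have e : ∀ t : ℝ, p + t • ((0, h) : Field n) = (p.1, p.2 + t • h) := fun t => by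
    ext <;> simp
  have hγ : ∀ t : ℝ, gammaOf (p.2 + t • h)
      = fun γ α β => gammaOf p.2 γ α β + t * gammaOf h γ α β := fun t => by
    funext γ α β; exact gammaOf_add_smul _ _ _ _ _ _
  simp only [e, lagrangian, hγ, traceVec_add_smul]
  have hR := (HasDerivAt.fun_sum (u := Finset.univ) fun (μ : Idx n) _ =>
    HasDerivAt.fun_sum (u := Finset.univ) fun (ν : Idx n) _ =>
      (hasDerivAt_ricciW_field (gammaOf p.2) (gammaOf h) (fun ρ => gammaOf (q ρ).2)
        (fun ρ => traceVec (q ρ).2) μ ν).const_mul (invMetric p.1 μ ν)).const_mul (vol p.1)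
  have hw := ((HasDerivAt.fun_sum (u := Finset.univ) fun (μ : Idx n) _ =>
    HasDerivAt.fun_sum (u := Finset.univ) fun (ν : Idx n) _ =>
      ((hasDerivAt_affine (traceVec p.2 μ) (traceVec h μ)).mul
        (hasDerivAt_affine (traceVec p.2 ν) (traceVec h ν))).const_mul
          (invMetric p.1 μ ν)).const_mul (vol p.1)).const_mul (1 / 6)
  refine ((((hR.sub_const _).sub_const _).sub hw).sub_const _).congr_deriv ?_
  simp only [zero_mul, add_zero, Finset.mul_sum, mul_assoc]

theorem fderiv_lagrangian_jet (lam mu : ℝ) (σ : Idx n → Idx n → ℝ) (p : Field n)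
    (q : Idx n → Field n) (ρ : Idx n) (h : Field n) :
    fderiv ℝ (fun q => lagrangian lam mu σ p q) q (Pi.single ρ h)
      = ∑ μ, ∑ ν, vol p.1 * invMetric p.1 μ ν *
          (gammaOf h.2 ρ μ ν - 1 / 2 * (delta ν ρ * ∑ γ, symPart (gammaOf h.2 γ) μ γ
            + delta μ ρ * ∑ γ, symPart (gammaOf h.2 γ) ν γ)
          + 1 / 3 * (delta ν ρ * traceVec h.2 μ - delta μ ρ * traceVec h.2 ν)) := by
  refine fderiv_eq_of_line (differentiableAt_lagrangian_jet lam mu σ p q) ?_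
  have e : ∀ (t : ℝ) τ, ((q + t • (Pi.single ρ h : Idx n → Field n)) τ).2 = (q τ).2 + (t * delta τ ρ) • h.2 := by
    intro t τ
    by_cases hτ : τ = ρ
    · subst hτ; simp [delta]
    · simp [delta, hτ]
  have hγ : ∀ (t : ℝ) τ, gammaOf ((q τ).2 + (t * delta τ ρ) • h.2)
      = fun γ α β => gammaOf (q τ).2 γ α β + t * (delta τ ρ * gammaOf h.2 γ α β) := fun t τ => by
    funext γ α β; rw [gammaOf_add_smul]; ring
  have hw : ∀ (t : ℝ) τ, traceVec ((q τ).2 + (t * delta τ ρ) • h.2)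
      = fun α => traceVec (q τ).2 α + t * (delta τ ρ * traceVec h.2 α) := fun t τ => by
    funext α; rw [traceVec_add_smul]; ring
  simp only [lagrangian, e, hγ, hw]
  have hR := (HasDerivAt.fun_sum (u := Finset.univ) fun (μ : Idx n) _ =>
    HasDerivAt.fun_sum (u := Finset.univ) fun (ν : Idx n) _ =>
      (hasDerivAt_ricciW_jet (gammaOf p.2) (fun τ => gammaOf (q τ).2)
        (fun τ γ α β => delta τ ρ * gammaOf h.2 γ α β) (fun τ => traceVec (q τ).2)
        (fun τ α => delta τ ρ * traceVec h.2 α) μ ν).const_mul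
          (invMetric p.1 μ ν)).const_mul (vol p.1)
  refine ((((hR.sub_const _).sub_const _).sub_const _).sub_const _).congr_deriv ?_
  rw [Finset.mul_sum]
  refine Finset.sum_congr rfl fun μ _ => ?_
  rw [Finset.mul_sum]
  refine Finset.sum_congr rfl fun ν _ => ?_
  have h1 : ∑ β, delta β ρ * gammaOf h.2 β μ ν = gammaOf h.2 ρ μ ν := by simp [delta]
  have h2 : ∀ α τ, ∑ γ, symPart (fun a b => delta τ ρ * gammaOf h.2 γ a b) α γ
      = delta τ ρ * ∑ γ, symPart (gammaOf h.2 γ) α γ := fun α τ => by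
    rw [Finset.mul_sum]
    exact Finset.sum_congr rfl fun γ _ => by simp only [symPart]; ring
  rw [h1, h2, h2, skewPart]
  ring

end

/-! ### The metric equation -/

section
variable {n : ℕ}

/-- Left side minus right side of the metric equation, for given values `T` of the curvature and `w` of
the trace vector. -/
noncomputable def metricEL (lam mu : ℝ) (G T : Idx n → Idx n → ℝ) (w : Idx n → ℝ)
    (Y : Idx n → Idx n → ℝ) (μ ν : Idx n) : ℝ :=
  traceReversed G T μ ν + lam * G μ ν + mu ^ 2 / 4 * massTensor G μ ν
    - 1 / 6 * traceReversed G (fun α β => w α * w β) μ ν - 8 * Real.pi * Y μ ν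

theorem sum_mul_skewPart_swap (A B : Idx n → Idx n → ℝ) :
    ∑ μ, ∑ ν, A μ ν * skewPart B ν μ = ∑ μ, ∑ ν, skewPart A μ ν * B ν μ := by
  have e : ∑ μ, ∑ ν, A μ ν * B μ ν = ∑ μ, ∑ ν, A ν μ * B ν μ := Finset.sum_comm
  have l : ∑ μ, ∑ ν, A μ ν * skewPart B ν μ
      = 1 / 2 * (∑ μ, ∑ ν, A μ ν * B ν μ - ∑ μ, ∑ ν, A μ ν * B μ ν) := by
    simp only [← Finset.sum_sub_distrib, Finset.mul_sum]
    exact Finset.sum_congr rfl fun μ _ => Finset.sum_congr rfl fun ν _ => by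
      rw [skewPart]; ring
  rw [l, e]
  simp only [← Finset.sum_sub_distrib, Finset.mul_sum]
  exact Finset.sum_congr rfl fun μ _ => Finset.sum_congr rfl fun ν _ => by rw [skewPart]; ring

theorem variation_apply (G : Idx n → Idx n → ℝ) (H : Matrix (Idx n) (Idx n) ℝ) (μ ν : Idx n) :
    variation G H μ ν = -∑ α, ∑ β, G μ α * H α β * G β ν := by
  simp only [variation, Matrix.mul_apply, Matrix.of_apply, Finset.sum_mul]
  rw [Finset.sum_comm]

/-- The mass tensor is, up to sign, the variation of `√|G| G^{μν} G_{[νμ]}` divided by `√|G|`; the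
three terms come from the variations of `G^{μν}`, of `G_{[νμ]}` and of the volume. -/
theorem sum_mul_massTensor (G : Idx n → Idx n → ℝ) (H : Matrix (Idx n) (Idx n) ℝ) :
    ∑ μ, ∑ ν, H ν μ * massTensor G μ ν
      = -(∑ μ, ∑ ν, H ν μ * skewPart G ν μ)
        - ∑ μ, ∑ ν, invMetric G μ ν * skewPart (variation G H) ν μ
        + 1 / 2 * (∑ μ, ∑ ν, H ν μ * G μ ν) * ∑ μ, ∑ ν, invMetric G μ ν * skewPart G ν μ := by
  have h1 : ∑ μ, ∑ ν, invMetric G μ ν * skewPart (variation G H) ν μ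
      = -∑ μ, ∑ ν, H ν μ * ∑ ρ, ∑ σ, skewPart (invMetric G) σ ρ * (G μ σ * G ρ ν) := by
    rw [sum_mul_skewPart_swap]
    simp only [variation_apply, mul_neg, Finset.sum_neg_distrib, Finset.mul_sum]
    congr 1
    rw [sum_rev4]
    exact Finset.sum_congr rfl fun _ _ => Finset.sum_congr rfl fun _ _ =>
      Finset.sum_congr rfl fun _ _ => Finset.sum_congr rfl fun _ _ => by ring
  have h2 : ∑ μ, ∑ ν, invMetric G μ ν * skewPart G ν μ
      = ∑ ρ, ∑ σ, skewPart (invMetric G) σ ρ * skewPart G ρ σ := by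
    rw [Finset.sum_comm]
    have : ∀ A B : Idx n → Idx n → ℝ, ∑ ρ, ∑ σ, A σ ρ * skewPart B ρ σ
        = ∑ ρ, ∑ σ, skewPart A σ ρ * skewPart B ρ σ := by
      intro A B
      have e : ∑ ρ, ∑ σ, A σ ρ * skewPart B ρ σ = ∑ ρ, ∑ σ, A ρ σ * skewPart B σ ρ :=
        Finset.sum_comm
      have e2 : ∑ ρ, ∑ σ, skewPart A σ ρ * skewPart B ρ σ
          = 1 / 2 * (∑ ρ, ∑ σ, A σ ρ * skewPart B ρ σ + ∑ ρ, ∑ σ, A ρ σ * skewPart B σ ρ) := by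
        simp only [← Finset.sum_add_distrib, Finset.mul_sum]
        exact Finset.sum_congr rfl fun μ _ => Finset.sum_congr rfl fun ν _ => by
          rw [skewPart, skewPart, skewPart]; ring
      rw [e2, ← e]; ring
    exact this _ _
  have h3 : ∀ μ ν, massTensor G μ ν = -skewPart G ν μ
      + ∑ ρ, ∑ σ, skewPart (invMetric G) σ ρ * (G μ σ * G ρ ν)
      + 1 / 2 * G μ ν * ∑ ρ, ∑ σ, skewPart (invMetric G) σ ρ * skewPart G ρ σ := by
    intro μ ν
    have : skewPart G μ ν = -skewPart G ν μ := by simp only [skewPart]; ring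
    rw [massTensor, this, add_assoc]
    simp only [mul_add, Finset.sum_add_distrib, Finset.mul_sum]
    congr 2
    exact Finset.sum_congr rfl fun μ _ => Finset.sum_congr rfl fun ν _ => by ring
  rw [h1, h2]
  simp only [h3]
  generalize ∑ ρ, ∑ σ, skewPart (invMetric G) σ ρ * skewPart G ρ σ = c
  simp only [mul_add, Finset.sum_add_distrib, mul_neg, Finset.sum_neg_distrib, Finset.mul_sum,
    Finset.sum_mul, sub_neg_eq_add]
  congr 1
  exact Finset.sum_congr rfl fun μ _ => Finset.sum_congr rfl fun ν _ => by ring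

theorem sum_mul_traceReversed (G T : Idx n → Idx n → ℝ) (H : Matrix (Idx n) (Idx n) ℝ) :
    ∑ μ, ∑ ν, H ν μ * traceReversed G T μ ν = ∑ μ, ∑ ν, H ν μ * T μ ν
      - 1 / 2 * (∑ μ, ∑ ν, H ν μ * G μ ν) * ∑ α, ∑ β, invMetric G α β * T α β := by
  simp only [traceReversed]
  generalize ∑ α, ∑ β, invMetric G α β * T α β = c
  simp only [mul_sub, Finset.sum_sub_distrib, Finset.mul_sum, Finset.sum_mul]
  congr 1
  exact Finset.sum_congr rfl fun μ _ => Finset.sum_congr rfl fun ν _ => by ring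

/-- The derivative of the Lagrangian in the direction `δG = -G H G`, that is `δG^{μν} = H_{νμ}`. The
source density is held fixed. -/
theorem fderiv_lagrangian_metric (lam mu : ℝ) (Y : Idx n → Idx n → ℝ) {p : Field n}
    (q : Idx n → Field n) (hp : (Matrix.of p.1).det ≠ 0) (H : Matrix (Idx n) (Idx n) ℝ) :
    fderiv ℝ (fun p' => lagrangian lam mu (fun μ ν => vol p.1 * Y μ ν) p' q) p (variation p.1 H, 0)
      = vol p.1 * ∑ μ, ∑ ν, H ν μ * metricEL lam mu p.1
          (ricciW (gammaOf p.2) (fun ρ => gammaOf (q ρ).2) (fun ρ => traceVec (q ρ).2))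
          (traceVec p.2) Y μ ν := by
  refine fderiv_eq_of_line (differentiableAt_lagrangian_field lam mu _ q hp) ?_
  have e : ∀ t : ℝ, p + t • ((variation p.1 H, 0) : Field n)
      = (p.1 + t • variation p.1 H, p.2) := fun t => by
    ext <;> simp
  simp only [e, lagrangian]
  have hv := hasDerivAt_vol_line (G := p.1) H
  have hI := hasDerivAt_invMetric_line hp H
  have hA : ∀ μ ν, HasDerivAt (fun t : ℝ => skewPart (p.1 + t • variation p.1 H) ν μ)
      (skewPart (variation p.1 H) ν μ) 0 := fun μ ν =>
    ((hasDerivAt_affine (p.1 ν μ) (variation p.1 H ν μ)).sub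
      (hasDerivAt_affine (p.1 μ ν) (variation p.1 H μ ν))).const_mul (1 / 2)
  have hsum : ∀ T : Idx n → Idx n → ℝ,
      HasDerivAt (fun t : ℝ => ∑ μ, ∑ ν, invMetric (p.1 + t • variation p.1 H) μ ν * T μ ν)
        (∑ μ, ∑ ν, H ν μ * T μ ν) 0 := fun T =>
    HasDerivAt.fun_sum fun μ _ => HasDerivAt.fun_sum fun ν _ => (hI μ ν).mul_const (T μ ν)
  have hsk : HasDerivAt (fun t : ℝ => ∑ μ, ∑ ν, invMetric (p.1 + t • variation p.1 H) μ ν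
        * skewPart (p.1 + t • variation p.1 H) ν μ)
      (∑ μ, ∑ ν, (H ν μ * skewPart (p.1 + (0 : ℝ) • variation p.1 H) ν μ
        + invMetric (p.1 + (0 : ℝ) • variation p.1 H) μ ν * skewPart (variation p.1 H) ν μ)) 0 :=
    HasDerivAt.fun_sum fun μ _ => HasDerivAt.fun_sum fun ν _ => (hI μ ν).mul (hA μ ν)
  have htr : (H * Matrix.of p.1).trace = ∑ μ, ∑ ν, H ν μ * p.1 μ ν := by
    rw [Finset.sum_comm]; rfl
  refine (((((hv.mul (hsum _)).sub (hv.const_mul (2 * lam))).sub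
    ((hv.mul hsk).const_mul (mu ^ 2 / 4))).sub ((hv.mul (hsum _)).const_mul (1 / 6))).sub
    ((hsum _).const_mul (8 * Real.pi))).congr_deriv ?_
  simp only [zero_smul, add_zero, htr]
  have hE : ∑ μ, ∑ ν, H ν μ * metricEL lam mu p.1
      (ricciW (gammaOf p.2) (fun ρ => gammaOf (q ρ).2) (fun ρ => traceVec (q ρ).2))
          (traceVec p.2) Y μ ν
      = ∑ μ, ∑ ν, H ν μ * traceReversed p.1
        (ricciW (gammaOf p.2) (fun ρ => gammaOf (q ρ).2) (fun ρ => traceVec (q ρ).2)) μ ν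
        + lam * ∑ μ, ∑ ν, H ν μ * p.1 μ ν + mu ^ 2 / 4 * ∑ μ, ∑ ν, H ν μ * massTensor p.1 μ ν
        - 1 / 6 * ∑ μ, ∑ ν, H ν μ * traceReversed p.1
          (fun α β => traceVec p.2 α * traceVec p.2 β) μ ν
        - 8 * Real.pi * ∑ μ, ∑ ν, H ν μ * Y μ ν := by
    simp only [← Finset.sum_add_distrib, ← Finset.sum_sub_distrib, Finset.mul_sum]
    exact Finset.sum_congr rfl fun μ _ => Finset.sum_congr rfl fun ν _ => by
      rw [metricEL]; ring
  have hY : ∑ μ, ∑ ν, H ν μ * (vol p.1 * Y μ ν) = vol p.1 * ∑ μ, ∑ ν, H ν μ * Y μ ν := by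
    simp only [Finset.mul_sum]
    exact Finset.sum_congr rfl fun μ _ => Finset.sum_congr rfl fun ν _ => by ring
  rw [hE, sum_mul_traceReversed, sum_mul_traceReversed, sum_mul_massTensor, hY]
  simp only [Finset.sum_add_distrib]
  ring

theorem variation_surjective {G : Idx n → Idx n → ℝ} (h : (Matrix.of G).det ≠ 0)
    (δ : Idx n → Idx n → ℝ) : ∃ H, variation G H = δ := by
  refine ⟨-((Matrix.of G)⁻¹ * Matrix.of δ * (Matrix.of G)⁻¹), ?_⟩
  have : -(Matrix.of G * -((Matrix.of G)⁻¹ * Matrix.of δ * (Matrix.of G)⁻¹) * Matrix.of G)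
      = Matrix.of δ := by
    rw [Matrix.mul_neg, Matrix.neg_mul, neg_neg, Matrix.mul_assoc, Matrix.mul_assoc,
      Matrix.mul_assoc, Matrix.nonsing_inv_mul _ h.isUnit, Matrix.mul_one, ← Matrix.mul_assoc,
      Matrix.mul_nonsing_inv _ h.isUnit, Matrix.one_mul]
  exact this

theorem metric_stationary_iff (lam mu : ℝ) (Y : Idx n → Idx n → ℝ) {p : Field n}
    (q : Idx n → Field n) (hp : (Matrix.of p.1).det ≠ 0) :
    (∀ δ, fderiv ℝ (fun p' => lagrangian lam mu (fun μ ν => vol p.1 * Y μ ν) p' q) p (δ, 0) = 0) ↔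
      ∀ μ ν, metricEL lam mu p.1
        (ricciW (gammaOf p.2) (fun ρ => gammaOf (q ρ).2) (fun ρ => traceVec (q ρ).2))
        (traceVec p.2) Y μ ν = 0 := by
  constructor
  · intro h μ ν
    have h1 := h (variation p.1 (Matrix.single ν μ 1))
    rw [fderiv_lagrangian_metric lam mu Y q hp] at h1
    have h2 := (mul_eq_zero.mp h1).resolve_left (vol_pos hp).ne'
    rw [Finset.sum_eq_single μ, Finset.sum_eq_single ν] at h2
    · simpa using h2
    · intro b _ hb; simp [hb.symm]
    · simp
    · intro b _ hb
      exact Finset.sum_eq_zero fun x _ => by simp [hb.symm]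
    · simp
  · intro h δ
    obtain ⟨H, rfl⟩ := variation_surjective hp δ
    rw [fderiv_lagrangian_metric lam mu Y q hp]
    simp [h]

end

/-! ### The Euler-Lagrange equations -/

section
variable {n : ℕ}

theorem traceVec_eq_zero_iff (K : Idx n → Idx n → Idx n → ℝ) (μ : Idx n) :
    traceVec K μ = 0 ↔ ∑ ρ, K ρ μ ρ = ∑ ρ, K ρ ρ μ := by
  rw [traceVec, Finset.sum_sub_distrib]
  constructor <;> intro h <;> linarith

theorem sum_symPart_of_traceFree {K : Idx n → Idx n → Idx n → ℝ} {μ : Idx n}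
    (h : ∑ ρ, K ρ μ ρ = ∑ ρ, K ρ ρ μ) : ∑ γ, symPart (K γ) μ γ = ∑ ρ, K ρ μ ρ := by
  simp only [symPart]
  rw [← Finset.mul_sum, Finset.sum_add_distrib, ← h]; ring
end

theorem traceVec_gammaOf (h : Idx 2 → Idx 2 → Idx 2 → ℝ) (μ : Idx 2) :
    traceVec (gammaOf h) μ = 0 := by
  have e : gammaOf h = fun γ α β => h γ α β - (2 / 3) * (delta γ α * (-traceVec h β)) := by
    funext γ α β; rw [gammaOf]; ring
  rw [e, traceVec_sub_delta]
  push_cast; ring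

theorem gammaOf_of_traceFree {K : Idx 2 → Idx 2 → Idx 2 → ℝ} (h : ∀ μ, traceVec K μ = 0) :
    gammaOf K = K := by
  funext γ α β; rw [gammaOf, h, mul_zero, mul_zero, add_zero]

/-- Variations of the connection that change `W_ν` only, `h^γ_{μν} = -⅔ δ^γ_μ k_ν`. -/
theorem exists_pure_trace (k : Idx 2 → ℝ) : ∃ h, traceVec h = k ∧ gammaOf h = 0 := by
  have e := traceVec_sub_delta (n := 2) (fun _ _ _ => 0) k
  have ht : traceVec (fun γ α β => 0 - (2 / 3) * (delta γ α * k β)) = k := by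
    funext μ
    rw [e]
    simp only [traceVec, sub_self, Finset.sum_const_zero, mul_zero]
    push_cast; ring
  refine ⟨_, ht, ?_⟩
  funext γ α β
  rw [gammaOf, ht]
  simp

/-- The Euler-Lagrange equations for variations of the connection alone, where `dc ρ μ ν` stands for
`e_ρ 𝔤^{μν}`. -/
theorem connection_stationary_iff (lam mu : ℝ) (σ : Idx 2 → Idx 2 → ℝ) {p : Field 2}
    (q : Idx 2 → Field 2) (hp : (Matrix.of p.1).det ≠ 0) (dc : Idx 2 → Idx 2 → Idx 2 → ℝ) :
    (∀ h, fderiv ℝ (fun p => lagrangian lam mu σ p q) p (0, h)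
      - ∑ ρ, ∑ μ, ∑ ν, dc ρ μ ν * (gammaOf h ρ μ ν
          - 1 / 2 * (delta ν ρ * ∑ γ, symPart (gammaOf h γ) μ γ
            + delta μ ρ * ∑ γ, symPart (gammaOf h γ) ν γ)
          + 1 / 3 * (delta ν ρ * traceVec h μ - delta μ ρ * traceVec h ν)) = 0) ↔
    (∀ μ, traceEL (fun α β => vol p.1 * invMetric p.1 α β) dc (traceVec p.2) μ = 0) ∧
      ∀ σ μ ν, densityDeriv (fun α β => vol p.1 * invMetric p.1 α β) dc (gammaOf p.2) σ μ ν
        = delta ν σ * traceCov (fun α β => vol p.1 * invMetric p.1 α β) (traceVec p.2) μ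
          - delta μ σ * traceCov (fun α β => vol p.1 * invMetric p.1 α β) (traceVec p.2) ν := by
  have hfree : ∀ (h : Idx 2 → Idx 2 → Idx 2 → ℝ) μ,
      ∑ ρ, gammaOf h ρ μ ρ = ∑ ρ, gammaOf h ρ ρ μ := fun h μ =>
    (traceVec_eq_zero_iff _ _).1 (traceVec_gammaOf h μ)
  rw [← variation_eq_zero_iff (by simp) (hfree p.2)]
  have hQ : ∀ h, fderiv ℝ (fun p => lagrangian lam mu σ p q) p (0, h)
      - ∑ ρ, ∑ μ, ∑ ν, dc ρ μ ν * (gammaOf h ρ μ ν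
          - 1 / 2 * (delta ν ρ * ∑ γ, symPart (gammaOf h γ) μ γ
            + delta μ ρ * ∑ γ, symPart (gammaOf h γ) ν γ)
          + 1 / 3 * (delta ν ρ * traceVec h μ - delta μ ρ * traceVec h ν))
      = ∑ σ, ∑ μ, ∑ ν, -densityDeriv (fun α β => vol p.1 * invMetric p.1 α β) dc
            (gammaOf p.2) σ μ ν * gammaOf h σ μ ν
        + ∑ μ, densityDiv (fun α β => vol p.1 * invMetric p.1 α β) dc (gammaOf p.2) μ
            * ∑ ρ, gammaOf h ρ μ ρ
        + ∑ μ, traceEL (fun α β => vol p.1 * invMetric p.1 α β) dc (traceVec p.2) μ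
            * traceVec h μ := by
    intro h
    rw [fderiv_lagrangian_connection lam mu σ q hp h]
    have := variation_eq (fun α β => vol p.1 * invMetric p.1 α β) dc (gammaOf p.2) (gammaOf h)
      (traceVec p.2) (traceVec h) (fun α => ∑ ρ, gammaOf h ρ α ρ)
    rw [← this]
    simp only [sum_symPart_of_traceFree (hfree _ _)]
  simp only [hQ]
  constructor
  · intro H
    refine ⟨fun k => ?_, fun K hK => ?_⟩
    · obtain ⟨h, hk, hγ⟩ := exists_pure_trace k
      have := H h
      simpa [hk, hγ] using this
    · have h0 : ∀ μ, traceVec K μ = 0 := fun μ => (traceVec_eq_zero_iff K μ).2 (hK μ)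
      have := H K
      simpa only [gammaOf_of_traceFree h0, h0, mul_zero, Finset.sum_const_zero, add_zero] using this
  · rintro ⟨H1, H2⟩ h
    rw [H1, H2 _ (hfree h), add_zero]

section
variable {U : Set (Chart 2)} {N : NConnection 2}

/-- The Euler-Lagrange equations in dimension `2 + 2`, for any nondegenerate metric and any connection. -/
theorem isNStationary_iff (hU : IsOpen U) {G : Chart 2 → Idx 2 → Idx 2 → ℝ}
    (hG : SmoothMat U fun u => Matrix.of (G u)) (h0 : ∀ u ∈ U, (Matrix.of (G u)).det ≠ 0)
    {Γ W : Chart 2 → Idx 2 → Idx 2 → Idx 2 → ℝ}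
    (hW : ∀ γ μ ν, ContDiffOn ℝ ∞ (fun u => W u γ μ ν) U)
    (hΓ : ∀ u ∈ U, gammaOf (W u) = Γ u) (lam mu : ℝ) (Y : Chart 2 → Idx 2 → Idx 2 → ℝ) :
    IsNStationary N U (fun u => lagrangian lam mu (fun μ ν => vol (G u) * Y u μ ν))
      (fun u => (G u, W u)) ↔ FieldEquations N U lam mu Y G Γ W := by
  have hvol := contDiffOn_vol hG h0
  have hinv := contDiffOn_invMetric hG h0
  have hc : ∀ μ ν, ContDiffOn ℝ ∞ (fun u => vol (G u) * invMetric (G u) μ ν) U := fun μ ν =>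
    hvol.mul (hinv μ ν)
  let dc : Chart 2 → Idx 2 → Idx 2 → Idx 2 → ℝ := fun u ρ μ ν =>
    eD N ρ (fun v => vol (G v) * invMetric (G v) μ ν) u
  -- The coefficients of the derivatives of the fields are constants times `𝔤^{μν}`.
  have hdiv : ∀ u ∈ U, ∀ h : Field 2, ∑ ρ, eD N ρ (fun v => fderiv ℝ
      (fun q => lagrangian lam mu (fun μ ν => vol (G v) * Y v μ ν) (G v, W v) q)
        (jet N (fun u => (G u, W u)) v) (Pi.single ρ h)) u
      = ∑ ρ, ∑ μ, ∑ ν, dc u ρ μ ν * (gammaOf h.2 ρ μ ν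
          - 1 / 2 * (delta ν ρ * ∑ γ, symPart (gammaOf h.2 γ) μ γ
            + delta μ ρ * ∑ γ, symPart (gammaOf h.2 γ) ν γ)
          + 1 / 3 * (delta ν ρ * traceVec h.2 μ - delta μ ρ * traceVec h.2 ν)) := by
    intro u hu h
    refine Finset.sum_congr rfl fun ρ _ => ?_
    simp only [fderiv_lagrangian_jet]
    have hd := fun μ ν => differentiableAt_of_smooth hU hu (hc μ ν)
    rw [eD_sum ρ fun μ => DifferentiableAt.fun_sum fun ν _ => (hd μ ν).mul_const _]
    refine Finset.sum_congr rfl fun μ _ => ?_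
    rw [eD_sum ρ fun ν => (hd μ ν).mul_const _]
    refine Finset.sum_congr rfl fun ν _ => ?_
    rw [eD_mul ρ (hd μ ν) (differentiableAt_const _), eD_const, mul_zero, add_zero]
  -- The curvature of the jet of the fields is the curvature of the fields.
  have hjet : ∀ u ∈ U, ∀ ρ γ α β, (jet N (fun u => (G u, W u)) u ρ).2 γ α β
      = eD N ρ (fun v => W v γ α β) u := by
    intro u hu ρ γ α β
    have hGd : DifferentiableAt ℝ G u := by
      rw [differentiableAt_pi]; intro i; rw [differentiableAt_pi]; intro j
      exact differentiableAt_of_smooth hU hu (hG i j)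
    have hWd : DifferentiableAt ℝ W u := by
      rw [differentiableAt_pi]; intro i; rw [differentiableAt_pi]; intro j
      rw [differentiableAt_pi]; intro k
      exact differentiableAt_of_smooth hU hu (hW i j k)
    have h1 := (hasFDerivAt_pi'.1 (hasFDerivAt_pi'.1 (hasFDerivAt_pi'.1
      (hGd.hasFDerivAt.prodMk hWd.hasFDerivAt).snd γ) α) β).fderiv
    rw [eD, h1, jet, (hGd.hasFDerivAt.prodMk hWd.hasFDerivAt).fderiv]
    rfl
  have hWd : ∀ u ∈ U, ∀ γ α β, DifferentiableAt ℝ (fun v => W v γ α β) u := fun u hu γ α β =>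
    differentiableAt_of_smooth hU hu (hW γ α β)
  have htd : ∀ u ∈ U, ∀ α, DifferentiableAt ℝ (fun v => traceVec (W v) α) u := fun u hu α =>
    (DifferentiableAt.fun_sum fun γ _ => (hWd u hu γ α γ).fun_sub (hWd u hu γ γ α)).const_mul (1 / 2)
  have htr : ∀ u ∈ U, ∀ ρ α, traceVec (jet N (fun u => (G u, W u)) u ρ).2 α
      = eD N ρ (fun v => traceVec (W v) α) u := by
    intro u hu ρ α
    simp only [traceVec, hjet u hu]
    rw [eD_const_mul ρ _ (DifferentiableAt.fun_sum fun γ _ =>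
      (hWd u hu γ α γ).fun_sub (hWd u hu γ γ α)), eD_sum ρ fun γ => (hWd u hu γ α γ).fun_sub (hWd u hu γ γ α)]
    congr 1
    exact Finset.sum_congr rfl fun γ _ => (eD_sub ρ (hWd u hu γ α γ) (hWd u hu γ γ α)).symm
  have hgm : ∀ u ∈ U, ∀ ρ γ α β, gammaOf (jet N (fun u => (G u, W u)) u ρ).2 γ α β
      = eD N ρ (fun v => Γ v γ α β) u := by
    intro u hu ρ γ α β
    rw [eD_congr hU hu (f' := fun v => W v γ α β + (2 / 3) * (delta γ α * traceVec (W v) β))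
      (fun v hv => by rw [← hΓ v hv, gammaOf]), gammaOf, hjet u hu, htr u hu,
      eD_add ρ (hWd u hu γ α β) (((htd u hu β).const_mul _).const_mul _),
      eD_const_mul ρ _ ((htd u hu β).const_mul _), eD_const_mul ρ _ (htd u hu β)]
  have hricci : ∀ u ∈ U, ricciW (gammaOf (W u))
      (fun ρ => gammaOf (jet N (fun u => (G u, W u)) u ρ).2)
      (fun ρ => traceVec (jet N (fun u => (G u, W u)) u ρ).2) = ricciWAt N Γ W u := by
    intro u hu
    funext μ ν
    rw [ricciWAt, ← hΓ u hu]
    congr 1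
    · funext ρ γ α β; exact hgm u hu ρ γ α β
    · funext ρ α; exact htr u hu ρ α
  -- The expression is linear in the variation, so metric and connection may be varied separately.
  have hsplit : IsNStationary N U (fun u => lagrangian lam mu (fun μ ν => vol (G u) * Y u μ ν))
      (fun u => (G u, W u)) ↔ ∀ u ∈ U,
      (∀ μ ν, metricEL lam mu (G u) (ricciWAt N Γ W u) (traceVec (W u)) (Y u) μ ν = 0) ∧
      (∀ μ, traceEL (fun α β => vol (G u) * invMetric (G u) α β) (dc u) (traceVec (W u)) μ = 0) ∧
      ∀ σ μ ν, densityDeriv (fun α β => vol (G u) * invMetric (G u) α β) (dc u) (Γ u) σ μ ν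
        = delta ν σ * traceCov (fun α β => vol (G u) * invMetric (G u) α β) (traceVec (W u)) μ
          - delta μ σ * traceCov (fun α β => vol (G u) * invMetric (G u) α β) (traceVec (W u)) ν := by
    refine forall₂_congr fun u hu => ?_
    have hm := metric_stationary_iff lam mu (Y u) (p := (G u, W u))
      (jet N (fun u => (G u, W u)) u) (h0 u hu)
    have hcn := connection_stationary_iff lam mu (fun μ ν => vol (G u) * Y u μ ν)
      (p := (G u, W u)) (jet N (fun u => (G u, W u)) u) (h0 u hu) (dc u)
    simp only [hricci u hu] at hm
    simp only [hΓ u hu] at hcn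
    rw [← hm, ← hcn]
    constructor
    · intro H
      refine ⟨fun δ => ?_, fun h => ?_⟩
      · have h1 := H (δ, 0)
        rw [hdiv u hu] at h1
        have hz : gammaOf (0 : Idx 2 → Idx 2 → Idx 2 → ℝ) = 0 := by
          funext γ α β; simp [gammaOf, traceVec]
        have hz' : traceVec (0 : Idx 2 → Idx 2 → Idx 2 → ℝ) = 0 := by
          funext α; simp [traceVec]
        simpa [hz, hz', symPart] using h1
      · have h1 := H (0, h)
        rwa [hdiv u hu] at h1
    · rintro ⟨H1, H2⟩ ⟨δ, h⟩
      rw [hdiv u hu]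
      have e : ((δ, h) : Field 2) = (δ, 0) + (0, h) := by simp
      have h1 := H1 δ
      have h2 := H2 h
      rw [e, map_add]
      simp only [← e]
      rw [h1, zero_add]
      exact h2
  rw [hsplit]
  have hskew : ∀ u ∈ U, ∀ μ,
      traceEL (fun α β => vol (G u) * invMetric (G u) α β) (dc u) (traceVec (W u)) μ = 0 ↔
      2 * ∑ ν, eD N ν (fun v => vol (G v) * skewPart (invMetric (G v)) ν μ) u
        = vol (G u) * ∑ ν, symPart (invMetric (G u)) ν μ * traceVec (W u) ν := by
    intro u hu μ
    have h1 : ∀ ν, eD N ν (fun v => vol (G v) * skewPart (invMetric (G v)) ν μ) u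
        = -(1 / 2) * (dc u ν μ ν - dc u ν ν μ) := by
      intro ν
      have e : (fun v => vol (G v) * skewPart (invMetric (G v)) ν μ)
          = fun v => (1 / 2) * (vol (G v) * invMetric (G v) ν μ - vol (G v) * invMetric (G v) μ ν) := by
        funext v; rw [skewPart]; ring
      have d1 := differentiableAt_of_smooth hU hu (hc ν μ)
      have d2 := differentiableAt_of_smooth hU hu (hc μ ν)
      rw [e, eD_const_mul ν _ (d1.fun_sub d2), eD_sub ν d1 d2]
      simp only [dc]; ring
    have h2 : vol (G u) * ∑ ν, symPart (invMetric (G u)) ν μ * traceVec (W u) ν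
        = 1 / 2 * ∑ ν, (vol (G u) * invMetric (G u) μ ν + vol (G u) * invMetric (G u) ν μ)
          * traceVec (W u) ν := by
      rw [Finset.mul_sum, Finset.mul_sum]
      exact Finset.sum_congr rfl fun ν _ => by rw [symPart]; ring
    simp only [h1]
    rw [h2, ← Finset.mul_sum, traceEL]
    constructor <;> intro h <;> linarith
  have hconn : ∀ u ∈ U, ∀ μ ν σ,
      densityDeriv (fun α β => vol (G u) * invMetric (G u) α β) (dc u) (Γ u) σ μ ν
        = delta ν σ * traceCov (fun α β => vol (G u) * invMetric (G u) α β) (traceVec (W u)) μ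
          - delta μ σ * traceCov (fun α β => vol (G u) * invMetric (G u) α β) (traceVec (W u)) ν ↔
      (vol (G u))⁻¹ * eD N σ (fun v => vol (G v) * invMetric (G v) μ ν) u
      + ∑ ρ, invMetric (G u) ρ ν * W u μ ρ σ
      + ∑ ρ, invMetric (G u) μ ρ * W u ν σ ρ
      - invMetric (G u) μ ν * ∑ ρ, W u ρ σ ρ
      + 1 / 6 * ∑ β, traceVec (W u) β * (delta ν σ * symPart (invMetric (G u)) μ β
          - delta μ σ * symPart (invMetric (G u)) ν β)
      + 2 / 3 * (delta ν σ * ∑ ρ, invMetric (G u) μ ρ * traceVec (W u) ρ) = 0 := by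
    intro u hu μ ν σ
    have hv := (vol_pos (h0 u hu)).ne'
    have hWΓ : ∀ γ α β, W u γ α β = Γ u γ α β - (2 / 3) * (delta γ α * traceVec (W u) β) := by
      intro γ α β; rw [← hΓ u hu, gammaOf]; ring
    generalize traceVec (W u) = w at hWΓ ⊢
    have s1 : ∑ ρ, invMetric (G u) ρ ν * W u μ ρ σ
        = ∑ ρ, invMetric (G u) ρ ν * Γ u μ ρ σ - 2 / 3 * (invMetric (G u) μ ν * w σ) := by
      have : ∑ ρ, invMetric (G u) ρ ν * (delta μ ρ * w σ) = invMetric (G u) μ ν * w σ := by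
        simp [delta]
      rw [← this, Finset.mul_sum, ← Finset.sum_sub_distrib]
      exact Finset.sum_congr rfl fun ρ _ => by rw [hWΓ]; ring
    have s2 : ∑ ρ, invMetric (G u) μ ρ * W u ν σ ρ
        = ∑ ρ, invMetric (G u) μ ρ * Γ u ν σ ρ
          - 2 / 3 * (delta ν σ * ∑ ρ, invMetric (G u) μ ρ * w ρ) := by
      rw [Finset.mul_sum, Finset.mul_sum, ← Finset.sum_sub_distrib]
      exact Finset.sum_congr rfl fun ρ _ => by rw [hWΓ]; ring
    have s3 : ∑ ρ, W u ρ σ ρ = ∑ ρ, Γ u ρ σ ρ - 2 / 3 * w σ := by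
      have : ∑ ρ, delta ρ σ * w ρ = w σ := by simp [delta]
      rw [← this, Finset.mul_sum, ← Finset.sum_sub_distrib]
      exact Finset.sum_congr rfl fun ρ _ => by rw [hWΓ]
    have s4 : ∑ β, w β * (delta ν σ * symPart (invMetric (G u)) μ β
          - delta μ σ * symPart (invMetric (G u)) ν β)
        = delta ν σ * ∑ β, symPart (invMetric (G u)) μ β * w β
          - delta μ σ * ∑ β, symPart (invMetric (G u)) ν β * w β := by
      rw [Finset.mul_sum, Finset.mul_sum, ← Finset.sum_sub_distrib]
      exact Finset.sum_congr rfl fun ρ _ => by ring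
    have s5 : ∀ α, traceCov (fun α β => vol (G u) * invMetric (G u) α β) w α
        = -(1 / 6) * (vol (G u) * ∑ β, symPart (invMetric (G u)) α β * w β) := by
      intro α
      rw [traceCov, Finset.mul_sum, Finset.mul_sum, Finset.mul_sum]
      exact Finset.sum_congr rfl fun ρ _ => by rw [symPart]; ring
    have s6 : densityDeriv (fun α β => vol (G u) * invMetric (G u) α β) (dc u) (Γ u) σ μ ν
        = dc u σ μ ν + vol (G u) * (∑ ρ, invMetric (G u) ρ ν * Γ u μ ρ σ
          + ∑ ρ, invMetric (G u) μ ρ * Γ u ν σ ρ - invMetric (G u) μ ν * ∑ ρ, Γ u ρ σ ρ) := by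
      rw [densityDeriv]
      simp only [mul_sub, mul_add, Finset.mul_sum, mul_assoc]
      ring
    rw [s1, s2, s3, s4, s5, s5, s6]
    have hdc : eD N σ (fun v => vol (G v) * invMetric (G v) μ ν) u = dc u σ μ ν := rfl
    have hscale : ∀ X R : ℝ, X = vol (G u) * R → (X = 0 ↔ R = 0) := fun X R h => by
      rw [h, mul_eq_zero, or_iff_right hv]
    rw [hdc, ← sub_eq_zero]
    refine hscale _ _ ?_
    field_simp
    ring
  constructor
  · intro H
    refine ⟨fun u hu μ ν => ?_, fun u hu μ => (hskew u hu μ).1 ((H u hu).2.1 μ),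
      fun u hu μ ν σ => (hconn u hu μ ν σ).1 ((H u hu).2.2 σ μ ν)⟩
    exact sub_eq_zero.1 ((H u hu).1 μ ν)
  · intro H u hu
    exact ⟨fun μ ν => sub_eq_zero.2 (H.metric_eq u hu μ ν),
      fun μ => (hskew u hu μ).2 (H.skew_eq u hu μ),
      fun σ μ ν => (hconn u hu μ ν σ).2 (H.connection_eq u hu μ ν σ)⟩

end

end NGT

theorem mainTheorem8 {n k : ℕ} (U : Set (NGT.Chart n)) (hU : IsOpen U)
    (N : NGT.NConnection n) (hN : ∀ a i, ContDiffOn ℝ ∞ (fun u => N u a i) U)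
    (g a : NGT.Chart n → Matrix (Fin n) (Fin n) ℝ) (hga : NGT.IsNonsymDMetric U k g a)
    (ξ : NGT.Chart n → Matrix (Fin n) (Fin k) ℝ) (hξ : NGT.IsKernelFrame U g a ξ)
    (htype : NGT.IsEllipticOrHyperbolic U g a ξ) :
    -- for every d-connection `D`, the connection `*Γ` is a smooth N-adapted (normal) d-connection,
    -- compatible with the d-metric, and does not depend on the choice of `ξ`
    (∀ D : NGT.DConn n, D.IsSmoothOn U →
      (NGT.starConn N g a ξ D).IsSmoothOn U ∧
      NGT.IsNormalDConnection N U (NGT.starConn N g a ξ D) ∧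
      NGT.IsMetricCompatible N U (NGT.starConn N g a ξ D) (NGT.fullMetric g a) ∧
      ∀ ξ' : NGT.Chart n → Matrix (Fin n) (Fin k) ℝ, NGT.IsKernelFrame U g a ξ' → ∀ u ∈ U,
        (NGT.starConn N g a ξ' D).coeff u = (NGT.starConn N g a ξ D).coeff u) ∧
    -- in dimension 2 + 2, for a nondegenerate d-metric
    (n = 2 → (∀ u ∈ U, (g u + a u).det ≠ 0) →
      -- the Euler-Lagrange equations at `*Γ` are the field equations
      (∀ (D : NGT.DConn n) (W : NGT.Chart n → NGT.Idx n → NGT.Idx n → NGT.Idx n → ℝ),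
        D.IsSmoothOn U → (∀ γ μ ν, ContDiffOn ℝ ∞ (fun u => W u γ μ ν) U) →
        NGT.IsUnconstrainedOf U (NGT.starConn N g a ξ D).coeff W →
        (∀ u ∈ U, ∀ ν, NGT.traceVec ((NGT.starConn N g a ξ D).coeff u) ν = 0) ∧
        ∀ (lam mu : ℝ) (Y : NGT.Chart n → NGT.Idx n → NGT.Idx n → ℝ),
          NGT.IsNStationary N U
              (fun u => NGT.lagrangian lam mu
                (fun μ ν => NGT.vol (NGT.fullMetric g a u) * Y u μ ν))
              (fun u => (NGT.fullMetric g a u, W u)) ↔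
            NGT.FieldEquations N U lam mu Y (NGT.fullMetric g a)
              (NGT.starConn N g a ξ D).coeff W) ∧
      -- the connections of the theory exist and are determined by `N`, `g` and `a`
      (∃ (D : NGT.DConn n) (W : NGT.Chart n → NGT.Idx n → NGT.Idx n → NGT.Idx n → ℝ),
        D.IsSmoothOn U ∧ (∀ γ μ ν, ContDiffOn ℝ ∞ (fun u => W u γ μ ν) U) ∧
        NGT.IsUnconstrainedOf U (NGT.starConn N g a ξ D).coeff W ∧
        NGT.SkewFieldEquation N U (NGT.fullMetric g a) W) ∧
      (∀ (D D' : NGT.DConn n) (W W' : NGT.Chart n → NGT.Idx n → NGT.Idx n → NGT.Idx n → ℝ),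
        D.IsSmoothOn U → D'.IsSmoothOn U →
        NGT.IsUnconstrainedOf U (NGT.starConn N g a ξ D).coeff W →
        NGT.IsUnconstrainedOf U (NGT.starConn N g a ξ D').coeff W' →
        NGT.SkewFieldEquation N U (NGT.fullMetric g a) W →
        NGT.SkewFieldEquation N U (NGT.fullMetric g a) W' →
        ∀ u ∈ U, (NGT.starConn N g a ξ D).coeff u = (NGT.starConn N g a ξ D').coeff u ∧
          W u = W' u)) := by
  obtain ⟨-, c, -, ν, -, htype⟩ := htype
  have S : NGT.Setup U N g a ξ ν := ⟨hU, hN, hga, hξ, fun u hu => by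
    ext i j
    have := htype u hu i j
    rw [Matrix.smul_apply, smul_eq_mul, ← this]
    simp only [Matrix.mul_apply, Matrix.transpose_apply, Finset.sum_mul]
    rw [Finset.sum_comm]
    exact Finset.sum_congr rfl fun _ _ => Finset.sum_congr rfl fun _ _ => by ring⟩
  refine ⟨fun D hD => ⟨S.smooth_star D hD, NGT.isNormalDConnection hU hN (S.smooth_star D hD),
    S.star_compatible D, fun ξ' hξ' u hu => S.star_unique D (fun v hv =>
      NGT.pointFacts (hga.symm v hv) (hga.skew v hv) (hga.rank_eq v hv) (hξ'.kernel v hv)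
        (hξ'.orthonormal v hv)) hu⟩, ?_⟩
  rintro rfl hdet
  refine ⟨fun D W hD hW hun => ?_, S.exists_connections hdet,
    fun D D' W W' _ _ hun hun' hs hs' u hu => S.connections_unique hdet hun hun' hs hs' hu⟩
  have htr := fun u hu => NGT.traceVec_eq_zero_of_unconstrained hun (u := u) hu
  refine ⟨htr, fun lam mu Y => NGT.isNStationary_iff hU S.smooth_fullMetric
    (fun u hu => NGT.det_fullMetric_ne_zero hdet hu) hW (fun u hu => ?_) lam mu Y⟩
  funext γ α β
  rw [NGT.gammaOf, hun u hu]
  ring
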